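/- Let $X=SL_3(\mathbb R)/SO(3)$ be the space of unit-determinant positive definite symmetric real $3\times 3$ matrices (equivalently, unit-volume ellipsoids centered at the origin of $\mathbb R^3$). Here $T\in SL_3(\mathbb R)$ acts by $P\mapsto (T^{-1})^tPT^{-1}$, and $X$ carries the $SL_3(\mathbb R)$-invariant distance for which the round ball and the ellipsoid $x^2/a^2+y^2/b^2+z^2/c^2=1$, $abc=1$, are $\sqrt{\log^2a+\log^2b+\log^2c}$ apart. Let $\Delta(P)=P^{-1}$, and let $\mathrm{Isom}(X)$ be the group generated by $SL_3(\mathbb R)$ (the projective transformations) and $\Delta$. An elliptic polarity is a conjugate of $\Delta$ in $\mathrm{Isom}(X)$. Let $G=\mathbb Z/2*\mathbb Z/3=\langle\sigma_2,\sigma_3\rangle$. A representation $\rho:G\to\mathrm{Isom}(X)$ is normalized if $\rho(\sigma_2)$ is an elliptic polarity, $\rho(\sigma_3)$ is the rotation $$\begin{pmatrix}\cos\theta&\sin\theta&0\\-\sin\theta&\cos\theta&0\\0&0&1\end{pmatrix},\qquad \theta=2\pi/3,$$ and $\rho(\sigma_3)$ does not fix the fixed point of $\rho(\sigma_2)$.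 Let $\mathcal R$ be the set of normalized representations modulo conjugacy in $\mathrm{Isom}(X)$, with the topology of the following distance: the distance between two classes is the infimum, over normalized representatives $\rho_1,\rho_2$, of the distance in $X$ between the fixed points of $\rho_1(\sigma_2)$ and $\rho_2(\sigma_2)$. A representation is line-preserving (conic-preserving) if the projective transformations in its image preserve a common line (a common nondegenerate conic with a real point) of the real projective plane. The map sending a normalized representation to the fixed point of $\rho(\sigma_2)$ identifies the set of normalized representations with an open subset of $X$, which gives it a smooth structure. **Theorem.** 1. There is a homeomorphism $\mathcal R\to\mathbb R^3\setminus\{0\}$ that maps the set of line-preserving classes onto the ray $\{(0,0,t):t>0\}$ and the set of conic-preserving classes onto the ray $\{(0,0,-t):t>0\}$. 2. The complement $\mathcal R^\circ$ of these two curves carries the structure of a smooth $3$-manifold that is the quotient structure: a function on an open subset of $\mathcal R^\circ$ is smooth if and only if its pullback to normalized representations is smooth, and the quotient map has a smooth local section through every normalized representation whose class lies in $\mathcal R^\circ$. 3. Let $w\in G$ be a word with an even number of letters $\sigma_2$. For every normalized $\rho$ there is a unique matrix in $SL_3(\mathbb R)$ acting on $X$ as $\rho(w)$; let $\mathrm{tr}\,\rho(w)$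 be its trace. If $\rho,\rho'$ are conjugate, then $\mathrm{tr}\,\rho'(w)$ is $\mathrm{tr}\,\rho(w)$ or $\mathrm{tr}\,\rho(w^{-1})$. For every smooth local section $s$ of the quotient map over an open set $U\subset\mathcal R^\circ$, the function $x\mapsto \mathrm{tr}\,s(x)(w)$ is smooth on $U$. The functions $[\rho]\mapsto\mathrm{tr}\,\rho(w)+\mathrm{tr}\,\rho(w^{-1})$ and $[\rho]\mapsto\mathrm{tr}\,\rho(w)\cdot\mathrm{tr}\,\rho(w^{-1})$ are well defined and smooth on $\mathcal R^\circ$. If $\mathrm{tr}\,\rho(w)$ depends only on $[\rho]$ for $[\rho]\in\mathcal R^\circ$, then $[\rho]\mapsto\mathrm{tr}\,\rho(w)$ is smooth on $\mathcal R^\circ$. -/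

import Mathlib

open scoped Manifold ContDiff Topology

noncomputable section

namespace ModularSL3

abbrev Mat3 : Type := Matrix (Fin 3) (Fin 3) ℝ

abbrev SL3 : Type := Matrix.SpecialLinearGroup (Fin 3) ℝ

/-- The symmetric space `X = SL₃(ℝ)/SO(3)`: unit determinant positive definite symmetric matrices.
The matrix `P` is an inner product, and names the ellipsoid that is its unit ball. -/
abbrev X : Type := {P : Mat3 // P.PosDef ∧ P.det = 1}

/-- The unit ball of the inner product `(T⁻¹)ᵀ P T⁻¹` is the image under `T` of the unit ball of
`P`, so this is the action of `T` on ellipsoids. -/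
def actFun (T : SL3) (P : X) : X :=
  ⟨((T⁻¹ : SL3) : Mat3).transpose * P.1 * ((T⁻¹ : SL3) : Mat3), by
    have hu : IsUnit ((T⁻¹ : SL3) : Mat3) := by
      rw [Matrix.isUnit_iff_isUnit_det, Matrix.SpecialLinearGroup.det_coe]; exact isUnit_one
    refine ⟨?_, ?_⟩
    · have h := (Matrix.IsUnit.posDef_star_left_conjugate_iff (x := P.1) hu).2 P.2.1
      rwa [Matrix.star_eq_conjTranspose, Matrix.conjTranspose_eq_transpose_of_trivial] at h
    · rw [Matrix.det_mul, Matrix.det_mul, Matrix.det_transpose, P.2.2, Matrix.SpecialLinearGroup.det_coe]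
      norm_num⟩

/-- The action of `SL₃(ℝ)` on `X`; the permutations `act T` are the projective transformations. -/
def act : SL3 →* Equiv.Perm X :=
  MonoidHom.toHomPerm
    { toFun := fun T => actFun T
      map_one' := by
        funext P
        apply Subtype.ext
        change ((1⁻¹ : SL3) : Mat3).transpose * P.1 * ((1⁻¹ : SL3) : Mat3) = P.1
        simp
      map_mul' := by
        intro S T
        funext P
        apply Subtype.ext
        change (actFun (S * T) P).1 = (actFun S (actFun T P)).1
        simp only [actFun, mul_inv_rev, Matrix.SpecialLinearGroup.coe_mul, Matrix.transpose_mul,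
          Matrix.mul_assoc] }

/-- The standard polarity `S ↦ S⁻¹`. -/
def polarity : Equiv.Perm X :=
  Function.Involutive.toPerm
    (fun P : X => (⟨P.1⁻¹, P.2.1.inv, by
      rw [Matrix.det_nonsing_inv, P.2.2, Ring.inverse_one]⟩ : X))
    (by
      intro P
      apply Subtype.ext
      exact Matrix.nonsing_inv_nonsing_inv _ (by rw [P.2.2]; exact isUnit_one))

/-- `Isom(X)`, the group generated by `SL₃(ℝ)` and the standard polarity. -/
def IsomX : Subgroup (Equiv.Perm X) :=
  Subgroup.closure (Set.range act ∪ {polarity})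

/-- An elliptic polarity is a conjugate of the standard polarity in `Isom(X)`. -/
def IsEllipticPolarity (h : Equiv.Perm X) : Prop :=
  ∃ g ∈ IsomX, h = g * polarity * g⁻¹

/-- The distance of `X`: the `SL₃(ℝ)`-invariant distance for which the round ball and the ellipsoid
`x²/a² + y²/b² + z²/c² = 1`, `abc = 1`, have distance `√(log² a + log² b + log² c)`.
The eigenvalues of `P⁻¹ Q` (all positive, with multiplicity) are the inverse squares of the semiaxes
of the second ellipsoid in coordinates in which the first one is the round ball. -/
def symDist (P Q : X) : ℝ :=
  Real.sqrt (((P.1⁻¹ * Q.1).charpoly.roots.map fun t => (Real.log t / 2) ^ 2).sum)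

theorem symDist_act (T : SL3) (P Q : X) : symDist (act T P) (act T Q) = symDist P Q := by
  have hT : IsUnit ((T⁻¹ : SL3) : Mat3) := by
    rw [Matrix.isUnit_iff_isUnit_det, Matrix.SpecialLinearGroup.det_coe]; exact isUnit_one
  have hTt : IsUnit ((T⁻¹ : SL3) : Mat3).transpose.det := by
    rw [Matrix.det_transpose, Matrix.SpecialLinearGroup.det_coe]; exact isUnit_one
  have key : (act T P).1⁻¹ * (act T Q).1 =
      ((T⁻¹ : SL3) : Mat3)⁻¹ * (P.1⁻¹ * Q.1) * ((T⁻¹ : SL3) : Mat3) := by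
    change (((T⁻¹ : SL3) : Mat3).transpose * P.1 * ((T⁻¹ : SL3) : Mat3))⁻¹ *
      (((T⁻¹ : SL3) : Mat3).transpose * Q.1 * ((T⁻¹ : SL3) : Mat3)) = _
    rw [Matrix.mul_inv_rev, Matrix.mul_inv_rev]
    simp only [Matrix.mul_assoc]
    rw [Matrix.nonsing_inv_mul_cancel_left _ _ hTt]
  have key2 := Matrix.charpoly_units_conj' hT.unit (P.1⁻¹ * Q.1)
  unfold symDist
  rw [key]
  rw [← key2]
  simp

theorem symDist_diagonal (a : Fin 3 → ℝ) (P Q : X) (hP : P.1 = 1)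
    (hQ : Q.1 = Matrix.diagonal fun i => (a i ^ 2)⁻¹) :
    symDist P Q = Real.sqrt (∑ i, Real.log (a i) ^ 2) := by
  have h1 : (Matrix.diagonal fun i => (a i ^ 2)⁻¹ : Mat3).charpoly =
      ∏ i, (Polynomial.X - Polynomial.C ((a i ^ 2)⁻¹)) := by
    simpa using Matrix.charpoly_of_isUpperTriangular _
      (Matrix.blockTriangular_diagonal (fun i => (a i ^ 2)⁻¹) (b := id))
  have h2 : (∏ i : Fin 3, (Polynomial.X - Polynomial.C ((a i ^ 2)⁻¹))).roots =
      Finset.univ.val.map fun i => (a i ^ 2)⁻¹ := Polynomial.roots_multiset_prod_X_sub_C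
        (Finset.univ.val.map fun i => (a i ^ 2)⁻¹) |> fun h => by
          simpa [Finset.prod, Multiset.map_map, Function.comp_def] using h
  unfold symDist
  rw [hP, hQ, inv_one, one_mul, h1, h2, Multiset.map_map]
  congr 1
  change ∑ i, _ = _
  refine Finset.sum_congr rfl fun i _ => ?_
  simp only [Function.comp_apply, Real.log_inv, Real.log_pow]
  push_cast
  ring

/-- The modular group `ℤ/2 * ℤ/3`. -/
abbrev G : Type := Monoid.Coprod (Multiplicative (ZMod 2)) (Multiplicative (ZMod 3))

def σ₂ : G := Monoid.Coprod.inl (Multiplicative.ofAdd 1)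

def σ₃ : G := Monoid.Coprod.inr (Multiplicative.ofAdd 1)

/-- The rotation by `2π/3` about the origin of the affine patch. -/
def rot : SL3 :=
  ⟨!![Real.cos (2 * Real.pi / 3), Real.sin (2 * Real.pi / 3), 0;
      -Real.sin (2 * Real.pi / 3), Real.cos (2 * Real.pi / 3), 0;
      0, 0, 1], by
    rw [Matrix.det_fin_three]
    simp
    nlinarith [Real.sin_sq_add_cos_sq (2 * Real.pi / 3)]⟩

/-- Normalized representations. -/
structure NormRep where
  hom : G →* IsomX
  elliptic : IsEllipticPolarity (hom σ₂ : Equiv.Perm X)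
  rotation : (hom σ₃ : Equiv.Perm X) = act rot
  disjoint : ∀ p : X, (hom σ₂ : Equiv.Perm X) p = p → (hom σ₃ : Equiv.Perm X) p ≠ p

/-- Conjugacy in `Isom(X)`. -/
def conjSetoid : Setoid NormRep where
  r ρ₁ ρ₂ := ∃ g : IsomX, ∀ w : G, ρ₂.hom w = g * ρ₁.hom w * g⁻¹
  iseqv :=
    { refl := fun _ => ⟨1, fun _ => by simp⟩
      symm := by
        rintro ρ₁ ρ₂ ⟨g, h⟩
        exact ⟨g⁻¹, fun w => by rw [h w]; group⟩
      trans := by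
        rintro ρ₁ ρ₂ ρ₃ ⟨g, h⟩ ⟨k, h'⟩
        exact ⟨k * g, fun w => by rw [h' w, h w]; group⟩ }

/-- The space `𝓡` of normalized representations modulo conjugacy. -/
def RepSpace : Type := Quotient conjSetoid

def repClass (ρ : NormRep) : RepSpace := Quotient.mk conjSetoid ρ

/-- The distance on `𝓡`: the infimum of the distances between the fixed points of `ρ₁(σ₂)` and
`ρ₂(σ₂)` over all normalized representatives. -/
def repDist (x y : RepSpace) : ℝ :=
  sInf {D : ℝ | ∃ ρ₁ ρ₂ : NormRep, repClass ρ₁ = x ∧ repClass ρ₂ = y ∧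
    ∃ p q : X, (ρ₁.hom σ₂ : Equiv.Perm X) p = p ∧ (ρ₂.hom σ₂ : Equiv.Perm X) q = q ∧
      D = symDist p q}

/-- The topology of the distance `repDist`. -/
instance : TopologicalSpace RepSpace where
  IsOpen U := ∀ x ∈ U, ∃ ε > 0, ∀ y, repDist x y < ε → y ∈ U
  isOpen_univ := fun _ _ => ⟨1, one_pos, fun _ _ => trivial⟩
  isOpen_inter := by
    rintro U V hU hV x ⟨hxU, hxV⟩
    obtain ⟨ε, hε, h⟩ := hU x hxU
    obtain ⟨δ, hδ, h'⟩ := hV x hxV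
    exact ⟨min ε δ, lt_min hε hδ, fun y hy =>
      ⟨h y (hy.trans_le (min_le_left _ _)), h' y (hy.trans_le (min_le_right _ _))⟩⟩
  isOpen_sUnion := by
    rintro S hS x ⟨U, hU, hx⟩
    obtain ⟨ε, hε, h⟩ := hS U hU x hx
    exact ⟨ε, hε, fun y hy => ⟨U, hU, h y hy⟩⟩

/-- The projective transformations in the image of `ρ` preserve a common line of the projective
plane, that is, a plane through the origin of `ℝ³`. -/
def LinePreserving (ρ : NormRep) : Prop :=
  ∃ l : Submodule ℝ (Fin 3 → ℝ), Module.finrank ℝ l = 2 ∧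
    ∀ (w : G) (T : SL3), (ρ.hom w : Equiv.Perm X) = act T → l.map (Matrix.toLin' (T : Mat3)) = l

/-- The projective transformations in the image of `ρ` preserve a common conic section. A conic
section is given by a nondegenerate ternary quadratic form with a nontrivial zero, up to scale. -/
def ConicPreserving (ρ : NormRep) : Prop :=
  ∃ Q : Mat3, Q.IsSymm ∧ Q.det ≠ 0 ∧ (∃ v : Fin 3 → ℝ, v ≠ 0 ∧ v ⬝ᵥ Q.mulVec v = 0) ∧
    ∀ (w : G) (T : SL3), (ρ.hom w : Equiv.Perm X) = act T →
      ∃ c : ℝ, c ≠ 0 ∧ (T : Mat3).transpose * Q * (T : Mat3) = c • Q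

def lineCurve : Set RepSpace := {x | ∃ ρ, repClass ρ = x ∧ LinePreserving ρ}

def conicCurve : Set RepSpace := {x | ∃ ρ, repClass ρ = x ∧ ConicPreserving ρ}

/-- The complement of the two curves in `𝓡`, with the subspace topology. -/
abbrev SmoothPart : Type := {x : RepSpace // x ∉ lineCurve ∪ conicCurve}

/-- Normalized representations whose class lies in the complement of the two curves. -/
abbrev SmoothRep : Type := {ρ : NormRep // repClass ρ ∉ lineCurve ∪ conicCurve}

/-- The quotient map from representations to classes, away from the two curves. -/
def smoothClass (ρ : SmoothRep) : SmoothPart := ⟨repClass ρ.1, ρ.2⟩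

theorem NormRep.exists_fixed (ρ : NormRep) :
    ∃ p : X, (ρ.hom σ₂ : Equiv.Perm X) p = p := by
  obtain ⟨g, _, h⟩ := ρ.elliptic
  have h1 : polarity ⟨1, Matrix.PosDef.one, Matrix.det_one⟩ =
      ⟨1, Matrix.PosDef.one, Matrix.det_one⟩ := Subtype.ext (inv_one (G := Mat3))
  refine ⟨g ⟨1, Matrix.PosDef.one, Matrix.det_one⟩, ?_⟩
  rw [h, ← Equiv.Perm.mul_apply, inv_mul_cancel_right, Equiv.Perm.mul_apply, h1]

/-- The (unique) fixed point of `ρ(σ₂)`, as an array of matrix entries. Normalized representations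
correspond bijectively to the points of `X` that `rot` moves, and so inherit the smooth structure of
the submanifold `X` of the space of all real `3 × 3` matrices. -/
def fixedPoint (ρ : NormRep) : Fin 3 → Fin 3 → ℝ :=
  fun i j => (Classical.choose ρ.exists_fixed).1 i j

/-- A function `φ` of representations is smooth on `W` if it is the restriction of a smooth function
of the entries of the fixed point of `ρ(σ₂)`. -/
def SmoothOnReps (φ : SmoothRep → ℝ) (W : Set SmoothRep) : Prop :=
  ∃ F : (Fin 3 → Fin 3 → ℝ) → ℝ,
    ContDiffOn ℝ ∞ F ((fun ρ : SmoothRep => fixedPoint ρ.1) '' W) ∧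
      ∀ ρ ∈ W, F (fixedPoint ρ.1) = φ ρ

/-- `s` is a smooth section over `U` of the quotient map from representations to classes. -/
def IsSmoothSection [ChartedSpace (EuclideanSpace ℝ (Fin 3)) SmoothPart] (U : Set SmoothPart)
    (s : SmoothPart → SmoothRep) : Prop :=
  (∀ x ∈ U, smoothClass (s x) = x) ∧
    ContMDiffOn (𝓡 3) 𝓘(ℝ, Fin 3 → Fin 3 → ℝ) ∞ (fun x => fixedPoint (s x).1) U

/-- The smooth structure on the complement of the curves is the quotient one: a function is smooth if
and only if its pullback to representations is smooth, and the quotient map has smooth local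
sections through every representation (so the quotient map is a surjective submersion). -/
def IsQuotientSmoothStructure [ChartedSpace (EuclideanSpace ℝ (Fin 3)) SmoothPart] : Prop :=
  (∀ (U : Set SmoothPart) (f : SmoothPart → ℝ), IsOpen U →
    (ContMDiffOn (𝓡 3) 𝓘(ℝ, ℝ) ∞ f U ↔
      SmoothOnReps (fun ρ => f (smoothClass ρ)) (smoothClass ⁻¹' U))) ∧
  ∀ ρ : SmoothRep, ∃ (U : Set SmoothPart) (s : SmoothPart → SmoothRep),
    IsOpen U ∧ smoothClass ρ ∈ U ∧ IsSmoothSection U s ∧ s (smoothClass ρ) = ρ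

/-- Words with an even number of letters `σ₂`, which correspond to projective transformations. -/
def IsEvenWord (w : G) : Prop :=
  Monoid.Coprod.lift (MonoidHom.id (Multiplicative (ZMod 2)))
    (1 : Multiplicative (ZMod 3) →* Multiplicative (ZMod 2)) w = 1

open Classical in
/-- The trace of the matrix in `SL₃(ℝ)` that acts on `X` as `ρ(w)` (and `0` if there is none). -/
def wordTrace (ρ : NormRep) (w : G) : ℝ :=
  if h : ∃ T : SL3, (ρ.hom w : Equiv.Perm X) = act T then
    Matrix.trace ((Classical.choose h : SL3) : Mat3) else 0

end ModularSL3

end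

noncomputable section

namespace ModularSL3

/-! ### The isometry group -/

/-! A normalized representation is determined by the fixed point P of ρ(σ₂), and P can be any point
of X that `rot` moves: `Isom(X)` is SL₃(ℝ) extended by `polarity`, and its elliptic polarities are
exactly the `sym P`. Conjugacy becomes the action on these points of the centralizer `commRot` of
the rotation. This centralizer consists of the `spin`s (a similarity of the plane with the
compensating factor on the axis) and their products with `polarity` (`repClass_eq_iff`,
`mem_commRot_iff`, `exists_eq_spin`).

A spin brings P to `normalForm n u v` with n ≥ 0 (`exists_normalForm`). For n > 0 the only
identification left is (u, v) ~ (-u, -v), which comes from `polarity`. For n = 0 the rotations about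
the axis remain, and only r = √(u² + v²) matters. The points fixed by `rot` have n = u = v = 0. So
an orbit is given by a = n², r and the direction of (u + iv)². The map `invMap` has horizontal part
2a(u + iv)²/r and height r² - a². On the quarter plane r, a ≥ 0 this is the squaring (r + ia)²,
which opens it to a half plane, and turning by the direction of (u + iv)² sweeps out ℝ³.

The edges a = 0 and r = 0 become the two halves of the vertical axis, and they are the two curves. A
common line must be the plane orthogonal to the axis, and P must preserve it, so n = 0
(`linePreserving_iff`). A common conic must have the form diag(α, α, β), and so must its transform
by P⁻¹, which forces u = v = 0 (`ConicPreserving.inv_eq_zero`, `conicPreserving_of_fix_eq`).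

Since `invMap` is an expression in the entries of P, it is continuous on X and smooth off the axis.
It separates the orbits (`exists_mem_commRot_of_invMap_eq`), and properness makes the bijection a
homeomorphism (`invHomeo`). Off the axis, solving for (n, u, v) with a smooth choice of square root
gives local sections (`exists_section_invMap`), hence the quotient smooth structure. The matrix of a
word is polynomial in the entries of P (`exists_smooth_word`), so traces are smooth. A conjugation
that involves `polarity` replaces T by its contragredient, whose trace is tr T⁻¹, so symmetric
functions of the two traces descend (`wordTrace_conj`). -/

theorem act_apply_coe (T : SL3) (P : X) :
    (act T P).1 = ((T⁻¹ : SL3) : Mat3).transpose * P.1 * ((T⁻¹ : SL3) : Mat3) := rfl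

theorem polarity_apply_coe (P : X) : (polarity P).1 = P.1⁻¹ := rfl

theorem X.transpose_eq (P : X) : P.1.transpose = P.1 := by
  have := P.2.1.isHermitian
  rwa [Matrix.IsHermitian, Matrix.conjTranspose_eq_transpose_of_trivial] at this

theorem X.apply_comm (P : X) (i j : Fin 3) : P.1 i j = P.1 j i := by
  conv_lhs => rw [← X.transpose_eq P]
  rfl

/-- A point of `X` as an element of `SL₃(ℝ)`. -/
def X.toSL (P : X) : SL3 := ⟨P.1, P.2.2⟩

@[simp] theorem X.coe_toSL (P : X) : (P.toSL : Mat3) = P.1 := rfl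

theorem SL3.coe_inv (T : SL3) : ((T⁻¹ : SL3) : Mat3) = (T : Mat3)⁻¹ := by
  rw [Matrix.inv_def, Matrix.SpecialLinearGroup.det_coe, Ring.inverse_one, one_smul,
    Matrix.SpecialLinearGroup.coe_inv]

/-- The contragredient automorphism of `SL₃(ℝ)`. -/
def contra : SL3 →* SL3 where
  toFun T := T⁻¹.transpose
  map_one' := Subtype.ext (by simp)
  map_mul' S T := Subtype.ext (by
    rw [mul_inv_rev, Matrix.SpecialLinearGroup.coe_mul]
    simp only [Matrix.SpecialLinearGroup.coe_transpose, Matrix.SpecialLinearGroup.coe_mul,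
      Matrix.transpose_mul])

theorem coe_contra (T : SL3) : (contra T : Mat3) = ((T⁻¹ : SL3) : Mat3).transpose := rfl

theorem polarity_mul_polarity : polarity * polarity = 1 := by
  ext1 P
  exact Function.Involutive.toPerm_involutive (f := fun P : X => polarity P) _ P

theorem polarity_inv : polarity⁻¹ = polarity :=
  inv_eq_of_mul_eq_one_right polarity_mul_polarity

/-- The inverse of (T⁻¹)ᵗPT⁻¹ is TP⁻¹Tᵗ. So the polarity normalizes the image of SL₃(ℝ), and every
product of generators can be brought to the form `act T` or `act T * polarity`. -/
theorem polarity_mul_act (T : SL3) : polarity * act T = act (contra T) * polarity := by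
  ext1 P
  apply Subtype.ext
  change (act T P).1⁻¹ = (act (contra T) (polarity P)).1
  rw [act_apply_coe, act_apply_coe, polarity_apply_coe, ← map_inv, coe_contra, inv_inv,
    Matrix.mul_inv_rev, Matrix.mul_inv_rev, Matrix.transpose_transpose, ← SL3.coe_inv, inv_inv,
    Matrix.mul_assoc, ← Matrix.transpose_nonsing_inv, ← SL3.coe_inv, inv_inv]

theorem act_mem (T : SL3) : act T ∈ IsomX := Subgroup.subset_closure (Or.inl ⟨T, rfl⟩)

theorem polarity_mem : polarity ∈ IsomX := Subgroup.subset_closure (Or.inr rfl)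

theorem mem_IsomX_iff (g : Equiv.Perm X) :
    g ∈ IsomX ↔ ∃ T, g = act T ∨ g = act T * polarity := by
  constructor
  · intro h
    induction h using Subgroup.closure_induction with
    | mem x hx =>
      rcases hx with ⟨T, rfl⟩ | rfl
      · exact ⟨T, Or.inl rfl⟩
      · exact ⟨1, Or.inr (by simp)⟩
    | one => exact ⟨1, Or.inl (by simp)⟩
    | mul x y _ _ hx hy =>
      obtain ⟨S, rfl | rfl⟩ := hx <;> obtain ⟨T, rfl | rfl⟩ := hy
      · exact ⟨S * T, Or.inl (by simp)⟩
      · exact ⟨S * T, Or.inr (by simp [mul_assoc])⟩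
      · exact ⟨S * contra T, Or.inr (by rw [mul_assoc, polarity_mul_act, map_mul, mul_assoc])⟩
      · refine ⟨S * contra T, Or.inl ?_⟩
        rw [mul_assoc, ← mul_assoc polarity, polarity_mul_act, mul_assoc, polarity_mul_polarity,
          mul_one, map_mul]
    | inv x _ hx =>
      obtain ⟨S, rfl | rfl⟩ := hx
      · exact ⟨S⁻¹, Or.inl (by simp)⟩
      · exact ⟨contra S⁻¹, Or.inr (by rw [mul_inv_rev, polarity_inv, ← map_inv, polarity_mul_act])⟩
  · rintro ⟨T, rfl | rfl⟩
    · exact act_mem T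
    · exact mul_mem (act_mem T) polarity_mem

/-- The round ball. -/
def X.base : X := ⟨1, Matrix.PosDef.one, Matrix.det_one⟩

theorem posDef_diagonal_three {a b c : ℝ} (ha : 0 < a) (hb : 0 < b) (hc : 0 < c) :
    (Matrix.diagonal ![a, b, c] : Mat3).PosDef := by
  refine Matrix.PosDef.diagonal ?_
  intro i
  fin_cases i <;> simpa

/-- The ellipsoid `a x² + b y² + c z² = 1`. -/
def X.diag (a b c : ℝ) (ha : 0 < a) (hb : 0 < b) (hc : 0 < c) (h : a * b * c = 1) : X :=
  ⟨Matrix.diagonal ![a, b, c], posDef_diagonal_three ha hb hc, by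
    simp [Matrix.det_diagonal, Fin.prod_univ_three, h]⟩

/-! ### Faithfulness of the action. -/

theorem transpose_mul_self_of_act_base {T : SL3} (h : act T X.base = X.base) :
    (T : Mat3).transpose * (T : Mat3) = 1 := by
  have h1 : act T⁻¹ X.base = X.base := by
    rw [map_inv]
    conv_lhs => rw [← h]
    exact Equiv.symm_apply_apply _ _
  have := congrArg Subtype.val h1
  rw [act_apply_coe, inv_inv] at this
  simpa [X.base] using this

/-- Such a T would fix the round ball, hence be orthogonal and preserve traces. But diag(2, 2, 1/4)
and its inverse have traces 17/4 and 5. -/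
theorem polarity_ne_act (T : SL3) : polarity ≠ act T := by
  intro h
  have h0 : act T X.base = X.base := by
    rw [← h]
    exact Subtype.ext (inv_one (G := Mat3))
  have h1 : act T⁻¹ X.base = X.base := by
    rw [map_inv]
    conv_lhs => rw [← h0]
    exact Equiv.symm_apply_apply _ _
  have hT := transpose_mul_self_of_act_base h1
  have h2 := congrArg Subtype.val (congrArg (fun g : Equiv.Perm X => g
    (X.diag 2 2 (1 / 4) (by norm_num) (by norm_num) (by norm_num) (by norm_num))) h)
  simp only [polarity_apply_coe, act_apply_coe] at h2
  have h3 := congrArg Matrix.trace h2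
  have hT' : ((T⁻¹ : SL3) : Mat3) * ((T⁻¹ : SL3) : Mat3).transpose = 1 :=
    mul_eq_one_comm.1 hT
  rw [Matrix.mul_assoc, Matrix.trace_mul_comm, Matrix.mul_assoc, hT', mul_one] at h3
  simp only [X.diag] at h3
  have hi : (Matrix.diagonal ![2, 2, 1 / 4] : Mat3)⁻¹ = Matrix.diagonal ![1 / 2, 1 / 2, 4] := by
    apply Matrix.inv_eq_left_inv
    rw [Matrix.diagonal_mul_diagonal, ← Matrix.diagonal_one]
    congr 1
    ext i
    fin_cases i <;> norm_num
  rw [hi, Matrix.trace_diagonal, Matrix.trace_diagonal, Fin.sum_univ_three,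
    Fin.sum_univ_three] at h3
  simp at h3
  norm_num at h3

/-- Fixing the round ball makes T orthogonal, so T commutes with every P. A diagonal P with distinct
entries makes T diagonal, one further P makes it scalar, and 1 is the only real cube root of 1. -/
theorem act_eq_one {T : SL3} (h : act T = 1) : T = 1 := by
  have key : ∀ P : X, (T : Mat3).transpose * P.1 * (T : Mat3) = P.1 := by
    intro P
    have h1 : act T⁻¹ P = P := by rw [map_inv, h, inv_one]; rfl
    have := congrArg Subtype.val h1
    rwa [act_apply_coe, inv_inv] at this
  have h1 : (T : Mat3) * (T : Mat3).transpose = 1 := by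
    have := key X.base
    simp only [X.base, mul_one] at this
    exact mul_eq_one_comm.1 this
  have hc : ∀ P : X, P.1 * (T : Mat3) = (T : Mat3) * P.1 := by
    intro P
    have := congrArg (fun M => (T : Mat3) * M) (key P)
    simp only [← Matrix.mul_assoc, h1, one_mul] at this
    exact this
  have e1 := hc (X.diag 2 3 (1 / 6) (by norm_num) (by norm_num) (by norm_num) (by norm_num))
  -- A Gram matrix of a unipotent matrix has determinant 1; this one has no zero entry off the
  -- diagonal, so a diagonal matrix commuting with it is scalar.
  let Q : X := ⟨!![1, 1, 1; 1, 2, 2; 1, 2, 3], by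
    have hQ : (!![1, 1, 1; 1, 2, 2; 1, 2, 3] : Mat3) =
        (!![1, 1, 1; 0, 1, 1; 0, 0, 1] : Mat3).conjTranspose * !![1, 1, 1; 0, 1, 1; 0, 0, 1] := by
      ext i j
      fin_cases i <;> fin_cases j <;> simp [Matrix.mul_apply, Fin.sum_univ_three] <;> norm_num
    rw [hQ]
    apply Matrix.PosDef.conjTranspose_mul_self
    apply Matrix.mulVec_injective_of_isUnit
    rw [Matrix.isUnit_iff_isUnit_det, Matrix.det_fin_three]
    simp, by
    rw [Matrix.det_fin_three]; simp; norm_num⟩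
  have e2 := hc Q
  have hd := T.2
  rw [Matrix.det_fin_three] at hd
  have f := fun i j => congrFun (congrFun e1 i) j
  have g := fun i j => congrFun (congrFun e2 i) j
  have f01 := f 0 1
  have f02 := f 0 2
  have f10 := f 1 0
  have f12 := f 1 2
  have f20 := f 2 0
  have f21 := f 2 1
  have g01 := g 0 1
  have g02 := g 0 2
  simp [X.diag, Q, Matrix.mul_apply, Fin.sum_univ_three] at f01 f02 f10 f12 f20 f21 g01 g02
  have t01 : T.1 0 1 = 0 := by linarith
  have t02 : T.1 0 2 = 0 := by linarith
  have t10 : T.1 1 0 = 0 := by linarith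
  have t12 : T.1 1 2 = 0 := by linarith
  have t20 : T.1 2 0 = 0 := by linarith
  have t21 : T.1 2 1 = 0 := by linarith
  have a1 : T.1 1 1 = T.1 0 0 := by linarith
  have a2 : T.1 2 2 = T.1 0 0 := by linarith
  rw [t01, t02, t10, t12, t20, a1, a2] at hd
  have t00 : T.1 0 0 = 1 := by
    have : (T.1 0 0 - 1) * (T.1 0 0 ^ 2 + T.1 0 0 + 1) = 0 := by linarith
    rcases mul_eq_zero.1 this with h | h
    · linarith
    · nlinarith [sq_nonneg (T.1 0 0 + 1 / 2)]
  apply Subtype.ext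
  ext i j
  fin_cases i <;> fin_cases j <;> simp_all

theorem act_injective : Function.Injective act :=
  (injective_iff_map_eq_one act).2 fun _ => act_eq_one

theorem act_ne_act_mul_polarity (S T : SL3) : act S ≠ act T * polarity := by
  intro h
  refine polarity_ne_act (T⁻¹ * S) ?_
  rw [map_mul, h, map_inv, inv_mul_cancel_left]

/-- The polarity with fixed point `P`. -/
def sym (P : X) : Equiv.Perm X := act P.toSL⁻¹ * polarity

theorem sym_base : sym X.base = polarity := by
  have : X.base.toSL = 1 := rfl
  rw [sym, this]
  simp

theorem conj_act_sym (T : SL3) (P : X) : act T * sym P * (act T)⁻¹ = sym (act T P) := by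
  rw [sym, sym, ← map_inv, ← mul_assoc, mul_assoc, polarity_mul_act, ← mul_assoc, ← map_mul,
    ← map_mul]
  congr 2
  apply inv_injective
  apply Subtype.ext
  rw [inv_inv, mul_inv_rev, mul_inv_rev, inv_inv, ← map_inv, inv_inv]
  simp only [Matrix.SpecialLinearGroup.coe_mul, coe_contra, X.coe_toSL, act_apply_coe,
    Matrix.mul_assoc]

theorem conj_polarity_sym (P : X) : polarity * sym P * polarity⁻¹ = sym (polarity P) := by
  rw [sym, sym, polarity_inv, ← mul_assoc, mul_assoc, polarity_mul_polarity, mul_one,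
    polarity_mul_act]
  congr 2
  apply inv_injective
  apply Subtype.ext
  rw [inv_inv, ← map_inv, inv_inv, coe_contra, X.coe_toSL, polarity_apply_coe, SL3.coe_inv,
    Matrix.transpose_nonsing_inv, X.coe_toSL, X.transpose_eq]

/-- This equivariance turns conjugation of polarities into motion of their fixed points. -/
theorem conj_sym {g : Equiv.Perm X} (hg : g ∈ IsomX) (P : X) : g * sym P * g⁻¹ = sym (g P) := by
  obtain ⟨T, rfl | rfl⟩ := (mem_IsomX_iff g).1 hg
  · exact conj_act_sym T P
  · have : act T * polarity * sym P * (act T * polarity)⁻¹ =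
        act T * (polarity * sym P * polarity⁻¹) * (act T)⁻¹ := by group
    rw [this, conj_polarity_sym, conj_act_sym]
    rfl

/-- A fixed point satisfies Q² = 1, so (Q + 1)(Q - 1) = 0, and Q + 1 is positive definite, hence
invertible. -/
theorem polarity_eq_self {Q : X} (h : polarity Q = Q) : Q = X.base := by
  have h1 : Q.1 * Q.1 = 1 := by
    have := congrArg Subtype.val h
    rw [polarity_apply_coe] at this
    nth_rewrite 1 [← this]
    exact Matrix.nonsing_inv_mul _ (by rw [Q.2.2]; exact isUnit_one)
  have h2 : IsUnit (Q.1 + 1) := (Q.2.1.add Matrix.PosDef.one).isUnit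
  apply Subtype.ext
  change Q.1 = 1
  have h3 : (Q.1 + 1) * (Q.1 - 1) = 0 := by
    rw [add_mul, mul_sub, h1, one_mul, mul_one]
    abel
  exact sub_eq_zero.1 ((h2.mul_right_eq_zero).1 h3)

open scoped MatrixOrder in
theorem posSemidef_exists_eq_transpose_mul_self {P : Mat3} (hP : P.PosSemidef) :
    ∃ B : Mat3, P = B.transpose * B := by
  obtain ⟨B, hB⟩ := CStarAlgebra.nonneg_iff_eq_star_mul_self.1 hP.nonneg
  exact ⟨B, by rw [hB, Matrix.star_eq_conjTranspose, Matrix.conjTranspose_eq_transpose_of_trivial]⟩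

theorem X.exists_act_base (P : X) : ∃ T, P = act T X.base := by
  obtain ⟨B, hB⟩ := posSemidef_exists_eq_transpose_mul_self P.2.1.posSemidef
  have hd : B.det * B.det = 1 := by
    have := P.2.2
    rwa [hB, Matrix.det_mul, Matrix.det_transpose] at this
  -- In odd dimension, passing from B to -B corrects the sign of the determinant and leaves BᵗB
  -- unchanged.
  obtain ⟨S, hS⟩ : ∃ S : SL3, P.1 = (S : Mat3).transpose * (S : Mat3) := by
    rcases mul_self_eq_one_iff.1 hd with h | h
    · exact ⟨⟨B, h⟩, hB⟩
    · refine ⟨⟨-B, ?_⟩, ?_⟩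
      · rw [Matrix.det_neg, h]; norm_num
      · simpa using hB
  refine ⟨S⁻¹, Subtype.ext ?_⟩
  rw [act_apply_coe, inv_inv, hS]
  simp [X.base]

theorem isEllipticPolarity_iff (h : Equiv.Perm X) : IsEllipticPolarity h ↔ ∃ P, h = sym P := by
  constructor
  · rintro ⟨g, hg, rfl⟩
    exact ⟨g X.base, by rw [← conj_sym hg, sym_base]⟩
  · rintro ⟨P, rfl⟩
    obtain ⟨T, rfl⟩ := X.exists_act_base P
    exact ⟨act T, act_mem T, by rw [← conj_act_sym, sym_base]⟩

theorem sym_apply_eq_iff (P Q : X) : sym P Q = Q ↔ Q = P := by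
  obtain ⟨T, rfl⟩ := X.exists_act_base P
  rw [← conj_act_sym, sym_base, Equiv.Perm.mul_apply, Equiv.Perm.mul_apply]
  constructor
  · intro h
    have h1 : polarity ((act T)⁻¹ Q) = (act T)⁻¹ Q := by
      rw [Equiv.Perm.eq_inv_iff_eq, h]
    rw [← polarity_eq_self h1, ← Equiv.Perm.mul_apply, mul_inv_cancel, Equiv.Perm.one_apply]
  · rintro rfl
    rw [← Equiv.Perm.mul_apply (act T)⁻¹, inv_mul_cancel, Equiv.Perm.one_apply]
    congr 1
    exact Subtype.ext (inv_one (G := Mat3))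

theorem sym_mem (P : X) : sym P ∈ IsomX := mul_mem (act_mem _) polarity_mem

theorem sym_mul_sym (P : X) : sym P * sym P = 1 := by
  obtain ⟨T, rfl⟩ := X.exists_act_base P
  rw [← conj_act_sym, sym_base]
  rw [mul_assoc, mul_assoc, ← mul_assoc (act T)⁻¹, ← mul_assoc (act T)⁻¹, inv_mul_cancel, one_mul,
    ← mul_assoc polarity, polarity_mul_polarity, one_mul, mul_inv_cancel]


/-! ### Representations and their fixed points -/

theorem cos_two_pi_div_three : Real.cos (2 * Real.pi / 3) = -1 / 2 := by
  have : 2 * Real.pi / 3 = Real.pi - Real.pi / 3 := by ring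
  rw [this, Real.cos_pi_sub, Real.cos_pi_div_three]
  norm_num

theorem sin_two_pi_div_three : Real.sin (2 * Real.pi / 3) = √3 / 2 := by
  have : 2 * Real.pi / 3 = Real.pi - Real.pi / 3 := by ring
  rw [this, Real.sin_pi_sub, Real.sin_pi_div_three]

theorem coe_rot : (rot : Mat3) = !![-1 / 2, √3 / 2, 0; -(√3 / 2), -1 / 2, 0; 0, 0, 1] := by
  rw [← cos_two_pi_div_three, ← sin_two_pi_div_three]
  rfl

theorem coe_rot_inv : ((rot⁻¹ : SL3) : Mat3) = (rot : Mat3).transpose := by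
  rw [SL3.coe_inv]
  apply Matrix.inv_eq_left_inv
  have h3 : √3 * √3 = 3 := Real.mul_self_sqrt (by norm_num)
  rw [coe_rot]
  ext i j
  fin_cases i <;> fin_cases j <;>
    simp [Matrix.mul_apply, Fin.sum_univ_three] <;> nlinarith

theorem contra_rot : contra rot = rot := by
  apply Subtype.ext
  rw [coe_contra, coe_rot_inv, Matrix.transpose_transpose]

theorem rot_pow_three : rot ^ 3 = 1 := by
  have h3 : √3 * √3 = 3 := Real.mul_self_sqrt (by norm_num)
  have h2 : rot * rot = rot⁻¹ := by
    apply Subtype.ext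
    rw [Matrix.SpecialLinearGroup.coe_mul, coe_rot_inv, coe_rot]
    ext i j
    fin_cases i <;> fin_cases j <;>
      simp [Matrix.mul_apply, Fin.sum_univ_three] <;> nlinarith
  rw [pow_succ, pow_two, h2, inv_mul_cancel]

/-- The homomorphism of a cyclic group given by an element of suitable order. -/
def zmodHom {H : Type*} [Group H] (n : ℕ) (h : H) (hn : h ^ n = 1) :
    Multiplicative (ZMod n) →* H :=
  AddMonoidHom.toMultiplicativeLeft
    (ZMod.lift n ⟨AddMonoidHom.toMultiplicativeLeft.symm (zpowersHom H h), by
      simpa using congrArg Additive.ofMul hn⟩)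

theorem zmodHom_one {H : Type*} [Group H] (n : ℕ) (h : H) (hn : h ^ n = 1) :
    zmodHom n h hn (Multiplicative.ofAdd 1) = h := by
  have := ZMod.lift_coe n ⟨AddMonoidHom.toMultiplicativeLeft.symm (zpowersHom H h), by
      simpa using congrArg Additive.ofMul hn⟩ 1
  simp only [Int.cast_one] at this
  change Additive.toMul (ZMod.lift n _ (1 : ZMod n)) = h
  rw [this]
  simp

theorem zmod_eq_pow {n : ℕ} [NeZero n] (m : Multiplicative (ZMod n)) :
    m = Multiplicative.ofAdd 1 ^ (Multiplicative.toAdd m).val := by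
  rw [← ofAdd_nsmul]
  simp

theorem closure_generators : Subgroup.closure {σ₂, σ₃} = (⊤ : Subgroup G) := by
  rw [eq_top_iff]
  intro w _
  induction w using Monoid.Coprod.induction_on with
  | inl m =>
    rw [zmod_eq_pow m, map_pow]
    exact Subgroup.pow_mem _ (Subgroup.subset_closure (by simp [σ₂])) _
  | inr m =>
    rw [zmod_eq_pow m, map_pow]
    exact Subgroup.pow_mem _ (Subgroup.subset_closure (by simp [σ₃])) _
  | mul x y hx hy => exact mul_mem (hx trivial) (hy trivial)

theorem G_hom_ext {H : Type*} [Group H] {f g : G →* H} (h2 : f σ₂ = g σ₂) (h3 : f σ₃ = g σ₃) :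
    f = g := by
  have : Subgroup.closure {σ₂, σ₃} ≤ f.eqLocus g := by
    rw [Subgroup.closure_le]
    rintro x (rfl | rfl)
    · exact h2
    · exact h3
  rw [closure_generators] at this
  apply Monoid.Coprod.hom_ext <;> exact MonoidHom.ext fun x => this (Subgroup.mem_top _)

/-- The fixed point of `ρ(σ₂)`. -/
def NormRep.fix (ρ : NormRep) : X := Classical.choose ρ.exists_fixed

theorem NormRep.hom_two_fix (ρ : NormRep) : (ρ.hom σ₂ : Equiv.Perm X) ρ.fix = ρ.fix :=
  Classical.choose_spec ρ.exists_fixed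

theorem NormRep.hom_two (ρ : NormRep) : (ρ.hom σ₂ : Equiv.Perm X) = sym ρ.fix := by
  obtain ⟨P, hP⟩ := (isEllipticPolarity_iff _).1 ρ.elliptic
  have h := ρ.hom_two_fix
  rw [hP, sym_apply_eq_iff] at h
  rw [hP, h]

theorem NormRep.hom_two_apply_eq_iff (ρ : NormRep) (P : X) :
    (ρ.hom σ₂ : Equiv.Perm X) P = P ↔ P = ρ.fix := by
  rw [ρ.hom_two, sym_apply_eq_iff]

theorem NormRep.rot_fix_ne (ρ : NormRep) : act rot ρ.fix ≠ ρ.fix := by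
  rw [← ρ.rotation]
  exact ρ.disjoint _ ρ.hom_two_fix

/-- The image of `σ₃` is prescribed and that of `σ₂` is the polarity at the fixed point, so the
fixed point determines ρ on generators. -/
theorem NormRep.ext_fix {ρ₁ ρ₂ : NormRep} (h : ρ₁.fix = ρ₂.fix) : ρ₁ = ρ₂ := by
  have : ρ₁.hom = ρ₂.hom := by
    apply G_hom_ext
    · apply Subtype.ext; rw [ρ₁.hom_two, ρ₂.hom_two, h]
    · apply Subtype.ext; rw [ρ₁.rotation, ρ₂.rotation]
  cases ρ₁; cases ρ₂; congr

/-- The points of `X` that are moved by the rotation. -/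
abbrev Moved : Type := {P : X // act rot P ≠ P}

/-- The normalized representation with a given fixed point. -/
def Moved.rep (P : Moved) : NormRep := by
  refine
    { hom := Monoid.Coprod.lift
        (zmodHom 2 ⟨sym P.1, sym_mem _⟩ (by
          apply Subtype.ext; simp [pow_two, sym_mul_sym]))
        (zmodHom 3 ⟨act rot, act_mem _⟩ (by
          apply Subtype.ext
          change act rot ^ 3 = 1
          rw [← map_pow, rot_pow_three, map_one]))
      elliptic := ?_
      rotation := ?_
      disjoint := ?_ }
  · rw [isEllipticPolarity_iff]
    refine ⟨P.1, ?_⟩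
    rw [σ₂, Monoid.Coprod.lift_apply_inl, zmodHom_one]
  · rw [σ₃, Monoid.Coprod.lift_apply_inr, zmodHom_one]
  · intro p hp
    rw [σ₂, Monoid.Coprod.lift_apply_inl, zmodHom_one, sym_apply_eq_iff] at hp
    rw [σ₃, Monoid.Coprod.lift_apply_inr, zmodHom_one, hp]
    exact P.2

@[simp] theorem Moved.fix_rep (P : Moved) : P.rep.fix = P.1 := by
  symm
  rw [← NormRep.hom_two_apply_eq_iff]
  change (Monoid.Coprod.lift _ _ σ₂ : IsomX).1 P.1 = P.1
  rw [σ₂, Monoid.Coprod.lift_apply_inl, zmodHom_one, sym_apply_eq_iff]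

/-- The point that is fixed by `ρ(σ₂)`, as a point moved by the rotation. -/
def NormRep.moved (ρ : NormRep) : Moved := ⟨ρ.fix, ρ.rot_fix_ne⟩

@[simp] theorem NormRep.rep_moved (ρ : NormRep) : ρ.moved.rep = ρ :=
  NormRep.ext_fix (Moved.fix_rep _)

/-- The class of the representation with a given fixed point. -/
def Moved.cls (P : Moved) : RepSpace := repClass P.rep

theorem NormRep.cls_moved (ρ : NormRep) : ρ.moved.cls = repClass ρ := by
  rw [Moved.cls, ρ.rep_moved]

theorem Moved.cls_surjective : Function.Surjective Moved.cls := by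
  intro x
  induction x using Quotient.inductionOn with
  | _ ρ => exact ⟨ρ.moved, ρ.cls_moved⟩

/-! ### Conjugacy as the action of the centralizer of the rotation. -/

/-- Elements that commute with the rotation. -/
def commRot : Subgroup (Equiv.Perm X) := IsomX ⊓ Subgroup.centralizer {act rot}

theorem mem_commRot_iff (g : Equiv.Perm X) :
    g ∈ commRot ↔ ∃ T, rot * T = T * rot ∧ (g = act T ∨ g = act T * polarity) := by
  rw [commRot, Subgroup.mem_inf, mem_IsomX_iff, Subgroup.mem_centralizer_singleton_iff]
  have hp : polarity * act rot = act rot * polarity := by rw [polarity_mul_act, contra_rot]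
  constructor
  · rintro ⟨⟨T, rfl | rfl⟩, h⟩
    · exact ⟨T, act_injective (by rw [map_mul, map_mul, h]), Or.inl rfl⟩
    · refine ⟨T, act_injective ?_, Or.inr rfl⟩
      rw [mul_assoc, hp, ← mul_assoc, ← mul_assoc] at h
      rw [map_mul, map_mul, mul_right_cancel h]
  · rintro ⟨T, hT, rfl | rfl⟩
    · exact ⟨⟨T, Or.inl rfl⟩, by rw [← map_mul, ← map_mul, hT]⟩
    · refine ⟨⟨T, Or.inr rfl⟩, ?_⟩
      rw [mul_assoc, hp, ← mul_assoc, ← mul_assoc, ← map_mul, ← map_mul, hT]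

/-- Comparing the images of `σ₃` shows that a conjugator commutes with the rotation; comparing those
of `σ₂` shows that it carries one fixed point to the other. Conversely, agreement on the two
generators suffices. -/
theorem repClass_eq_iff (ρ₁ ρ₂ : NormRep) :
    repClass ρ₁ = repClass ρ₂ ↔ ∃ g ∈ commRot, ρ₂.fix = g ρ₁.fix := by
  have : repClass ρ₁ = repClass ρ₂ ↔ ∃ g : IsomX, ∀ w : G, ρ₂.hom w = g * ρ₁.hom w * g⁻¹ :=
    Quotient.eq (r := conjSetoid)
  rw [this]
  constructor
  · rintro ⟨g, hg⟩
    refine ⟨g.1, ?_, ?_⟩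
    · rw [commRot, Subgroup.mem_inf, Subgroup.mem_centralizer_singleton_iff]
      refine ⟨g.2, ?_⟩
      have h3 := congrArg Subtype.val (hg σ₃)
      rw [ρ₂.rotation] at h3
      change _ = g.1 * (ρ₁.hom σ₃).1 * g.1⁻¹ at h3
      rw [ρ₁.rotation] at h3
      exact (eq_mul_inv_iff_mul_eq.1 h3).symm
    · have h2 := congrArg Subtype.val (hg σ₂)
      rw [ρ₂.hom_two] at h2
      change _ = g.1 * (ρ₁.hom σ₂).1 * g.1⁻¹ at h2
      rw [ρ₁.hom_two, conj_sym g.2] at h2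
      symm
      rw [← sym_apply_eq_iff, h2, sym_apply_eq_iff]
  · rintro ⟨g, hg, h⟩
    rw [commRot, Subgroup.mem_inf, Subgroup.mem_centralizer_singleton_iff] at hg
    refine ⟨⟨g, hg.1⟩, fun w => ?_⟩
    have : ρ₂.hom = (MulAut.conj (⟨g, hg.1⟩ : IsomX)).toMonoidHom.comp ρ₁.hom := by
      apply G_hom_ext
      · apply Subtype.ext
        change _ = g * (ρ₁.hom σ₂).1 * g⁻¹
        rw [ρ₁.hom_two, ρ₂.hom_two, h, conj_sym hg.1]
      · apply Subtype.ext
        change _ = g * (ρ₁.hom σ₃).1 * g⁻¹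
        rw [ρ₁.rotation, ρ₂.rotation, hg.2, mul_inv_cancel_right]
    rw [this]
    rfl

theorem Moved.cls_eq_iff (P Q : Moved) : P.cls = Q.cls ↔ ∃ g ∈ commRot, Q.1 = g P.1 := by
  rw [Moved.cls, Moved.cls, repClass_eq_iff, Moved.fix_rep, Moved.fix_rep]

theorem commRot_apply_moved {g : Equiv.Perm X} (hg : g ∈ commRot) (P : Moved) :
    act rot (g P.1) ≠ g P.1 := by
  rw [commRot, Subgroup.mem_inf, Subgroup.mem_centralizer_singleton_iff] at hg
  rw [← Equiv.Perm.mul_apply, ← hg.2, Equiv.Perm.mul_apply]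
  exact fun h => P.2 (g.injective h)

/-- The action of the centralizer of the rotation on the points that are moved. -/
def Moved.translate (P : Moved) (g : Equiv.Perm X) (hg : g ∈ commRot) : Moved :=
  ⟨g P.1, commRot_apply_moved hg P⟩

theorem Moved.cls_translate (P : Moved) (g : Equiv.Perm X) (hg : g ∈ commRot) :
    (P.translate g hg).cls = P.cls :=
  ((Moved.cls_eq_iff _ _).2 ⟨g, hg, rfl⟩).symm

/-! ### Words -/

/-- Every word acts through a subgroup that contains the generators, up to the polarity. -/
theorem NormRep.exists_word (ρ : NormRep) (H : Subgroup SL3) (hc : ∀ T ∈ H, contra T ∈ H)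
    (hr : rot ∈ H) (hP : ρ.fix.toSL ∈ H) (w : G) :
    ∃ T ∈ H, (ρ.hom w : Equiv.Perm X) = act T ∨ (ρ.hom w : Equiv.Perm X) = act T * polarity := by
  have hw : w ∈ Subgroup.closure {σ₂, σ₃} := by rw [closure_generators]; trivial
  induction hw using Subgroup.closure_induction with
  | mem x hx =>
    rcases hx with rfl | rfl
    · exact ⟨_, inv_mem hP, Or.inr ρ.hom_two⟩
    · exact ⟨_, hr, Or.inl ρ.rotation⟩
  | one => exact ⟨1, one_mem _, Or.inl (by simp)⟩
  | mul x y _ _ hx hy =>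
    rw [map_mul, Subgroup.coe_mul]
    obtain ⟨S, hS, h1 | h1⟩ := hx <;> obtain ⟨T, hT, h2 | h2⟩ := hy
    · exact ⟨S * T, mul_mem hS hT, Or.inl (by rw [h1, h2, map_mul])⟩
    · exact ⟨S * T, mul_mem hS hT, Or.inr (by rw [h1, h2, map_mul, mul_assoc])⟩
    · refine ⟨S * contra T, mul_mem hS (hc _ hT), Or.inr ?_⟩
      rw [h1, h2, mul_assoc, polarity_mul_act, map_mul, mul_assoc]
    · refine ⟨S * contra T, mul_mem hS (hc _ hT), Or.inl ?_⟩
      rw [h1, h2, mul_assoc, ← mul_assoc polarity, polarity_mul_act, mul_assoc,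
        polarity_mul_polarity, mul_one, map_mul]
  | inv x _ hx =>
    rw [map_inv, Subgroup.coe_inv]
    obtain ⟨S, hS, h1 | h1⟩ := hx
    · exact ⟨S⁻¹, inv_mem hS, Or.inl (by rw [h1, map_inv])⟩
    · refine ⟨contra S⁻¹, hc _ (inv_mem hS), Or.inr ?_⟩
      rw [h1, mul_inv_rev, polarity_inv, ← map_inv, polarity_mul_act]

/-- To find an invariant line or conic, it is enough to put `rot` and P into a subgroup that
preserves it and is stable under `contra`. -/
theorem NormRep.mem_of_hom_eq_act (ρ : NormRep) (H : Subgroup SL3)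
    (hc : ∀ T ∈ H, contra T ∈ H) (hr : rot ∈ H) (hP : ρ.fix.toSL ∈ H) (w : G) (T : SL3)
    (h : (ρ.hom w : Equiv.Perm X) = act T) : T ∈ H := by
  obtain ⟨S, hS, h1 | h1⟩ := ρ.exists_word H hc hr hP w
  · rw [← act_injective (h.symm.trans h1)] at hS
    exact hS
  · exact absurd (h.symm.trans h1) (act_ne_act_mul_polarity _ _)

/-- The number of letters `σ₂` modulo two. -/
def parity : G →* Multiplicative (ZMod 2) :=
  Monoid.Coprod.lift (MonoidHom.id (Multiplicative (ZMod 2)))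
    (1 : Multiplicative (ZMod 3) →* Multiplicative (ZMod 2))

theorem isEvenWord_iff (w : G) : IsEvenWord w ↔ parity w = 1 := Iff.rfl

theorem IsEvenWord.inv {w : G} (h : IsEvenWord w) : IsEvenWord w⁻¹ := by
  rw [isEvenWord_iff] at h ⊢
  rw [map_inv, h, inv_one]

/-! ### Words as smooth functions of the fixed point. -/

/-- A matrix valued function of matrix arrays. -/
abbrev MatFun : Type := (Fin 3 → Fin 3 → ℝ) → Fin 3 → Fin 3 → ℝ

theorem contDiff_matrix_mul {M N : MatFun} (hM : ContDiff ℝ ∞ M) (hN : ContDiff ℝ ∞ N) :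
    ContDiff ℝ ∞ (fun A i j => (Matrix.of (M A) * Matrix.of (N A)) i j : MatFun) := by
  have h1 := fun i j => contDiff_pi.1 (contDiff_pi.1 hM i) j
  have h2 := fun i j => contDiff_pi.1 (contDiff_pi.1 hN i) j
  refine contDiff_pi.2 fun i => contDiff_pi.2 fun j => ?_
  simp only [Matrix.mul_apply, Matrix.of_apply]
  exact ContDiff.sum fun k _ => (h1 i k).mul (h2 k j)

theorem contDiff_matrix_transpose {M : MatFun} (hM : ContDiff ℝ ∞ M) :
    ContDiff ℝ ∞ (fun A i j => (Matrix.of (M A)).transpose i j : MatFun) := by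
  have h1 := fun i j => contDiff_pi.1 (contDiff_pi.1 hM i) j
  exact contDiff_pi.2 fun i => contDiff_pi.2 fun j => h1 j i

/-- The adjugate equals the inverse on determinant 1 and is polynomial on all arrays, so no domain
has to be tracked. -/
theorem contDiff_matrix_adjugate {M : MatFun} (hM : ContDiff ℝ ∞ M) :
    ContDiff ℝ ∞ (fun A i j => (Matrix.of (M A)).adjugate i j : MatFun) := by
  have h1 : ∀ i j, ContDiff ℝ ∞ fun A => M A i j :=
    fun i j => contDiff_pi.1 (contDiff_pi.1 hM i) j
  have h2 : ∀ i j k l i' j' k' l', ContDiff ℝ ∞ fun A =>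
      M A i j * M A k l - M A i' j' * M A k' l' := fun i j k l i' j' k' l' =>
    ((h1 i j).mul (h1 k l)).sub ((h1 i' j').mul (h1 k' l'))
  have h3 : ∀ i j k l i' j' k' l', ContDiff ℝ ∞ fun A =>
      -(M A i j * M A k l) + M A i' j' * M A k' l' := fun i j k l i' j' k' l' =>
    ((h1 i j).mul (h1 k l)).neg.add ((h1 i' j').mul (h1 k' l'))
  refine contDiff_pi.2 fun i => contDiff_pi.2 fun j => ?_
  simp only [Matrix.adjugate_fin_three]
  fin_cases i <;> fin_cases j <;> first | exact h2 _ _ _ _ _ _ _ _ | exact h3 _ _ _ _ _ _ _ _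

/-- The action of a word is a smooth function of the fixed point. -/
theorem exists_smooth_word (w : G) :
    ∃ M : MatFun, ContDiff ℝ ∞ M ∧ ∀ ρ : NormRep, ∃ T : SL3,
      (T : Mat3) = Matrix.of (M (fixedPoint ρ)) ∧
      ((parity w = 1 ∧ (ρ.hom w : Equiv.Perm X) = act T) ∨
        (parity w ≠ 1 ∧ (ρ.hom w : Equiv.Perm X) = act T * polarity)) := by
  have hw : w ∈ Subgroup.closure {σ₂, σ₃} := by rw [closure_generators]; trivial
  have hadj : ∀ T : SL3, ((T⁻¹ : SL3) : Mat3) = (T : Mat3).adjugate :=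
    Matrix.SpecialLinearGroup.coe_inv
  induction hw using Subgroup.closure_induction with
  | mem x hx =>
    rcases hx with rfl | rfl
    · refine ⟨_, contDiff_matrix_adjugate contDiff_id, fun ρ => ⟨ρ.fix.toSL⁻¹, ?_, Or.inr ?_⟩⟩
      · rw [hadj]; rfl
      · refine ⟨?_, ρ.hom_two⟩
        rw [parity, σ₂, Monoid.Coprod.lift_apply_inl]
        decide
    · refine ⟨fun _ i j => (rot : Mat3) i j, contDiff_const, fun ρ => ⟨rot, rfl, Or.inl ?_⟩⟩
      refine ⟨?_, ρ.rotation⟩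
      rw [parity, σ₃, Monoid.Coprod.lift_apply_inr]
      rfl
  | one =>
    refine ⟨fun _ i j => (1 : Mat3) i j, contDiff_const, fun ρ => ⟨1, ?_, Or.inl ?_⟩⟩
    · rfl
    · simp
  | mul x y _ _ hx hy =>
    obtain ⟨M, hM, h1⟩ := hx
    obtain ⟨N, hN, h2⟩ := hy
    -- The matrix function has to be the same for all ρ, so it may depend only on the parity of `x`,
    -- which decides whether a polarity must be moved past `y`.
    by_cases hp : parity x = 1
    · refine ⟨_, contDiff_matrix_mul hM hN, fun ρ => ?_⟩
      obtain ⟨S, hS, h1 | h1⟩ := h1 ρ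
      · obtain ⟨T, hT, h2⟩ := h2 ρ
        refine ⟨S * T, ?_, ?_⟩
        · rw [Matrix.SpecialLinearGroup.coe_mul, hS, hT]; rfl
        · rw [map_mul, map_mul, Subgroup.coe_mul, h1.1, one_mul, h1.2, map_mul, mul_assoc]
          exact h2.imp (fun h => ⟨h.1, by rw [h.2]⟩) (fun h => ⟨h.1, by rw [h.2]⟩)
      · exact absurd hp h1.1
    -- Moving the polarity past T replaces T by its contragredient, the transposed adjugate.
    · refine ⟨_, contDiff_matrix_mul hM (contDiff_matrix_transpose (contDiff_matrix_adjugate hN)),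
        fun ρ => ?_⟩
      obtain ⟨S, hS, h1 | h1⟩ := h1 ρ
      · exact absurd h1.1 hp
      · obtain ⟨T, hT, h2⟩ := h2 ρ
        have hpar : ∀ a b : Multiplicative (ZMod 2), a ≠ 1 → b ≠ 1 → a * b = 1 := by decide
        refine ⟨S * contra T, ?_, ?_⟩
        · rw [Matrix.SpecialLinearGroup.coe_mul, hS, coe_contra, hadj, hT]; rfl
        · rw [map_mul, map_mul, Subgroup.coe_mul, h1.2]
          rcases h2 with h | h
          · right
            rw [h.1, mul_one, h.2, mul_assoc, polarity_mul_act, map_mul, mul_assoc]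
            exact ⟨hp, rfl⟩
          · left
            rw [h.2, mul_assoc, ← mul_assoc polarity, polarity_mul_act, mul_assoc,
              polarity_mul_polarity, mul_one, map_mul]
            exact ⟨hpar _ _ hp h.1, rfl⟩
  | inv x _ hx =>
    obtain ⟨M, hM, h1⟩ := hx
    by_cases hp : parity x = 1
    · refine ⟨_, contDiff_matrix_adjugate hM, fun ρ => ?_⟩
      obtain ⟨S, hS, h1 | h1⟩ := h1 ρ
      · refine ⟨S⁻¹, by rw [hadj, hS]; rfl, Or.inl ?_⟩
        rw [map_inv, map_inv, Subgroup.coe_inv, h1.1, h1.2, map_inv, inv_one]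
        exact ⟨rfl, rfl⟩
      · exact absurd hp h1.1
    · refine ⟨_, contDiff_matrix_transpose hM, fun ρ => ?_⟩
      obtain ⟨S, hS, h1 | h1⟩ := h1 ρ
      · exact absurd h1.1 hp
      · refine ⟨contra S⁻¹, by rw [coe_contra, inv_inv, hS]; rfl, Or.inr ?_⟩
        rw [map_inv, map_inv, Subgroup.coe_inv, h1.2, mul_inv_rev, polarity_inv, ← map_inv act,
          polarity_mul_act]
        exact ⟨by simpa using hp, rfl⟩

theorem NormRep.existsUnique_act (ρ : NormRep) {w : G} (hw : IsEvenWord w) :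
    ∃! T : SL3, (ρ.hom w : Equiv.Perm X) = act T := by
  obtain ⟨M, _, h⟩ := exists_smooth_word w
  obtain ⟨T, _, h | h⟩ := h ρ
  · exact ⟨T, h.2, fun S hS => act_injective (hS.symm.trans h.2)⟩
  · exact absurd hw h.1

theorem wordTrace_eq {ρ : NormRep} {w : G} {T : SL3} (h : (ρ.hom w : Equiv.Perm X) = act T) :
    wordTrace ρ w = Matrix.trace (T : Mat3) := by
  have hex : ∃ T : SL3, (ρ.hom w : Equiv.Perm X) = act T := ⟨T, h⟩
  rw [wordTrace, dif_pos hex, act_injective ((Classical.choose_spec hex).symm.trans h)]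

/-- The trace of an even word is a smooth function of the fixed point. -/
theorem exists_smooth_wordTrace {w : G} (hw : IsEvenWord w) :
    ∃ t : (Fin 3 → Fin 3 → ℝ) → ℝ, ContDiff ℝ ∞ t ∧
      ∀ ρ : NormRep, wordTrace ρ w = t (fixedPoint ρ) := by
  obtain ⟨M, hM, h⟩ := exists_smooth_word w
  refine ⟨fun A => Matrix.trace (Matrix.of (M A)), ?_, fun ρ => ?_⟩
  · have h1 := fun i j => contDiff_pi.1 (contDiff_pi.1 hM i) j
    simp only [Matrix.trace, Matrix.diag, Matrix.of_apply]
    exact ContDiff.sum fun i _ => h1 i i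
  · obtain ⟨T, hT, h | h⟩ := h ρ
    · rw [wordTrace_eq h.2, hT]
    · exact absurd hw h.1

/-- Conjugate representations have the same traces, or the traces of the inverse words. -/
theorem wordTrace_conj {ρ ρ' : NormRep} (h : repClass ρ = repClass ρ') :
    (∀ w, IsEvenWord w → wordTrace ρ' w = wordTrace ρ w) ∨
      ∀ w, IsEvenWord w → wordTrace ρ' w = wordTrace ρ w⁻¹ := by
  obtain ⟨g, hg⟩ : ∃ g : IsomX, ∀ w : G, ρ'.hom w = g * ρ.hom w * g⁻¹ :=
    (Quotient.eq (r := conjSetoid)).1 h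
  have hg' : ∀ w, (ρ'.hom w : Equiv.Perm X) = g.1 * (ρ.hom w).1 * g.1⁻¹ :=
    fun w => congrArg Subtype.val (hg w)
  have htr : ∀ S U : SL3, Matrix.trace ((S * U * S⁻¹ : SL3) : Mat3) = Matrix.trace (U : Mat3) := by
    intro S U
    rw [Matrix.SpecialLinearGroup.coe_mul, Matrix.trace_mul_comm,
      ← Matrix.SpecialLinearGroup.coe_mul, ← mul_assoc, inv_mul_cancel, one_mul]
  obtain ⟨S, h1 | h1⟩ := (mem_IsomX_iff g.1).1 g.2
  · refine Or.inl fun w hw => ?_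
    obtain ⟨T, hT, -⟩ := ρ.existsUnique_act hw
    have : (ρ'.hom w : Equiv.Perm X) = act (S * T * S⁻¹) := by
      rw [hg', h1, hT, map_mul, map_mul, map_inv]
    rw [wordTrace_eq this, wordTrace_eq hT, htr]
  · refine Or.inr fun w hw => ?_
    obtain ⟨T, hT, -⟩ := ρ.existsUnique_act hw
    have hi : (ρ.hom w⁻¹ : Equiv.Perm X) = act T⁻¹ := by
      rw [map_inv, Subgroup.coe_inv, hT, map_inv]
    -- Conjugation by the polarity turns T into its contragredient, which has the trace of T⁻¹.
    have : (ρ'.hom w : Equiv.Perm X) = act (S * contra T * S⁻¹) := by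
      rw [hg', h1, hT, map_mul, map_mul, map_inv, mul_inv_rev, mul_assoc (act S), polarity_mul_act,
        mul_assoc, mul_assoc, ← mul_assoc polarity polarity⁻¹, mul_inv_cancel, one_mul, mul_assoc]
    rw [wordTrace_eq this, wordTrace_eq hi, htr, coe_contra, Matrix.trace_transpose]


/-! ### Invariants of the centralizer of the rotation -/

/-- A real `3 × 3` array. -/
abbrev Arr : Type := Fin 3 → Fin 3 → ℝ

/-- The entries of a point of `X`. -/
def X.arr (P : X) : Arr := fun i j => P.1 i j

theorem fixedPoint_eq_arr (ρ : NormRep) : fixedPoint ρ = ρ.fix.arr := rfl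

theorem X.arr_injective : Function.Injective X.arr := fun _ _ h => Subtype.ext h

/-- The minor of the upper left block. -/
def blockDet (A : Arr) : ℝ := A 0 0 * A 1 1 - A 0 1 * A 1 0

/-- Half the trace of the upper left block. -/
def halfTr (A : Arr) : ℝ := (A 0 0 + A 1 1) / 2

/-- Half the trace of the upper left block of the adjugate. -/
def halfTrAdj (A : Arr) : ℝ :=
  (A 1 1 * A 2 2 - A 1 2 * A 2 1 + (A 0 0 * A 2 2 - A 0 2 * A 2 0)) / 2

/-- The cubic invariant. -/
def cubic (A : Arr) : ℝ := A 0 1 * (A 0 2 ^ 2 - A 1 2 ^ 2) - (A 0 0 - A 1 1) * A 0 2 * A 1 2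

/-- By `polarity_two_two`, `blockDet` is the last diagonal entry of P⁻¹. A spin scales the two
entries by inverse factors and the polarity swaps them, so their geometric mean is invariant. -/
def geomMean (A : Arr) : ℝ := √(A 2 2 * blockDet A)

/-- This is the fourth root of `A 2 2 / blockDet A`. A spin divides it by p² + r² and the polarity
inverts it, which cancels the scaling of the two half traces below. -/
def scaleFactor (A : Arr) : ℝ := √(A 2 2 / geomMean A)

def invN (A : Arr) : ℝ := A 2 2 * blockDet A - 1

/-- The polarity swaps the two summands, so their sum here is invariant, and their difference in
`invU` changes sign. The factors `geomMean A + 1` make the values on the normal form √(1 + u² + v²)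
and n²u. -/
def invM (A : Arr) : ℝ :=
  (halfTr A * scaleFactor A + halfTrAdj A / scaleFactor A) / (geomMean A + 1)

def invU (A : Arr) : ℝ :=
  (geomMean A + 1) * (halfTrAdj A / scaleFactor A - halfTr A * scaleFactor A)

def invV (A : Arr) : ℝ := -cubic A

/-- The map that will identify the quotient with `ℝ³`. -/
def invMap (A : Arr) : EuclideanSpace ℝ (Fin 3) :=
  !₂[2 * (invU A ^ 2 - invV A ^ 2) / √(invU A ^ 2 + invV A ^ 2),
    2 * (2 * invU A * invV A) / √(invU A ^ 2 + invV A ^ 2),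
    invM A ^ 2 - 1 - invN A ^ 2]

/-! ### Behaviour of the invariants under the polarity. -/

theorem det_three (P : X) :
    P.1 0 0 * P.1 1 1 * P.1 2 2 - P.1 0 0 * P.1 1 2 ^ 2 - P.1 0 1 ^ 2 * P.1 2 2
      + 2 * P.1 0 1 * P.1 0 2 * P.1 1 2 - P.1 0 2 ^ 2 * P.1 1 1 = 1 := by
  have h := P.2.2
  rw [Matrix.det_fin_three, P.apply_comm 1 0, P.apply_comm 2 0, P.apply_comm 2 1] at h
  linarith

theorem polarity_arr (P : X) : (polarity P).arr = fun i j => P.1.adjugate i j := by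
  ext i j
  change P.1⁻¹ i j = _
  rw [Matrix.inv_def, P.2.2, Ring.inverse_one, one_smul]

theorem polarity_entries (P : X) :
    (polarity P).arr 0 0 = P.1 1 1 * P.1 2 2 - P.1 1 2 ^ 2 ∧
    (polarity P).arr 1 1 = P.1 0 0 * P.1 2 2 - P.1 0 2 ^ 2 ∧
    (polarity P).arr 2 2 = P.1 0 0 * P.1 1 1 - P.1 0 1 ^ 2 ∧
    (polarity P).arr 0 1 = P.1 0 2 * P.1 1 2 - P.1 0 1 * P.1 2 2 ∧
    (polarity P).arr 0 2 = P.1 0 1 * P.1 1 2 - P.1 0 2 * P.1 1 1 ∧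
    (polarity P).arr 1 2 = P.1 0 2 * P.1 0 1 - P.1 0 0 * P.1 1 2 := by
  rw [polarity_arr]
  simp only [Matrix.adjugate_fin_three]
  have h1 := P.apply_comm 1 0
  have h2 := P.apply_comm 2 0
  have h3 := P.apply_comm 2 1
  refine ⟨?_, ?_, ?_, ?_, ?_, ?_⟩ <;> simp [h1, h2, h3] <;> ring

theorem X.diag_pos (P : X) (i : Fin 3) : 0 < P.1 i i := P.2.1.diag_pos

theorem X.blockDet_eq (P : X) : blockDet P.arr = P.1 0 0 * P.1 1 1 - P.1 0 1 ^ 2 := by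
  simp only [blockDet, X.arr]
  rw [P.apply_comm 1 0]; ring

theorem X.halfTrAdj_eq (P : X) : halfTrAdj P.arr =
    (P.1 1 1 * P.1 2 2 - P.1 1 2 ^ 2 + (P.1 0 0 * P.1 2 2 - P.1 0 2 ^ 2)) / 2 := by
  simp only [halfTrAdj, X.arr]
  rw [P.apply_comm 2 0, P.apply_comm 2 1]; ring

theorem polarity_two_two (P : X) : (polarity P).arr 2 2 = blockDet P.arr := by
  rw [(polarity_entries P).2.2.1, P.blockDet_eq]

theorem X.blockDet_pos (P : X) : 0 < blockDet P.arr := by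
  rw [← polarity_two_two]; exact (polarity P).diag_pos 2

theorem X.halfTr_pos (P : X) : 0 < halfTr P.arr := by
  have h0 := P.diag_pos 0
  have h1 := P.diag_pos 1
  simp only [halfTr, X.arr]; positivity

theorem halfTr_polarity (P : X) : halfTr (polarity P).arr = halfTrAdj P.arr := by
  rw [P.halfTrAdj_eq, halfTr, (polarity_entries P).1, (polarity_entries P).2.1]

theorem halfTrAdj_polarity (P : X) : halfTrAdj (polarity P).arr = halfTr P.arr := by
  have := halfTr_polarity (polarity P)
  rw [← this]
  congr 2
  exact (congrArg (fun g : Equiv.Perm X => g P) polarity_mul_polarity)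

theorem blockDet_polarity (P : X) : blockDet (polarity P).arr = P.arr 2 2 := by
  rw [← polarity_two_two]
  congr 2
  exact (congrArg (fun g : Equiv.Perm X => g P) polarity_mul_polarity)

/-- With S the upper left block and b the column beside it, `cubic` is det(b, Sb). For the adjugate
of P it equals -det P times the value at P. -/
theorem cubic_polarity (P : X) : cubic (polarity P).arr = -cubic P.arr := by
  obtain ⟨h1, h2, h3, h4, h5, h6⟩ := polarity_entries P
  rw [cubic, h1, h2, h4, h5, h6]
  have hd := det_three P
  simp only [cubic, X.arr]
  linear_combination (-(P.1 0 1 * (P.1 0 2 ^ 2 - P.1 1 2 ^ 2) -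
    (P.1 0 0 - P.1 1 1) * P.1 0 2 * P.1 1 2)) * hd

theorem X.geomMean_pos (P : X) : 0 < geomMean P.arr :=
  Real.sqrt_pos.2 (mul_pos (P.diag_pos 2) P.blockDet_pos)

theorem X.scaleFactor_pos (P : X) : 0 < scaleFactor P.arr :=
  Real.sqrt_pos.2 (div_pos (P.diag_pos 2) P.geomMean_pos)

theorem X.halfTrAdj_pos (P : X) : 0 < halfTrAdj P.arr := by
  rw [← halfTr_polarity]; exact (polarity P).halfTr_pos

theorem geomMean_polarity (P : X) : geomMean (polarity P).arr = geomMean P.arr := by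
  rw [geomMean, blockDet_polarity, polarity_two_two, mul_comm]; rfl

theorem scaleFactor_polarity (P : X) : scaleFactor (polarity P).arr = (scaleFactor P.arr)⁻¹ := by
  rw [scaleFactor, scaleFactor, geomMean_polarity, polarity_two_two, ← Real.sqrt_inv]
  congr 1
  have h := P.geomMean_pos
  have h2 : 0 < P.arr 2 2 := P.diag_pos 2
  have h3 : geomMean P.arr * geomMean P.arr = P.arr 2 2 * blockDet P.arr :=
    Real.mul_self_sqrt (mul_pos h2 P.blockDet_pos).le
  field_simp
  linarith

theorem invN_polarity (P : X) : invN (polarity P).arr = invN P.arr := by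
  rw [invN, blockDet_polarity, polarity_two_two, mul_comm]; rfl

theorem invM_polarity (P : X) : invM (polarity P).arr = invM P.arr := by
  have := P.scaleFactor_pos
  rw [invM, halfTr_polarity, halfTrAdj_polarity, geomMean_polarity, scaleFactor_polarity, invM]
  congr 1
  field_simp
  ring

theorem invU_polarity (P : X) : invU (polarity P).arr = -invU P.arr := by
  have := P.scaleFactor_pos
  rw [invU, halfTr_polarity, halfTrAdj_polarity, geomMean_polarity, scaleFactor_polarity, invU]
  field_simp
  ring

theorem invV_polarity (P : X) : invV (polarity P).arr = -invV P.arr := by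
  rw [invV, cubic_polarity, invV]

theorem invMap_polarity (P : X) : invMap (polarity P).arr = invMap P.arr := by
  rw [invMap, invN_polarity, invM_polarity, invU_polarity, invV_polarity, invMap]
  simp only [neg_sq, mul_neg, neg_mul, neg_neg]

/-! ### Behaviour of the invariants under the centralizer. -/

/-- A rotation about the axis followed by a scaling. -/
def spin (p r : ℝ) (h : p ^ 2 + r ^ 2 ≠ 0) : SL3 :=
  ⟨!![p, -r, 0; r, p, 0; 0, 0, 1 / (p ^ 2 + r ^ 2)], by
    rw [Matrix.det_fin_three]
    simp
    field_simp⟩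

theorem spin_comm_rot (p r : ℝ) (h : p ^ 2 + r ^ 2 ≠ 0) : rot * spin p r h = spin p r h * rot := by
  apply Subtype.ext
  rw [Matrix.SpecialLinearGroup.coe_mul, Matrix.SpecialLinearGroup.coe_mul, coe_rot, spin]
  ext i j
  fin_cases i <;> fin_cases j <;> simp [Matrix.mul_apply, Fin.sum_univ_three] <;> ring

/-- The rotation has a pair of nonreal eigenvalues on the plane and 1 on the axis, so its commutant
consists of the complex scalars on the plane and the real scalars on the axis. -/
theorem comm_rot_entries {M : Mat3} (h : (rot : Mat3) * M = M * (rot : Mat3)) :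
    M 0 1 = -M 1 0 ∧ M 1 1 = M 0 0 ∧ M 1 2 = 0 ∧ M 0 2 = 0 ∧ M 2 1 = 0 ∧ M 2 0 = 0 := by
  rw [coe_rot] at h
  have f := fun i j => congrFun (congrFun h i) j
  have f00 := f 0 0
  have f01 := f 0 1
  have f02 := f 0 2
  have f12 := f 1 2
  have f20 := f 2 0
  have f21 := f 2 1
  simp [Matrix.mul_apply, Fin.sum_univ_three] at f00 f01 f02 f12 f20 f21
  have h3 : √3 * √3 = 3 := Real.mul_self_sqrt (by norm_num)
  have hp : 0 < √3 := by positivity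
  have t01 : M 0 1 = -M 1 0 := by
    have : √3 * (M 0 1 + M 1 0) = 0 := by linarith
    rcases mul_eq_zero.1 this with h' | h' <;> linarith
  have t11 : M 1 1 = M 0 0 := by
    have : √3 * (M 1 1 - M 0 0) = 0 := by linarith
    rcases mul_eq_zero.1 this with h' | h' <;> linarith
  have t12 : M 1 2 = 0 := by
    have e1 : M 0 2 = √3 / 3 * M 1 2 := by linarith
    rw [e1] at f12
    nlinarith
  have t02 : M 0 2 = 0 := by rw [t12] at f02; linarith
  have t21 : M 2 1 = 0 := by
    have e1 : M 2 0 = -(√3 / 3) * M 2 1 := by linarith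
    rw [e1] at f21
    nlinarith
  have t20 : M 2 0 = 0 := by rw [t21] at f20; linarith
  exact ⟨t01, t11, t12, t02, t21, t20⟩

theorem exists_eq_spin {T : SL3} (hT : rot * T = T * rot) : ∃ p r h, T = spin p r h := by
  have e := congrArg Subtype.val hT
  rw [Matrix.SpecialLinearGroup.coe_mul, Matrix.SpecialLinearGroup.coe_mul] at e
  obtain ⟨t01, t11, t12, t02, t21, t20⟩ := comm_rot_entries e
  have hd := T.2
  rw [Matrix.det_fin_three, t01, t11, t12, t02, t21, t20] at hd
  have hd' : (T.1 0 0 ^ 2 + T.1 1 0 ^ 2) * T.1 2 2 = 1 := by linarith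
  have hne := left_ne_zero_of_mul_eq_one hd'
  refine ⟨T.1 0 0, T.1 1 0, hne, ?_⟩
  have t22 : T.1 2 2 = 1 / (T.1 0 0 ^ 2 + T.1 1 0 ^ 2) := by
    field_simp; linarith
  apply Subtype.ext
  ext i j
  fin_cases i <;> fin_cases j <;>
    simp only [spin, Fin.zero_eta, Fin.mk_one, Fin.reduceFinMk, Matrix.of_apply, Matrix.cons_val,
      t01, t11, t12, t02, t21, t20, t22]

/-- The inverse is taken so that the action reads P ↦ MᵗPM with M the matrix `spin p r h`. The
column beside the block turns once and the traceless part of the block turns twice. -/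
theorem spin_entries (p r : ℝ) (h : p ^ 2 + r ^ 2 ≠ 0) (P : X) :
    (act (spin p r h)⁻¹ P).arr 0 0 =
      p ^ 2 * P.1 0 0 + 2 * p * r * P.1 0 1 + r ^ 2 * P.1 1 1 ∧
    (act (spin p r h)⁻¹ P).arr 1 1 =
      r ^ 2 * P.1 0 0 - 2 * p * r * P.1 0 1 + p ^ 2 * P.1 1 1 ∧
    (act (spin p r h)⁻¹ P).arr 2 2 = P.1 2 2 / (p ^ 2 + r ^ 2) ^ 2 ∧
    (act (spin p r h)⁻¹ P).arr 0 1 =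
      -(p * r) * P.1 0 0 + (p ^ 2 - r ^ 2) * P.1 0 1 + p * r * P.1 1 1 ∧
    (act (spin p r h)⁻¹ P).arr 0 2 = (p * P.1 0 2 + r * P.1 1 2) / (p ^ 2 + r ^ 2) ∧
    (act (spin p r h)⁻¹ P).arr 1 2 = (-r * P.1 0 2 + p * P.1 1 2) / (p ^ 2 + r ^ 2) := by
  have h1 := P.apply_comm 1 0
  have h2 := P.apply_comm 2 0
  have h3 := P.apply_comm 2 1
  have h4 := act_apply_coe (spin p r h)⁻¹ P
  rw [inv_inv] at h4
  simp only [X.arr]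
  rw [h4, spin]
  refine ⟨?_, ?_, ?_, ?_, ?_, ?_⟩ <;>
    simp [Matrix.mul_apply, Fin.sum_univ_three, h1, h2, h3] <;> first | ring1 | field_simp

section spin

variable (p r : ℝ) (h : p ^ 2 + r ^ 2 ≠ 0) (P : X)

theorem blockDet_spin : blockDet (act (spin p r h)⁻¹ P).arr =
    blockDet P.arr * (p ^ 2 + r ^ 2) ^ 2 := by
  obtain ⟨h1, h2, h3, h4, h5, h6⟩ := spin_entries p r h P
  rw [X.blockDet_eq, X.blockDet_eq]
  change (act (spin p r h)⁻¹ P).arr 0 0 * (act (spin p r h)⁻¹ P).arr 1 1 -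
    (act (spin p r h)⁻¹ P).arr 0 1 ^ 2 = _
  rw [h1, h2, h4]
  ring

theorem halfTr_spin : halfTr (act (spin p r h)⁻¹ P).arr = halfTr P.arr * (p ^ 2 + r ^ 2) := by
  obtain ⟨h1, h2, h3, h4, h5, h6⟩ := spin_entries p r h P
  rw [halfTr, h1, h2]
  simp only [halfTr, X.arr]
  ring

theorem halfTrAdj_spin :
    halfTrAdj (act (spin p r h)⁻¹ P).arr = halfTrAdj P.arr / (p ^ 2 + r ^ 2) := by
  obtain ⟨h1, h2, h3, h4, h5, h6⟩ := spin_entries p r h P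
  rw [X.halfTrAdj_eq, X.halfTrAdj_eq]
  change ((act (spin p r h)⁻¹ P).arr 1 1 * (act (spin p r h)⁻¹ P).arr 2 2 -
    (act (spin p r h)⁻¹ P).arr 1 2 ^ 2 + ((act (spin p r h)⁻¹ P).arr 0 0 *
    (act (spin p r h)⁻¹ P).arr 2 2 - (act (spin p r h)⁻¹ P).arr 0 2 ^ 2)) / 2 = _
  rw [h1, h2, h3, h5, h6]
  field_simp
  ring

theorem cubic_spin : cubic (act (spin p r h)⁻¹ P).arr = cubic P.arr := by
  obtain ⟨h1, h2, h3, h4, h5, h6⟩ := spin_entries p r h P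
  rw [cubic, h1, h2, h4, h5, h6]
  simp only [cubic, X.arr]
  field_simp
  ring

theorem geomMean_spin : geomMean (act (spin p r h)⁻¹ P).arr = geomMean P.arr := by
  rw [geomMean, blockDet_spin, (spin_entries p r h P).2.2.1, geomMean]
  congr 1
  simp only [X.arr]
  field_simp

theorem scaleFactor_spin :
    scaleFactor (act (spin p r h)⁻¹ P).arr = scaleFactor P.arr / (p ^ 2 + r ^ 2) := by
  rw [scaleFactor, geomMean_spin, (spin_entries p r h P).2.2.1, scaleFactor, div_right_comm,
    Real.sqrt_div' _ (by positivity), Real.sqrt_sq (by positivity)]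
  rfl

theorem invN_spin : invN (act (spin p r h)⁻¹ P).arr = invN P.arr := by
  rw [invN, blockDet_spin, (spin_entries p r h P).2.2.1, invN]
  simp only [X.arr]
  field_simp

theorem invM_spin : invM (act (spin p r h)⁻¹ P).arr = invM P.arr := by
  have := P.scaleFactor_pos
  rw [invM, halfTr_spin, halfTrAdj_spin, geomMean_spin, scaleFactor_spin, invM]
  congr 1
  field_simp

theorem invU_spin : invU (act (spin p r h)⁻¹ P).arr = invU P.arr := by
  have := P.scaleFactor_pos
  rw [invU, halfTr_spin, halfTrAdj_spin, geomMean_spin, scaleFactor_spin, invU]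
  field_simp

theorem invV_spin : invV (act (spin p r h)⁻¹ P).arr = invV P.arr := by
  rw [invV, cubic_spin, invV]

theorem invMap_spin : invMap (act (spin p r h)⁻¹ P).arr = invMap P.arr := by
  rw [invMap, invN_spin, invM_spin, invU_spin, invV_spin, invMap]

end spin

/-- Elements that commute with the rotation, acting by projective transformations. -/
theorem exists_eq_spin_inv {T : SL3} (hT : rot * T = T * rot) : ∃ p r h, T = (spin p r h)⁻¹ := by
  have : rot * T⁻¹ = T⁻¹ * rot := by
    rw [← mul_left_inj T, mul_assoc, mul_assoc, hT, inv_mul_cancel_left, inv_mul_cancel, mul_one]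
  obtain ⟨p, r, h, e⟩ := exists_eq_spin this
  exact ⟨p, r, h, by rw [← e, inv_inv]⟩

theorem act_spin_inv_mem (p r : ℝ) (h : p ^ 2 + r ^ 2 ≠ 0) : act (spin p r h)⁻¹ ∈ commRot := by
  rw [map_inv]
  refine inv_mem ((mem_commRot_iff _).2 ⟨_, spin_comm_rot p r h, Or.inl rfl⟩)

theorem polarity_mem_commRot : polarity ∈ commRot :=
  (mem_commRot_iff _).2 ⟨1, by simp, Or.inr (by simp)⟩

theorem invMap_apply_of_mem {g : Equiv.Perm X} (hg : g ∈ commRot) (P : X) :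
    invMap (g P).arr = invMap P.arr := by
  obtain ⟨T, hT, rfl | rfl⟩ := (mem_commRot_iff g).1 hg
  · obtain ⟨p, r, h, rfl⟩ := exists_eq_spin_inv hT
    exact invMap_spin p r h P
  · obtain ⟨p, r, h, rfl⟩ := exists_eq_spin_inv hT
    rw [Equiv.Perm.mul_apply, invMap_spin, invMap_polarity]


/-! ### Normal form -/

/-- `√(1 + u² + v²) - u`. -/
def gap (u v : ℝ) : ℝ := √(1 + u ^ 2 + v ^ 2) - u

theorem gap_pos (u v : ℝ) : 0 < gap u v := by
  have h : |u| < √(1 + u ^ 2 + v ^ 2) := by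
    rw [← Real.sqrt_sq_eq_abs]
    exact Real.sqrt_lt_sqrt (sq_nonneg u) (by nlinarith [sq_nonneg v])
  have := le_abs_self u
  unfold gap
  linarith

/-- A difference of squares. It identifies (1 + v²)/gap with √(1 + u² + v²) + u, which makes the
half traces of the normal form linear in u and the root. -/
theorem gap_mul (u v : ℝ) : gap u v * (√(1 + u ^ 2 + v ^ 2) + u) = 1 + v ^ 2 := by
  have : √(1 + u ^ 2 + v ^ 2) * √(1 + u ^ 2 + v ^ 2) = 1 + u ^ 2 + v ^ 2 :=
    Real.mul_self_sqrt (by positivity)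
  unfold gap
  linear_combination this

/-- The matrix of the normal form. -/
def normalArr (n u v : ℝ) : Arr :=
  ![![√(1 + n ^ 2) * gap u v + v ^ 2 / gap u v, -v / gap u v, n * √(gap u v)],
    ![-v / gap u v, 1 / gap u v, 0],
    ![n * √(gap u v), 0, √(1 + n ^ 2)]]

theorem normalArr_posDef (n u v : ℝ) : (Matrix.of (normalArr n u v)).PosDef := by
  have hg := gap_pos u v
  set g := gap u v
  have hC : 0 < √(1 + n ^ 2) := Real.sqrt_pos.2 (by positivity)
  have hC2 : √(1 + n ^ 2) * √(1 + n ^ 2) = 1 + n ^ 2 := Real.mul_self_sqrt (by positivity)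
  have hs : √g * √g = g := Real.mul_self_sqrt hg.le
  have hs0 : 0 < √g := Real.sqrt_pos.2 hg
  set C := √(1 + n ^ 2)
  have hc : √C * √C = C := Real.mul_self_sqrt hC.le
  have hc0 : 0 < √C := Real.sqrt_pos.2 hC
  -- The rows of the factor come from completing squares: first in y, then in z, with (g/C)x² left
  -- over.
  have e : Matrix.of (normalArr n u v) =
      (!![-v / √g, 1 / √g, 0; n * √g / √C, 0, √C; √g / √C, 0, 0] : Mat3).conjTranspose *
        !![-v / √g, 1 / √g, 0; n * √g / √C, 0, √C; √g / √C, 0, 0] := by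
    rw [Matrix.conjTranspose_eq_transpose_of_trivial]
    ext i j
    have e00 : C * g + v ^ 2 / g = -v / √g * (-v / √g) + n * √g / √C * (n * √g / √C) +
        √g / √C * (√g / √C) := by
      have h1 : -v / √g * (-v / √g) = v ^ 2 / g := by
        rw [div_mul_div_comm, hs]; ring
      have h2 : n * √g / √C * (n * √g / √C) = n ^ 2 * g / C := by
        rw [div_mul_div_comm, hc]; congr 1; linear_combination n ^ 2 * hs
      have h3 : √g / √C * (√g / √C) = g / C := by
        rw [div_mul_div_comm, hs, hc]
      rw [h1, h2, h3]
      field_simp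
      linear_combination hC2 * g ^ 2
    have e01 : -v / g = -v / √g * (1 / √g) := by rw [div_mul_div_comm, hs, mul_one]
    have e11 : 1 / g = 1 / √g * (1 / √g) := by rw [div_mul_div_comm, hs, mul_one]
    have e02 : n * √g = n * √g / √C * √C := by field_simp
    fin_cases i <;> fin_cases j <;> simp [normalArr, Matrix.mul_apply, Fin.sum_univ_three]
    · exact e00
    · simpa using e01
    · exact e02
    · simpa [mul_comm] using e01
    · simpa using e11
    · exact e02.trans (mul_comm _ _)
    · exact hc.symm
  rw [e]
  apply Matrix.PosDef.conjTranspose_mul_self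
  apply Matrix.mulVec_injective_of_isUnit
  rw [Matrix.isUnit_iff_isUnit_det, Matrix.det_fin_three, isUnit_iff_ne_zero]
  simp [hs0.ne', hc0.ne']

theorem normalArr_det (n u v : ℝ) : (Matrix.of (normalArr n u v)).det = 1 := by
  have hg := gap_pos u v
  have hC2 : √(1 + n ^ 2) * √(1 + n ^ 2) = 1 + n ^ 2 := Real.mul_self_sqrt (by positivity)
  have hs : √(gap u v) * √(gap u v) = gap u v := Real.mul_self_sqrt hg.le
  rw [Matrix.det_fin_three]
  simp [normalArr]
  set g := gap u v
  set C := √(1 + n ^ 2)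
  have e1 : (C * g + v ^ 2 / g) * g⁻¹ * C - -v / g * (-v / g) * C = C * C := by
    field_simp
    ring
  have e2 : n * √g * g⁻¹ * (n * √g) = n ^ 2 := by
    rw [show n * √g * g⁻¹ * (n * √g) = n ^ 2 * g⁻¹ * (√g * √g) by ring, hs]
    field_simp
  linarith

/-- The normal form of the points of `X` with respect to the centralizer of the rotation. -/
def normalForm (n u v : ℝ) : X :=
  ⟨Matrix.of (normalArr n u v), normalArr_posDef n u v, normalArr_det n u v⟩

theorem arr_normalForm (n u v : ℝ) : (normalForm n u v).arr = normalArr n u v := rfl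

theorem blockDet_normalArr (n u v : ℝ) : blockDet (normalArr n u v) = √(1 + n ^ 2) := by
  have hg := gap_pos u v
  simp [blockDet, normalArr]
  field_simp
  ring

theorem geomMean_normalArr (n u v : ℝ) : geomMean (normalArr n u v) = √(1 + n ^ 2) := by
  rw [geomMean, blockDet_normalArr]
  exact Real.sqrt_mul_self (Real.sqrt_nonneg _)

theorem scaleFactor_normalArr (n u v : ℝ) : scaleFactor (normalArr n u v) = 1 := by
  rw [scaleFactor, geomMean_normalArr]
  have : 0 < √(1 + n ^ 2) := Real.sqrt_pos.2 (by positivity)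
  change √(√(1 + n ^ 2) / √(1 + n ^ 2)) = 1
  rw [div_self this.ne', Real.sqrt_one]

theorem halfTr_normalArr (n u v : ℝ) : halfTr (normalArr n u v) =
    (√(1 + n ^ 2) * (√(1 + u ^ 2 + v ^ 2) - u) + (√(1 + u ^ 2 + v ^ 2) + u)) / 2 := by
  have hg := gap_pos u v
  have h := gap_mul u v
  have : √(1 + u ^ 2 + v ^ 2) + u = (1 + v ^ 2) / gap u v := by
    field_simp; linarith
  rw [this]
  simp [halfTr, normalArr]
  rw [← gap]
  ring

theorem halfTrAdj_normalArr (n u v : ℝ) : halfTrAdj (normalArr n u v) =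
    (√(1 + n ^ 2) * (√(1 + u ^ 2 + v ^ 2) + u) + (√(1 + u ^ 2 + v ^ 2) - u)) / 2 := by
  have hg := gap_pos u v
  have h := gap_mul u v
  have hC2 : √(1 + n ^ 2) * √(1 + n ^ 2) = 1 + n ^ 2 := Real.mul_self_sqrt (by positivity)
  have hs : √(gap u v) * √(gap u v) = gap u v := Real.mul_self_sqrt hg.le
  have : √(1 + u ^ 2 + v ^ 2) + u = (1 + v ^ 2) / gap u v := by
    field_simp; linarith
  rw [this, ← gap]
  simp only [halfTrAdj, normalArr, Matrix.cons_val]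
  congr 1
  have e : n * √(gap u v) * (n * √(gap u v)) = n ^ 2 * gap u v := by
    linear_combination n ^ 2 * hs
  rw [e]
  field_simp
  linear_combination hC2 * gap u v ^ 2

theorem invN_normalArr (n u v : ℝ) : invN (normalArr n u v) = n ^ 2 := by
  have hC2 : √(1 + n ^ 2) * √(1 + n ^ 2) = 1 + n ^ 2 := Real.mul_self_sqrt (by positivity)
  rw [invN, blockDet_normalArr]
  change √(1 + n ^ 2) * √(1 + n ^ 2) - 1 = _
  linarith

theorem invM_normalArr (n u v : ℝ) : invM (normalArr n u v) = √(1 + u ^ 2 + v ^ 2) := by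
  have : 0 < √(1 + n ^ 2) := Real.sqrt_pos.2 (by positivity)
  rw [invM, scaleFactor_normalArr, geomMean_normalArr, halfTr_normalArr, halfTrAdj_normalArr]
  field_simp
  ring

theorem invU_normalArr (n u v : ℝ) : invU (normalArr n u v) = n ^ 2 * u := by
  have hC2 : √(1 + n ^ 2) * √(1 + n ^ 2) = 1 + n ^ 2 := Real.mul_self_sqrt (by positivity)
  rw [invU, scaleFactor_normalArr, geomMean_normalArr, halfTr_normalArr, halfTrAdj_normalArr]
  linear_combination u * hC2

theorem invV_normalArr (n u v : ℝ) : invV (normalArr n u v) = n ^ 2 * v := by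
  have hg := gap_pos u v
  have hs : √(gap u v) * √(gap u v) = gap u v := Real.mul_self_sqrt hg.le
  simp [invV, cubic, normalArr]
  rw [mul_pow, pow_two (√(gap u v)), hs]
  field_simp

/-- The entries force the parameters: `P.1 1 1` gives the gap, `P.1 0 1` gives v, `P.1 0 2` gives n,
and the determinant equation supplies the last diagonal entry. -/
theorem eq_normalForm_of_apply_eq_zero (P : X) (h12 : P.1 1 2 = 0) (h02 : 0 ≤ P.1 0 2)
    (hc : P.1 2 2 = blockDet P.arr) : ∃ n u v, 0 ≤ n ∧ P = normalForm n u v := by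
  have h11 := P.diag_pos 1
  have h22 := P.diag_pos 2
  rw [P.blockDet_eq] at hc
  have hd := det_three P
  rw [h12] at hd
  set g := 1 / P.1 1 1 with hg
  have hg0 : 0 < g := by positivity
  have h11g : P.1 1 1 = 1 / g := by rw [hg]; field_simp
  set v := -P.1 0 1 / P.1 1 1 with hv
  -- The solution of gap u v = g: by `gap_mul`, the root plus u must be (1 + v²)/g, while the root
  -- minus u is g.
  set u := ((1 + v ^ 2) / g - g) / 2 with hu
  have hq : √(1 + u ^ 2 + v ^ 2) = ((1 + v ^ 2) / g + g) / 2 := by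
    rw [show 1 + u ^ 2 + v ^ 2 = (((1 + v ^ 2) / g + g) / 2) ^ 2 by rw [hu]; field_simp; ring]
    exact Real.sqrt_sq (by positivity)
  have hgap : gap u v = g := by
    rw [gap, hq, hu]; ring
  have hs : √g * √g = g := Real.mul_self_sqrt hg0.le
  have hs0 : 0 < √g := Real.sqrt_pos.2 hg0
  have h01 : P.1 0 1 = -v / g := by rw [hv, hg]; field_simp
  have hn2 : (P.1 0 2 / √g) ^ 2 = P.1 0 2 ^ 2 * P.1 1 1 := by
    rw [div_pow, pow_two (√g), hs, h11g]; ring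
  have hn : √(1 + (P.1 0 2 / √g) ^ 2) = P.1 2 2 := by
    rw [hn2, show 1 + P.1 0 2 ^ 2 * P.1 1 1 = P.1 2 2 ^ 2 by
      rw [pow_two (P.1 2 2)]; nth_rewrite 1 [hc]; linarith]
    exact Real.sqrt_sq h22.le
  have h00 : P.1 0 0 = P.1 2 2 * g + v ^ 2 / g := by
    rw [hc, hv, hg]; field_simp; ring
  have h10 : P.1 1 0 = -v / g := by rw [P.apply_comm, h01]
  have h20 : P.1 2 0 = P.1 0 2 := P.apply_comm _ _
  have h21 : P.1 2 1 = 0 := by rw [P.apply_comm, h12]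
  have h02' : P.1 0 2 / √g * √g = P.1 0 2 := by field_simp
  refine ⟨P.1 0 2 / √g, u, v, by positivity, ?_⟩
  apply X.arr_injective
  rw [arr_normalForm, normalArr, hgap, hn, h02']
  ext i j
  fin_cases i <;> fin_cases j
  · exact h00
  · exact h01
  · rfl
  · exact h10
  · exact h11g
  · exact h12
  · exact h20
  · exact h21
  · rfl

/-- Every point can be rotated and scaled to normal form. -/
theorem exists_normalForm (P : X) : ∃ p r h n u v, 0 ≤ n ∧
    act (spin p r h)⁻¹ P = normalForm n u v := by
  -- With λ² = p² + r², a spin multiplies `blockDet` by λ⁴ and divides the last diagonal entry by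
  -- λ⁴. Making them equal takes an eighth root.
  set lam := √(√(√(P.1 2 2 / blockDet P.arr))) with hlam
  have hb := P.blockDet_pos
  have h22 := P.diag_pos 2
  have hl0 : 0 < lam := by
    apply Real.sqrt_pos.2; apply Real.sqrt_pos.2; apply Real.sqrt_pos.2; positivity
  have hl8 : ((lam ^ 2) ^ 2) ^ 2 = P.1 2 2 / blockDet P.arr := by
    rw [hlam, Real.sq_sqrt (Real.sqrt_nonneg _), Real.sq_sqrt (Real.sqrt_nonneg _),
      Real.sq_sqrt (by positivity)]
  -- A rotation takes the column (P₀₂, P₁₂) to the nonnegative first axis; if the column vanishes,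
  -- any rotation will do.
  obtain ⟨p, r, hpr, h1, h2⟩ : ∃ p r : ℝ, p ^ 2 + r ^ 2 = lam ^ 2 ∧
      -r * P.1 0 2 + p * P.1 1 2 = 0 ∧ 0 ≤ p * P.1 0 2 + r * P.1 1 2 := by
    by_cases hz : P.1 0 2 ^ 2 + P.1 1 2 ^ 2 = 0
    · have e1 : P.1 0 2 = 0 := by nlinarith [sq_nonneg (P.1 0 2), sq_nonneg (P.1 1 2)]
      have e2 : P.1 1 2 = 0 := by nlinarith [sq_nonneg (P.1 0 2), sq_nonneg (P.1 1 2)]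
      exact ⟨lam, 0, by ring, by rw [e1, e2]; ring, by rw [e1, e2]; simp⟩
    · have hz0 : 0 < P.1 0 2 ^ 2 + P.1 1 2 ^ 2 := by positivity
      set B := √(P.1 0 2 ^ 2 + P.1 1 2 ^ 2) with hB
      have hB0 : 0 < B := Real.sqrt_pos.2 hz0
      have hB2 : B ^ 2 = P.1 0 2 ^ 2 + P.1 1 2 ^ 2 := Real.sq_sqrt hz0.le
      refine ⟨lam * P.1 0 2 / B, lam * P.1 1 2 / B, ?_, ?_, ?_⟩
      · field_simp; linarith
      · field_simp; ring
      · have : lam * P.1 0 2 / B * P.1 0 2 + lam * P.1 1 2 / B * P.1 1 2 = lam * B := by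
          field_simp; linarith
        rw [this]; positivity
  have hne : p ^ 2 + r ^ 2 ≠ 0 := by rw [hpr]; positivity
  obtain ⟨n, u, v, hn, e⟩ := eq_normalForm_of_apply_eq_zero (act (spin p r hne)⁻¹ P)
    (by
      have := (spin_entries p r hne P).2.2.2.2.2
      rw [h1, zero_div] at this
      exact this)
    (by
      have := (spin_entries p r hne P).2.2.2.2.1
      change 0 ≤ (act (spin p r hne)⁻¹ P).arr 0 2
      rw [this]
      exact div_nonneg h2 (by positivity))
    (by
      have := (spin_entries p r hne P).2.2.1
      change (act (spin p r hne)⁻¹ P).arr 2 2 = _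
      rw [this, blockDet_spin, hpr]
      have h8 := hl8
      field_simp at h8 ⊢
      linarith)
  exact ⟨p, r, hne, n, u, v, hn, e⟩

/-- Normal forms with vanishing first parameter are determined by the length of the others. -/
theorem exists_rotate_normalForm_zero {u v u' v' : ℝ} (h : u ^ 2 + v ^ 2 = u' ^ 2 + v' ^ 2) :
    ∃ p r h, act (spin p r h)⁻¹ (normalForm 0 u v) = normalForm 0 u' v' := by
  have hm : halfTr (normalArr 0 u v) = halfTr (normalArr 0 u' v') := by
    rw [halfTr_normalArr, halfTr_normalArr, add_assoc, add_assoc, h]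
    simp
  have hd : blockDet (normalArr 0 u v) = blockDet (normalArr 0 u' v') := by
    rw [blockDet_normalArr, blockDet_normalArr]
  set A := normalArr 0 u v with hA
  set B := normalArr 0 u' v' with hB
  have hA10 : A 1 0 = A 0 1 := rfl
  have hB10 : B 1 0 = B 0 1 := rfl
  have hA02 : A 0 2 = 0 := by simp [hA, normalArr]
  have hB02 : B 0 2 = 0 := by simp [hB, normalArr]
  have hA12 : A 1 2 = 0 := by simp [hA, normalArr]
  have hB12 : B 1 2 = 0 := by simp [hB, normalArr]
  have hA22 : A 2 2 = 1 := by simp [hA, normalArr]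
  have hB22 : B 2 2 = 1 := by simp [hB, normalArr]
  rw [halfTr, halfTr] at hm
  rw [blockDet, blockDet, hA10, hB10] at hd
  -- With n = 0 only the traceless part of the block is left, as a complex number that rotations
  -- multiply by squares of unit numbers. Equal traces and determinants give equal moduli, so a
  -- square root of the ratio is the rotation sought.
  obtain ⟨z, hz1, hz2⟩ : ∃ z : ℂ, ‖z‖ = 1 ∧ (⟨(B 0 0 - B 1 1) / 2, B 0 1⟩ : ℂ) * z ^ 2 =
      ⟨(A 0 0 - A 1 1) / 2, A 0 1⟩ := by
    set a : ℂ := ⟨(A 0 0 - A 1 1) / 2, A 0 1⟩ with ha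
    set b : ℂ := ⟨(B 0 0 - B 1 1) / 2, B 0 1⟩ with hb
    have hn : ‖a‖ = ‖b‖ := by
      rw [Complex.norm_def, Complex.norm_def]
      congr 1
      rw [ha, hb, Complex.normSq_mk, Complex.normSq_mk]
      have e1 : A 0 0 + A 1 1 = B 0 0 + B 1 1 := by linarith
      linear_combination (1 / 4) * (A 0 0 + A 1 1 + (B 0 0 + B 1 1)) * e1 - hd
    by_cases h0 : b = 0
    · refine ⟨1, by simp, ?_⟩
      rw [h0, norm_zero, norm_eq_zero] at hn
      rw [h0, hn, zero_mul]
    · obtain ⟨z, hz⟩ := IsAlgClosed.exists_pow_nat_eq (a / b) (n := 2) (by norm_num)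
      refine ⟨z, ?_, ?_⟩
      · have : ‖z‖ ^ 2 = 1 := by
          rw [← norm_pow, hz, norm_div, hn, div_self (norm_ne_zero_iff.2 h0)]
        exact (pow_eq_one_iff_of_nonneg (norm_nonneg z) (by norm_num)).1 this
      · rw [hz, mul_div_cancel₀ _ h0]
  have hpr : z.re ^ 2 + z.im ^ 2 = 1 := by
    have : Complex.normSq z = 1 := by rw [Complex.normSq_eq_norm_sq, hz1]; norm_num
    rw [Complex.normSq_apply] at this
    linarith
  have hre := congrArg Complex.re hz2
  have him := congrArg Complex.im hz2
  simp [pow_two] at hre him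
  set p := z.re
  set r := z.im
  have hne : p ^ 2 + r ^ 2 ≠ 0 := by rw [hpr]; norm_num
  refine ⟨p, r, hne, X.arr_injective ?_⟩
  obtain ⟨h1, h2, h3, h4, h5, h6⟩ := spin_entries p r hne (normalForm 0 u v)
  have e1 : A 0 0 + A 1 1 = B 0 0 + B 1 1 := by linarith
  change _ = p ^ 2 * A 0 0 + 2 * p * r * A 0 1 + r ^ 2 * A 1 1 at h1
  change _ = r ^ 2 * A 0 0 - 2 * p * r * A 0 1 + p ^ 2 * A 1 1 at h2
  change _ = A 2 2 / (p ^ 2 + r ^ 2) ^ 2 at h3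
  change _ = -(p * r) * A 0 0 + (p ^ 2 - r ^ 2) * A 0 1 + p * r * A 1 1 at h4
  change _ = (p * A 0 2 + r * A 1 2) / (p ^ 2 + r ^ 2) at h5
  change _ = (-r * A 0 2 + p * A 1 2) / (p ^ 2 + r ^ 2) at h6
  rw [hpr, hA22, one_pow, div_one, ← hB22] at h3
  rw [hA02, hA12, mul_zero, mul_zero, add_zero, zero_div] at h5 h6
  have k1 : (act (spin p r hne)⁻¹ (normalForm 0 u v)).arr 0 0 = B 0 0 := by
    rw [h1]
    linear_combination -(p ^ 2 - r ^ 2) * hre - 2 * p * r * him + e1 * (p ^ 2 + r ^ 2) / 2 +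
      hpr * ((B 0 0 + B 1 1) / 2 + (p ^ 2 + r ^ 2 + 1) * (B 0 0 - B 1 1) / 2)
  have k2 : (act (spin p r hne)⁻¹ (normalForm 0 u v)).arr 1 1 = B 1 1 := by
    rw [h2]
    linear_combination (p ^ 2 - r ^ 2) * hre + 2 * p * r * him + e1 * (p ^ 2 + r ^ 2) / 2 +
      hpr * ((B 0 0 + B 1 1) / 2 - (p ^ 2 + r ^ 2 + 1) * (B 0 0 - B 1 1) / 2)
  have k4 : (act (spin p r hne)⁻¹ (normalForm 0 u v)).arr 0 1 = B 0 1 := by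
    rw [h4]
    linear_combination -(p ^ 2 - r ^ 2) * him + 2 * p * r * hre +
      hpr * (p ^ 2 + r ^ 2 + 1) * B 0 1
  have hB20 : B 2 0 = 0 := by simp [hB, normalArr]
  have hB21 : B 2 1 = 0 := by simp [hB, normalArr]
  have hsym := X.apply_comm (act (spin p r hne)⁻¹ (normalForm 0 u v))
  change _ = B
  ext i j
  fin_cases i <;> fin_cases j
  · exact k1
  · exact k4
  · exact h5.trans hB02.symm
  · exact (hsym 1 0).trans (k4.trans hB10.symm)
  · exact k2
  · exact h6.trans hB12.symm
  · exact (hsym 2 0).trans (h5.trans hB20.symm)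
  · exact (hsym 2 1).trans (h6.trans hB21.symm)
  · exact h3

/-! ### Points fixed by the rotation. -/

theorem rot_eq_spin_inv : ∃ h, rot = (spin (-1 / 2) (√3 / 2) h)⁻¹ := by
  have h3 : √3 * √3 = 3 := Real.mul_self_sqrt (by norm_num)
  have h : (-1 / 2 : ℝ) ^ 2 + (√3 / 2) ^ 2 = 1 := by linarith
  refine ⟨by rw [h]; norm_num, ?_⟩
  apply inv_injective
  rw [inv_inv]
  apply Subtype.ext
  rw [coe_rot_inv, coe_rot, spin]
  ext i j
  fin_cases i <;> fin_cases j <;> simp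
  simpa using h

/-- The rotation turns the column by 2π/3 and the traceless part of the block by 4π/3, up to sign.
Neither is a full turn, so both must vanish at a fixed point. -/
theorem act_rot_eq_iff (P : X) :
    act rot P = P ↔ P.1 0 2 = 0 ∧ P.1 1 2 = 0 ∧ P.1 0 1 = 0 ∧ P.1 0 0 = P.1 1 1 := by
  obtain ⟨h, e⟩ := rot_eq_spin_inv
  have h3 : √3 * √3 = 3 := Real.mul_self_sqrt (by norm_num)
  have hs : 0 < √3 := by positivity
  have hd : (-1 / 2 : ℝ) ^ 2 + (√3 / 2) ^ 2 = 1 := by linarith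
  obtain ⟨h1, h2, h3', h4, h5, h6⟩ := spin_entries _ _ h P
  rw [← e] at h1 h2 h3' h4 h5 h6
  rw [hd] at h3' h5 h6
  constructor
  · intro hP
    rw [hP] at h1 h2 h3' h4 h5 h6
    simp only [X.arr] at h1 h2 h3' h4 h5 h6
    have a1 : P.1 1 2 = √3 * P.1 0 2 := by nlinarith
    have a2 : P.1 0 2 = 0 := by rw [a1] at h6; nlinarith
    have a3 : P.1 0 1 = √3 / 2 * (P.1 1 1 - P.1 0 0) * (-1 / 3) := by
      linear_combination (2 / 3) * h4 - 1 / 6 * P.1 0 1 * h3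
    have a4 : P.1 0 0 = P.1 1 1 := by rw [a3] at h1; nlinarith
    exact ⟨a2, by rw [a1, a2, mul_zero], by rw [a3, a4]; ring, a4⟩
  · rintro ⟨a1, a2, a3, a4⟩
    rw [a1, a2] at h5 h6
    rw [a3, a4] at h1 h2 h4
    have hsym := X.apply_comm (act rot P)
    have k1 : (act rot P).1 0 0 = P.1 0 0 := h1.trans (by rw [a4]; linear_combination P.1 1 1 * hd)
    have k2 : (act rot P).1 1 1 = P.1 1 1 := h2.trans (by linear_combination P.1 1 1 * hd)
    have k3 : (act rot P).1 2 2 = P.1 2 2 := h3'.trans (by ring)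
    have k4 : (act rot P).1 0 1 = P.1 0 1 := h4.trans (by rw [a3]; ring)
    have k5 : (act rot P).1 0 2 = P.1 0 2 := h5.trans (by rw [a1]; ring)
    have k6 : (act rot P).1 1 2 = P.1 1 2 := h6.trans (by rw [a2]; ring)
    apply X.arr_injective
    ext i j
    fin_cases i <;> fin_cases j
    · exact k1
    · exact k4
    · exact k5
    · exact (hsym 1 0).trans (k4.trans (P.apply_comm _ _))
    · exact k2
    · exact k6
    · exact (hsym 2 0).trans (k5.trans (P.apply_comm _ _))
    · exact (hsym 2 1).trans (k6.trans (P.apply_comm _ _))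
    · exact k3

theorem act_rot_normalForm_iff (n u v : ℝ) :
    act rot (normalForm n u v) = normalForm n u v ↔ n = 0 ∧ u = 0 ∧ v = 0 := by
  rw [act_rot_eq_iff]
  change normalArr n u v 0 2 = 0 ∧ normalArr n u v 1 2 = 0 ∧ normalArr n u v 0 1 = 0 ∧
    normalArr n u v 0 0 = normalArr n u v 1 1 ↔ _
  have hg := gap_pos u v
  have hs : 0 < √(gap u v) := Real.sqrt_pos.2 hg
  simp only [normalArr, Matrix.cons_val]
  constructor
  · rintro ⟨h1, -, h2, h3⟩
    have hn : n = 0 := by rcases mul_eq_zero.1 h1 with h | h <;> [exact h; linarith]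
    have hv : v = 0 := by rcases div_eq_zero_iff.1 h2 with h | h <;> linarith
    rw [hn, hv] at h3
    simp at h3
    have h4 : gap u 0 * gap u 0 = 1 := by
      rw [hv] at hg; field_simp at h3; nlinarith
    have h5 : gap u 0 = 1 := by rw [hv] at hg; nlinarith
    have h6 := gap_mul u 0
    rw [h5] at h6
    have h7 : √(1 + u ^ 2 + 0 ^ 2) - u = 1 := h5
    exact ⟨hn, by linarith, hv⟩
  · rintro ⟨rfl, rfl, rfl⟩
    simp [gap]


/-! ### The invariants separate the orbits -/

/-- The horizontal part is 2n²(u + iv)²/|u + iv|. At u = v = 0 division by zero gives 0, which is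
also the limit. -/
theorem invMap_normalArr (n u v : ℝ) : invMap (normalArr n u v) =
    !₂[2 * n ^ 2 * (u ^ 2 - v ^ 2) / √(u ^ 2 + v ^ 2), 4 * n ^ 2 * u * v / √(u ^ 2 + v ^ 2),
      u ^ 2 + v ^ 2 - n ^ 4] := by
  have e1 : √((n ^ 2 * u) ^ 2 + (n ^ 2 * v) ^ 2) = n ^ 2 * √(u ^ 2 + v ^ 2) := by
    rw [show (n ^ 2 * u) ^ 2 + (n ^ 2 * v) ^ 2 = (n ^ 2) ^ 2 * (u ^ 2 + v ^ 2) by ring,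
      Real.sqrt_mul (by positivity), Real.sqrt_sq (by positivity)]
  rw [invMap, invN_normalArr, invM_normalArr, invU_normalArr, invV_normalArr, e1,
    Real.sq_sqrt (by positivity)]
  have e2 : 1 + u ^ 2 + v ^ 2 - 1 - (n ^ 2) ^ 2 = u ^ 2 + v ^ 2 - n ^ 4 := by ring
  rw [e2]
  rcases eq_or_ne n 0 with rfl | hn
  · simp
  · rw [show 2 * ((n ^ 2 * u) ^ 2 - (n ^ 2 * v) ^ 2) = n ^ 2 * (2 * n ^ 2 * (u ^ 2 - v ^ 2)) by ring,
      show 2 * (2 * (n ^ 2 * u) * (n ^ 2 * v)) = n ^ 2 * (4 * n ^ 2 * u * v) by ring,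
      mul_div_mul_left _ _ (by positivity), mul_div_mul_left _ _ (by positivity)]

/-- With r² = u² + v², the height and the horizontal length are the real and imaginary parts of (r +
in²)². Hence the norm of `invMap` is r² + n⁴. -/
theorem invMap_normalArr_sq (n u v : ℝ) :
    invMap (normalArr n u v) 0 ^ 2 + invMap (normalArr n u v) 1 ^ 2 =
      4 * n ^ 4 * (u ^ 2 + v ^ 2) ∧ invMap (normalArr n u v) 2 = u ^ 2 + v ^ 2 - n ^ 4 := by
  rw [invMap_normalArr]
  simp only [Matrix.cons_val]
  refine ⟨?_, trivial⟩
  rw [div_pow, div_pow, Real.sq_sqrt (by positivity)]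
  rcases eq_or_ne (u ^ 2 + v ^ 2) 0 with h | h
  · rw [h]; simp
  · field_simp; ring

theorem eq_of_invMap_normalArr_eq {n u v n' u' v' : ℝ} (hn : 0 ≤ n) (hn' : 0 ≤ n')
    (h : invMap (normalArr n u v) = invMap (normalArr n' u' v')) :
    n = n' ∧ u ^ 2 + v ^ 2 = u' ^ 2 + v' ^ 2 ∧
      (n ≠ 0 → (u = u' ∧ v = v') ∨ (u = -u' ∧ v = -v')) := by
  obtain ⟨h1, h2⟩ := invMap_normalArr_sq n u v
  obtain ⟨h1', h2'⟩ := invMap_normalArr_sq n' u' v'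
  rw [h, h1'] at h1
  rw [h, h2'] at h2
  -- The norm determines r² + n⁴; with the height r² - n⁴ this gives r and n.
  have hsum : u ^ 2 + v ^ 2 + n ^ 4 = u' ^ 2 + v' ^ 2 + n' ^ 4 := by
    have : (u ^ 2 + v ^ 2 + n ^ 4) ^ 2 = (u' ^ 2 + v' ^ 2 + n' ^ 4) ^ 2 := by
      linear_combination -h1 - (u ^ 2 + v ^ 2 - n ^ 4 + (u' ^ 2 + v' ^ 2 - n' ^ 4)) * h2
    exact (pow_left_inj₀ (by positivity) (by positivity) (by norm_num)).1 this
  have hr : u ^ 2 + v ^ 2 = u' ^ 2 + v' ^ 2 := by linarith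
  have hnn : n = n' := by
    have : n ^ 4 = n' ^ 4 := by linarith
    exact (pow_left_inj₀ hn hn' (by norm_num)).1 this
  refine ⟨hnn, hr, fun hn0 => ?_⟩
  rw [invMap_normalArr, invMap_normalArr, ← hnn, ← hr] at h
  have k0 := congrArg (fun w : EuclideanSpace ℝ (Fin 3) => w 0) h
  have k1 := congrArg (fun w : EuclideanSpace ℝ (Fin 3) => w 1) h
  simp only [Matrix.cons_val] at k0 k1
  rcases eq_or_ne (u ^ 2 + v ^ 2) 0 with h0 | h0
  · have a1 : u = 0 := by nlinarith [sq_nonneg u, sq_nonneg v]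
    have a2 : v = 0 := by nlinarith [sq_nonneg u, sq_nonneg v]
    rw [h0] at hr
    have a3 : u' = 0 := by nlinarith [sq_nonneg u', sq_nonneg v']
    have a4 : v' = 0 := by nlinarith [sq_nonneg u', sq_nonneg v']
    left
    rw [a1, a2, a3, a4]
    exact ⟨rfl, rfl⟩
  · have hs : 0 < √(u ^ 2 + v ^ 2) := Real.sqrt_pos.2 (by positivity)
    rw [div_left_inj' hs.ne'] at k0 k1
    have hn2 : 0 < n ^ 2 := by positivity
    have k0' : u ^ 2 - v ^ 2 = u' ^ 2 - v' ^ 2 :=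
      mul_left_cancel₀ (mul_pos two_pos hn2).ne' k0
    have k1' : u * v = u' * v' := by
      have : 4 * n ^ 2 * (u * v) = 4 * n ^ 2 * (u' * v') := by linarith
      exact mul_left_cancel₀ (by positivity) this
    have hz : (⟨u, v⟩ : ℂ) ^ 2 = (⟨u', v'⟩ : ℂ) ^ 2 := by
      apply Complex.ext
      · simp [pow_two]; linarith
      · simp [pow_two]; linarith
    rcases sq_eq_sq_iff_eq_or_eq_neg.1 hz with e | e
    · left
      exact ⟨congrArg Complex.re e, congrArg Complex.im e⟩
    · right
      exact ⟨congrArg Complex.re e, congrArg Complex.im e⟩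

theorem exists_mem_commRot_normalForm (P : X) :
    ∃ g ∈ commRot, ∃ n u v, 0 ≤ n ∧ g P = normalForm n u v := by
  obtain ⟨p, r, h, n, u, v, hn, e⟩ := exists_normalForm P
  exact ⟨_, act_spin_inv_mem p r h, n, u, v, hn, e⟩

theorem exists_mem_commRot_of_invMap_eq {P Q : X} (h : invMap P.arr = invMap Q.arr) :
    ∃ g ∈ commRot, Q = g P := by
  obtain ⟨g, hg, n, u, v, hn, e⟩ := exists_mem_commRot_normalForm P
  obtain ⟨g', hg', n', u', v', hn', e'⟩ := exists_mem_commRot_normalForm Q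
  suffices ∃ k ∈ commRot, normalForm n' u' v' = k (normalForm n u v) by
    obtain ⟨k, hk, hk'⟩ := this
    refine ⟨g'⁻¹ * k * g, mul_mem (mul_mem (inv_mem hg') hk) hg, ?_⟩
    rw [Equiv.Perm.mul_apply, Equiv.Perm.mul_apply, e, ← hk', ← e', ← Equiv.Perm.mul_apply,
      inv_mul_cancel, Equiv.Perm.one_apply]
  have h' : invMap (normalArr n u v) = invMap (normalArr n' u' v') := by
    rw [← arr_normalForm, ← arr_normalForm, ← e, ← e', invMap_apply_of_mem hg,
      invMap_apply_of_mem hg', h]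
  obtain ⟨hnn, hr, hs⟩ := eq_of_invMap_normalArr_eq hn hn' h'
  subst hnn
  rcases eq_or_ne n 0 with rfl | hn0
  · obtain ⟨p, r, hpr, hk⟩ := exists_rotate_normalForm_zero hr
    exact ⟨_, act_spin_inv_mem p r hpr, hk.symm⟩
  rcases hs hn0 with ⟨rfl, rfl⟩ | ⟨rfl, rfl⟩
  · exact ⟨1, one_mem _, rfl⟩
  -- The polarity realizes the change of sign of (u, v). Its value at a normal form is normalized
  -- again, and the new parameters are read off from `invN`, `invU` and `invV`.
  obtain ⟨p, r, hpr, m, a, b, hm, hk⟩ := exists_normalForm (polarity (normalForm n (-u') (-v')))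
  refine ⟨act (spin p r hpr)⁻¹ * polarity, mul_mem (act_spin_inv_mem p r hpr) polarity_mem_commRot,
    ?_⟩
  rw [Equiv.Perm.mul_apply, hk]
  have hN : m ^ 2 = n ^ 2 := by
    rw [← invN_normalArr m a b, ← arr_normalForm, ← hk, invN_spin, invN_polarity, arr_normalForm,
      invN_normalArr]
  have hmn : m = n := (pow_left_inj₀ hm hn (by norm_num)).1 hN
  subst hmn
  have hU : m ^ 2 * a = m ^ 2 * u' := by
    rw [← invU_normalArr m a b, ← arr_normalForm, ← hk, invU_spin, invU_polarity, arr_normalForm,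
      invU_normalArr]
    ring
  have hV : m ^ 2 * b = m ^ 2 * v' := by
    rw [← invV_normalArr m a b, ← arr_normalForm, ← hk, invV_spin, invV_polarity, arr_normalForm,
      invV_normalArr]
    ring
  rw [mul_left_cancel₀ (pow_ne_zero 2 hn0) hU, mul_left_cancel₀ (pow_ne_zero 2 hn0) hV]

/-! ### Solving for the normal form -/

/-- The length of a vector of `ℝ³`. -/
def len (w : EuclideanSpace ℝ (Fin 3)) : ℝ := √(w 0 ^ 2 + w 1 ^ 2 + w 2 ^ 2)

/-- The distance to the third axis. -/
def axisDist (w : EuclideanSpace ℝ (Fin 3)) : ℝ := √(w 0 ^ 2 + w 1 ^ 2)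

/-- `solveN` and `solveR` are the half-length formulas for the square root r + ia of w₂ + i ·
`axisDist w`. Here a is n², so n itself is √(solveN w). -/
def solveN (w : EuclideanSpace ℝ (Fin 3)) : ℝ := √((len w - w 2) / 2)

def solveR (w : EuclideanSpace ℝ (Fin 3)) : ℝ := √((len w + w 2) / 2)

theorem abs_le_len (w : EuclideanSpace ℝ (Fin 3)) : |w 2| ≤ len w := by
  rw [← Real.sqrt_sq_eq_abs]
  exact Real.sqrt_le_sqrt (by nlinarith [sq_nonneg (w 0), sq_nonneg (w 1)])

theorem solveN_sq (w : EuclideanSpace ℝ (Fin 3)) : solveN w ^ 2 = (len w - w 2) / 2 :=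
  Real.sq_sqrt (by have := (abs_le.1 (abs_le_len w)).2; linarith)

theorem solveR_sq (w : EuclideanSpace ℝ (Fin 3)) : solveR w ^ 2 = (len w + w 2) / 2 :=
  Real.sq_sqrt (by have := (abs_le.1 (abs_le_len w)).1; linarith)

theorem two_mul_solveN_mul_solveR (w : EuclideanSpace ℝ (Fin 3)) :
    2 * solveN w * solveR w = axisDist w := by
  have h1 : len w ^ 2 = w 0 ^ 2 + w 1 ^ 2 + w 2 ^ 2 := Real.sq_sqrt (by positivity)
  have h2 : axisDist w ^ 2 = w 0 ^ 2 + w 1 ^ 2 := Real.sq_sqrt (by positivity)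
  have hN : 0 ≤ solveN w := Real.sqrt_nonneg _
  have hR : 0 ≤ solveR w := Real.sqrt_nonneg _
  have hA : 0 ≤ axisDist w := Real.sqrt_nonneg _
  refine (pow_left_inj₀ (by positivity) hA (two_ne_zero)).1 ?_
  rw [mul_pow, mul_pow, solveN_sq, solveR_sq, h2]
  linear_combination h1

theorem invMap_solve (w : EuclideanSpace ℝ (Fin 3)) (a b : ℝ) (hab : a ^ 2 + b ^ 2 = 1)
    (h0 : w 0 = axisDist w * (a ^ 2 - b ^ 2)) (h1 : w 1 = axisDist w * (2 * a * b)) :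
    invMap (normalArr √(solveN w) (solveR w * a) (solveR w * b)) = w := by
  have hN : 0 ≤ solveN w := Real.sqrt_nonneg _
  have hR : 0 ≤ solveR w := Real.sqrt_nonneg _
  have hs : (solveR w * a) ^ 2 + (solveR w * b) ^ 2 = solveR w ^ 2 := by
    linear_combination solveR w ^ 2 * hab
  have hq : √(solveN w) ^ 2 = solveN w := Real.sq_sqrt hN
  have hq4 : √(solveN w) ^ 4 = solveN w ^ 2 := by
    rw [show √(solveN w) ^ 4 = (√(solveN w) ^ 2) ^ 2 by ring, hq]
  rw [invMap_normalArr, hs, hq, hq4, Real.sqrt_sq hR, solveN_sq, solveR_sq]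
  have hax := two_mul_solveN_mul_solveR w
  ext i
  fin_cases i
  · change 2 * solveN w * ((solveR w * a) ^ 2 - (solveR w * b) ^ 2) / solveR w = w 0
    rw [h0, ← hax]
    rcases eq_or_ne (solveR w) 0 with h | h
    · rw [h]; simp
    · field_simp
  · change 4 * solveN w * (solveR w * a) * (solveR w * b) / solveR w = w 1
    rw [h1, ← hax]
    rcases eq_or_ne (solveR w) 0 with h | h
    · rw [h]; simp
    · field_simp; ring
  · change (len w + w 2) / 2 - (len w - w 2) / 2 = w 2
    ring

theorem exists_half_angle (x y : ℝ) : ∃ a b : ℝ, a ^ 2 + b ^ 2 = 1 ∧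
    x = √(x ^ 2 + y ^ 2) * (a ^ 2 - b ^ 2) ∧ y = √(x ^ 2 + y ^ 2) * (2 * a * b) := by
  rcases eq_or_ne (x ^ 2 + y ^ 2) 0 with h | h
  · have a1 : x = 0 := by nlinarith [sq_nonneg x, sq_nonneg y]
    have a2 : y = 0 := by nlinarith [sq_nonneg x, sq_nonneg y]
    exact ⟨1, 0, by norm_num, by rw [a1, a2]; simp, by rw [a1, a2]; simp⟩
  · have hs : 0 < √(x ^ 2 + y ^ 2) := Real.sqrt_pos.2 (by positivity)
    have hss : √(x ^ 2 + y ^ 2) ^ 2 = x ^ 2 + y ^ 2 := Real.sq_sqrt (by positivity)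
    set s := √(x ^ 2 + y ^ 2)
    obtain ⟨z, hz⟩ := IsAlgClosed.exists_pow_nat_eq (⟨x / s, y / s⟩ : ℂ) (n := 2) (by norm_num)
    have hn : Complex.normSq z = 1 := by
      have : Complex.normSq z ^ 2 = 1 := by
        rw [← map_pow, hz, Complex.normSq_mk]
        field_simp
        linarith
      exact (pow_eq_one_iff_of_nonneg (Complex.normSq_nonneg z) (by norm_num)).1 this
    rw [Complex.normSq_apply] at hn
    have hre := congrArg Complex.re hz
    have him := congrArg Complex.im hz
    simp [pow_two] at hre him
    refine ⟨z.re, z.im, by linarith, ?_, ?_⟩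
    · rw [pow_two, pow_two, hre]; field_simp
    · rw [show 2 * z.re * z.im = y / s by linarith]; field_simp

theorem exists_normalArr_invMap_eq (w : EuclideanSpace ℝ (Fin 3)) :
    ∃ n u v, 0 ≤ n ∧ invMap (normalArr n u v) = w := by
  obtain ⟨a, b, hab, h0, h1⟩ := exists_half_angle (w 0) (w 1)
  exact ⟨_, _, _, Real.sqrt_nonneg _, invMap_solve w a b hab h0 h1⟩

theorem invMap_normalArr_eq_zero_iff (n u v : ℝ) :
    invMap (normalArr n u v) = 0 ↔ n = 0 ∧ u = 0 ∧ v = 0 := by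
  constructor
  · intro h
    obtain ⟨h1, h2⟩ := invMap_normalArr_sq n u v
    rw [h] at h1 h2
    simp at h1 h2
    have hr : u ^ 2 + v ^ 2 = n ^ 4 := by linarith
    rw [hr] at h1
    have hn : n = 0 := by simpa using h1
    rw [hn] at hr
    simp at hr
    exact ⟨hn, by nlinarith [sq_nonneg u, sq_nonneg v], by nlinarith [sq_nonneg u, sq_nonneg v]⟩
  · rintro ⟨rfl, rfl, rfl⟩
    rw [invMap_normalArr]
    ext i
    fin_cases i <;> simp

theorem invMap_eq_zero_iff (P : X) : invMap P.arr = 0 ↔ act rot P = P := by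
  obtain ⟨g, hg, n, u, v, hn, e⟩ := exists_mem_commRot_normalForm P
  have hc : act rot * g = g * act rot := by
    rw [commRot, Subgroup.mem_inf, Subgroup.mem_centralizer_singleton_iff] at hg
    exact hg.2.symm
  rw [← invMap_apply_of_mem hg, e, arr_normalForm, invMap_normalArr_eq_zero_iff,
    ← act_rot_normalForm_iff, ← e, ← Equiv.Perm.mul_apply, hc, Equiv.Perm.mul_apply,
    g.apply_eq_iff_eq]


/-! ### Line-preserving representations -/

/-- The half turn about the axis. -/
def halfTurn : SL3 := spin (-1) 0 (by norm_num)

theorem coe_halfTurn : (halfTurn : Mat3) = !![-1, 0, 0; 0, -1, 0; 0, 0, 1] := by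
  rw [halfTurn, spin]
  ext i j
  fin_cases i <;> fin_cases j <;> simp

theorem halfTurn_mul_self : halfTurn * halfTurn = 1 := by
  apply Subtype.ext
  rw [Matrix.SpecialLinearGroup.coe_mul, coe_halfTurn]
  ext i j
  fin_cases i <;> fin_cases j <;> simp [Matrix.mul_apply, Fin.sum_univ_three]

theorem halfTurn_inv : halfTurn⁻¹ = halfTurn := inv_eq_of_mul_eq_one_right halfTurn_mul_self

theorem contra_halfTurn : contra halfTurn = halfTurn := by
  apply Subtype.ext
  rw [coe_contra, halfTurn_inv, coe_halfTurn]
  ext i j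
  fin_cases i <;> fin_cases j <;> rfl

/-- The action of the word `σ₂σ₃σ₂`. -/
theorem NormRep.hom_conj (ρ : NormRep) : (ρ.hom (σ₂ * σ₃ * σ₂) : Equiv.Perm X) =
    act (ρ.fix.toSL⁻¹ * rot * ρ.fix.toSL) := by
  have hP : contra ρ.fix.toSL⁻¹ = ρ.fix.toSL := by
    apply Subtype.ext
    rw [coe_contra, inv_inv, X.coe_toSL, X.transpose_eq]
  rw [map_mul, map_mul, Subgroup.coe_mul, Subgroup.coe_mul, ρ.hom_two, ρ.rotation, sym,
    mul_assoc, ← mul_assoc (act rot), ← map_mul, mul_assoc, ← mul_assoc polarity,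
    polarity_mul_act, mul_assoc, polarity_mul_polarity, mul_one, map_mul contra, contra_rot, hP,
    ← map_mul, mul_assoc]

theorem contra_toSL (P : X) : contra P.toSL = P.toSL⁻¹ := by
  apply Subtype.ext
  rw [coe_contra, SL3.coe_inv, Matrix.transpose_nonsing_inv, X.coe_toSL, X.transpose_eq]

theorem rot_mulVec (v : Fin 3 → ℝ) : (rot : Mat3).mulVec v =
    ![-1 / 2 * v 0 + √3 / 2 * v 1, -(√3 / 2) * v 0 - 1 / 2 * v 1, v 2] := by
  rw [coe_rot]
  ext i
  fin_cases i <;> simp [Matrix.mulVec, dotProduct, Fin.sum_univ_three]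
  ring

/-- The horizontal plane is the only invariant plane. If v ∈ l has v₂ ≠ 0, the sum over its orbit
lies on the axis; a second vector of l then gives a horizontal one, which spans the horizontal plane
with its rotation, so l would be everything. -/
theorem apply_two_eq_zero_of_rot_invariant {l : Submodule ℝ (Fin 3 → ℝ)}
    (hl : Module.finrank ℝ l = 2) (hr : ∀ v ∈ l, (rot : Mat3).mulVec v ∈ l)
    {v : Fin 3 → ℝ} (hv : v ∈ l) : v 2 = 0 := by
  by_contra hv2
  have h3 : √3 * √3 = 3 := Real.mul_self_sqrt (by norm_num)
  have he : ![0, 0, 1] ∈ l := by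
    have : v + (rot : Mat3).mulVec v + (rot : Mat3).mulVec ((rot : Mat3).mulVec v) ∈ l :=
      add_mem (add_mem hv (hr _ hv)) (hr _ (hr _ hv))
    have h2 := l.smul_mem (1 / (3 * v 2)) this
    convert h2 using 1
    rw [rot_mulVec, rot_mulVec]
    ext i
    fin_cases i
    · change (0 : ℝ) = 1 / (3 * v 2) * (v 0 + (-1 / 2 * v 0 + √3 / 2 * v 1) +
        (-1 / 2 * (-1 / 2 * v 0 + √3 / 2 * v 1) + √3 / 2 * (-(√3 / 2) * v 0 - 1 / 2 * v 1)))
      linear_combination 1 / (3 * v 2) * (1 / 4 * v 0 * h3)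
    · change (0 : ℝ) = 1 / (3 * v 2) * (v 1 + (-(√3 / 2) * v 0 - 1 / 2 * v 1) +
        (-(√3 / 2) * (-1 / 2 * v 0 + √3 / 2 * v 1) - 1 / 2 * (-(√3 / 2) * v 0 - 1 / 2 * v 1)))
      linear_combination 1 / (3 * v 2) * (1 / 4 * v 1 * h3)
    · change (1 : ℝ) = 1 / (3 * v 2) * (v 2 + v 2 + v 2)
      field_simp
      norm_num
  obtain ⟨w, hw, hw'⟩ : ∃ w ∈ l, w ∉ Submodule.span ℝ {(![0, 0, 1] : Fin 3 → ℝ)} := by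
    by_contra! hcon
    have h1 : Module.finrank ℝ l ≤ 1 :=
      (Submodule.finrank_mono (show l ≤ _ from hcon)).trans (finrank_span_singleton (K := ℝ)
        (v := (![0, 0, 1] : Fin 3 → ℝ)) (by intro h; simpa using congrFun h 2)).le
    omega
  have hu : ![w 0, w 1, 0] ∈ l := by
    have := sub_mem hw (l.smul_mem (w 2) he)
    convert this using 1
    ext i
    fin_cases i <;> simp
  have hu' := hr _ hu
  rw [rot_mulVec] at hu'
  simp at hu'
  have hne : w 0 ^ 2 + w 1 ^ 2 ≠ 0 := by
    intro h0
    have a1 : w 0 = 0 := by nlinarith [sq_nonneg (w 0), sq_nonneg (w 1)]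
    have a2 : w 1 = 0 := by nlinarith [sq_nonneg (w 0), sq_nonneg (w 1)]
    apply hw'
    rw [Submodule.mem_span_singleton]
    refine ⟨w 2, ?_⟩
    ext i
    fin_cases i <;> simp [a1, a2]
  have htop : l = ⊤ := by
    rw [eq_top_iff]
    rintro x -
    have hs : √3 ≠ 0 := by positivity
    -- The quarter turn is a linear combination of the rotation and the identity on the plane.
    have hD : ![-w 1, w 0, 0] ∈ l := by
      have := l.smul_mem (-2 / √3) (add_mem hu' (l.smul_mem (1 / 2) hu))
      convert this using 1
      ext i
      fin_cases i <;> simp <;> field_simp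
      ring
    have := add_mem (add_mem (l.smul_mem ((x 0 * w 0 + x 1 * w 1) / (w 0 ^ 2 + w 1 ^ 2)) hu)
      (l.smul_mem ((x 1 * w 0 - x 0 * w 1) / (w 0 ^ 2 + w 1 ^ 2)) hD)) (l.smul_mem (x 2) he)
    convert this using 1
    ext i
    fin_cases i <;> simp <;> field_simp <;> ring
  rw [htop, finrank_top] at hl
  simp at hl

/-- A common plane l is invariant under `rot` and P⁻¹ `rot` P, so l and Pl are both the horizontal
plane and P has no mixed entries. Conversely, such a P commutes with the half turn, as does the
whole image. -/
theorem linePreserving_iff (ρ : NormRep) :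
    LinePreserving ρ ↔ ρ.fix.1 0 2 = 0 ∧ ρ.fix.1 1 2 = 0 := by
  set P := ρ.fix with hP
  have hPc : P.1 * ((P.toSL⁻¹ : SL3) : Mat3) = 1 := by
    have := congrArg Subtype.val (mul_inv_cancel P.toSL)
    rwa [Matrix.SpecialLinearGroup.coe_mul] at this
  constructor
  · rintro ⟨l, hl, h⟩
    have hr : ∀ v ∈ l, (rot : Mat3).mulVec v ∈ l := by
      intro v hv
      rw [← h σ₃ rot ρ.rotation]
      exact Submodule.mem_map_of_mem hv
    have h2 : ∀ v ∈ l, ((P.toSL⁻¹ * rot * P.toSL : SL3) : Mat3).mulVec v ∈ l := by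
      intro v hv
      rw [← h _ _ ρ.hom_conj]
      exact Submodule.mem_map_of_mem hv
    have hinj : Function.Injective (Matrix.toLin' P.1) := by
      apply Matrix.mulVec_injective_of_isUnit
      exact P.2.1.isUnit
    have hl' : Module.finrank ℝ (l.map (Matrix.toLin' P.1)) = 2 := by
      rw [← hl]
      exact (Submodule.equivMapOfInjective _ hinj l).finrank_eq.symm
    have hr' : ∀ v ∈ l.map (Matrix.toLin' P.1), (rot : Mat3).mulVec v ∈
        l.map (Matrix.toLin' P.1) := by
      rintro _ ⟨v, hv, rfl⟩
      refine ⟨_, h2 v hv, ?_⟩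
      rw [Matrix.toLin'_apply, Matrix.toLin'_apply, Matrix.mulVec_mulVec, Matrix.mulVec_mulVec,
        Matrix.SpecialLinearGroup.coe_mul, Matrix.SpecialLinearGroup.coe_mul, ← Matrix.mul_assoc,
        ← Matrix.mul_assoc, hPc, one_mul]
      rfl
    -- One nonzero horizontal v and its rotation form a basis of the plane, so their images under P
    -- suffice to kill both mixed entries.
    obtain ⟨v, hv, hv0⟩ : ∃ v ∈ l, v ≠ 0 := by
      apply Submodule.exists_mem_ne_zero_of_ne_bot
      rintro rfl
      simp at hl
    have a0 := apply_two_eq_zero_of_rot_invariant hl hr hv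
    have a1 := apply_two_eq_zero_of_rot_invariant hl' hr' ⟨v, hv, rfl⟩
    have a2 := apply_two_eq_zero_of_rot_invariant hl' hr' ⟨_, hr v hv, rfl⟩
    rw [rot_mulVec] at a2
    simp [Matrix.mulVec, dotProduct, Fin.sum_univ_three, a0] at a1 a2
    rw [P.apply_comm 2 0, P.apply_comm 2 1] at a1 a2
    have hne : v 0 ^ 2 + v 1 ^ 2 ≠ 0 := by
      intro h0
      have b0 : v 0 = 0 := by nlinarith [sq_nonneg (v 0), sq_nonneg (v 1)]
      have b1 : v 1 = 0 := by nlinarith [sq_nonneg (v 0), sq_nonneg (v 1)]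
      apply hv0
      ext i
      fin_cases i
      · exact b0
      · exact b1
      · exact a0
    have a3 : P.1 0 2 * v 1 - P.1 1 2 * v 0 = 0 := by
      have : √3 / 2 * (P.1 0 2 * v 1 - P.1 1 2 * v 0) = 0 := by
        linear_combination a2 + 1 / 2 * a1
      exact (mul_eq_zero.1 this).resolve_left (by positivity)
    constructor
    · have : P.1 0 2 * (v 0 ^ 2 + v 1 ^ 2) = 0 := by linear_combination v 0 * a1 + v 1 * a3
      exact (mul_eq_zero.1 this).resolve_right hne
    · have : P.1 1 2 * (v 0 ^ 2 + v 1 ^ 2) = 0 := by linear_combination v 1 * a1 - v 0 * a3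
      exact (mul_eq_zero.1 this).resolve_right hne
  · rintro ⟨h02, h12⟩
    have hfix : ∀ (w : G) (T : SL3), (ρ.hom w : Equiv.Perm X) = act T →
        T ∈ Subgroup.centralizer {halfTurn} := by
      refine ρ.mem_of_hom_eq_act _ ?_ ?_ ?_
      · intro T hT
        rw [Subgroup.mem_centralizer_singleton_iff] at hT ⊢
        rw [← contra_halfTurn, ← map_mul, hT, map_mul]
      · rw [Subgroup.mem_centralizer_singleton_iff]
        exact spin_comm_rot _ _ _
      · rw [Subgroup.mem_centralizer_singleton_iff]
        apply Subtype.ext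
        rw [Matrix.SpecialLinearGroup.coe_mul, Matrix.SpecialLinearGroup.coe_mul, coe_halfTurn,
          X.coe_toSL]
        have h20 : P.1 2 0 = 0 := by rw [P.apply_comm, h02]
        have h21 : P.1 2 1 = 0 := by rw [P.apply_comm, h12]
        ext i j
        fin_cases i <;> fin_cases j <;>
          simp [Matrix.mul_apply, Fin.sum_univ_three, ← hP, h02, h12, h20, h21]
    have hent : ∀ T ∈ Subgroup.centralizer {halfTurn}, T.1 2 0 = 0 ∧ T.1 2 1 = 0 := by
      intro T hT
      rw [Subgroup.mem_centralizer_singleton_iff] at hT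
      have e := congrArg Subtype.val hT
      rw [Matrix.SpecialLinearGroup.coe_mul, Matrix.SpecialLinearGroup.coe_mul, coe_halfTurn] at e
      have f0 := congrFun (congrFun e 2) 0
      have f1 := congrFun (congrFun e 2) 1
      simp [Matrix.mul_apply, Fin.sum_univ_three] at f0 f1
      exact ⟨by linarith, by linarith⟩
    set l := LinearMap.ker (LinearMap.proj (R := ℝ) (φ := fun _ : Fin 3 => ℝ) 2) with hl
    have hmem : ∀ v, v ∈ l ↔ v 2 = 0 := fun v => Iff.rfl
    have hle : ∀ T ∈ Subgroup.centralizer {halfTurn}, ∀ v ∈ l, (T : Mat3).mulVec v ∈ l := by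
      intro T hT v hv
      rw [hmem] at hv ⊢
      simp [Matrix.mulVec, dotProduct, Fin.sum_univ_three, hv, (hent T hT).1, (hent T hT).2]
    refine ⟨l, ?_, fun w T hT => ?_⟩
    · have := LinearMap.finrank_range_add_finrank_ker
        (LinearMap.proj (R := ℝ) (φ := fun _ : Fin 3 => ℝ) 2)
      rw [LinearMap.range_eq_top.2 (LinearMap.proj_surjective 2), finrank_top,
        Module.finrank_self, Module.finrank_fin_fun] at this
      change Module.finrank ℝ (LinearMap.ker _) = 2
      omega
    · have hTm := hfix w T hT
      apply le_antisymm
      · rintro _ ⟨v, hv, rfl⟩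
        exact hle T hTm v hv
      · intro v hv
        refine ⟨((T⁻¹ : SL3) : Mat3).mulVec v, hle _ (inv_mem hTm) v hv, ?_⟩
        rw [Matrix.toLin'_apply, Matrix.mulVec_mulVec, ← Matrix.SpecialLinearGroup.coe_mul,
          mul_inv_cancel, Matrix.SpecialLinearGroup.coe_one, Matrix.one_mulVec]

theorem entry_normalForm (n u v : ℝ) :
    ((normalForm n u v).1 0 2 = 0 ∧ (normalForm n u v).1 1 2 = 0) ↔ n = 0 := by
  change n * √(gap u v) = 0 ∧ (0 : ℝ) = 0 ↔ _
  have := Real.sqrt_pos.2 (gap_pos u v)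
  simp [this.ne']

theorem spin_column_eq_zero {p r : ℝ} (h : p ^ 2 + r ^ 2 ≠ 0) (P : X) :
    ((act (spin p r h)⁻¹ P).1 0 2 = 0 ∧ (act (spin p r h)⁻¹ P).1 1 2 = 0) ↔
      P.1 0 2 = 0 ∧ P.1 1 2 = 0 := by
  obtain ⟨-, -, -, -, h5, h6⟩ := spin_entries p r h P
  change (act (spin p r h)⁻¹ P).arr 0 2 = 0 ∧ (act (spin p r h)⁻¹ P).arr 1 2 = 0 ↔ _
  rw [h5, h6, div_eq_zero_iff, div_eq_zero_iff, or_iff_left h, or_iff_left h]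
  constructor
  · rintro ⟨h1, h2⟩
    constructor
    · have : P.1 0 2 * (p ^ 2 + r ^ 2) = 0 := by linear_combination p * h1 - r * h2
      exact (mul_eq_zero.1 this).resolve_right h
    · have : P.1 1 2 * (p ^ 2 + r ^ 2) = 0 := by linear_combination r * h1 + p * h2
      exact (mul_eq_zero.1 this).resolve_right h
  · rintro ⟨h1, h2⟩
    rw [h1, h2]
    simp

/-! ### Conic-preserving representations -/

/-- As `rot` is orthogonal, invariance means commuting with it; symmetry then leaves only diag(a, a,
b). -/
theorem diag_of_rot_invariant {Q : Mat3} (hs : Q.IsSymm)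
    (h : (rot : Mat3).transpose * Q * (rot : Mat3) = Q) :
    Q 0 1 = 0 ∧ Q 1 0 = 0 ∧ Q 1 1 = Q 0 0 ∧ Q 1 2 = 0 ∧ Q 0 2 = 0 ∧ Q 2 1 = 0 ∧ Q 2 0 = 0 := by
  have hr : (rot : Mat3) * (rot : Mat3).transpose = 1 := by
    rw [← coe_rot_inv, ← Matrix.SpecialLinearGroup.coe_mul, mul_inv_cancel,
      Matrix.SpecialLinearGroup.coe_one]
  have hc : (rot : Mat3) * Q = Q * (rot : Mat3) := by
    conv_lhs => rw [← h]
    rw [← Matrix.mul_assoc, ← Matrix.mul_assoc, hr, one_mul]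
  obtain ⟨t01, t11, t12, t02, t21, t20⟩ := comm_rot_entries hc
  have hs10 : Q 1 0 = Q 0 1 := hs.apply 0 1
  have h10 : Q 1 0 = 0 := by linarith
  exact ⟨by linarith, h10, t11, t12, t02, t21, t20⟩

/-- Determinants give c³ = 1, so the scale factor of an invariant conic is 1. -/
theorem transpose_mul_mul_eq_of_smul {Q : Mat3} (hQ : Q.det ≠ 0) {T : SL3} {c : ℝ}
    (h : (T : Mat3).transpose * Q * (T : Mat3) = c • Q) :
    (T : Mat3).transpose * Q * (T : Mat3) = Q := by
  have hd := congrArg Matrix.det h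
  rw [Matrix.det_mul, Matrix.det_mul, Matrix.det_transpose, T.2, Matrix.det_smul, one_mul, mul_one,
    Fintype.card_fin] at hd
  have hc3 : c ^ 3 = 1 := mul_right_cancel₀ hQ (by rw [one_mul]; exact hd.symm)
  have hc : c = 1 := by
    have : (c - 1) * (c ^ 2 + c + 1) = 0 := by linear_combination hc3
    rcases mul_eq_zero.1 this with h | h
    · linarith
    · nlinarith [sq_nonneg (c + 1 / 2)]
  rw [h, hc, one_smul]

/-- The effect of `P Q' = Q P⁻¹` for `Q = diag(a, a, b)` and `Q' = diag(a', a', b')`. -/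
theorem inv_eq_zero_of_entries {P : X} (hmoved : act rot P ≠ P) {a b a' b' : ℝ} (ha : a ≠ 0)
    (hb : b ≠ 0) (hd : a' ^ 2 * b' = a ^ 2 * b)
    (f00 : P.1 0 0 * a' = a * (P.1 1 1 * P.1 2 2 - P.1 1 2 ^ 2))
    (f11 : P.1 1 1 * a' = a * (P.1 0 0 * P.1 2 2 - P.1 0 2 ^ 2))
    (f22 : P.1 2 2 * b' = b * (P.1 0 0 * P.1 1 1 - P.1 0 1 ^ 2))
    (f01 : P.1 0 1 * a' = a * (P.1 0 2 * P.1 1 2 - P.1 0 1 * P.1 2 2))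
    (f02 : P.1 0 2 * b' = a * (P.1 0 1 * P.1 1 2 - P.1 0 2 * P.1 1 1))
    (f12 : P.1 1 2 * b' = a * (P.1 0 2 * P.1 0 1 - P.1 0 0 * P.1 1 2)) :
    invU P.arr = 0 ∧ invV P.arr = 0 ∧ ¬(P.1 0 2 = 0 ∧ P.1 1 2 = 0) := by
  have hm : halfTr P.arr * a' = a * halfTrAdj P.arr := by
    rw [P.halfTrAdj_eq]
    simp only [halfTr, X.arr]
    linarith
  have hm0 := P.halfTr_pos
  have hm0' := P.halfTrAdj_pos
  have haa : 0 < a * a' := by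
    have : halfTr P.arr * (a * a') = a ^ 2 * halfTrAdj P.arr := by linear_combination a * hm
    have h0 : 0 < halfTr P.arr * (a * a') := by rw [this]; positivity
    exact pos_of_mul_pos_right h0 hm0.le
  have hP22 := P.diag_pos 2
  -- By `f02` and `f12`, the mixed columns of P and of P⁻¹ are parallel, which makes det(b, Sb)
  -- vanish.
  have hcub : cubic P.arr = 0 := by
    have : a * ((P.1 0 1 * P.1 1 2 - P.1 0 2 * P.1 1 1) * P.1 1 2 -
        (P.1 0 2 * P.1 0 1 - P.1 0 0 * P.1 1 2) * P.1 0 2) = 0 := by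
      linear_combination P.1 0 2 * f12 - P.1 1 2 * f02
    have h0 := (mul_eq_zero.1 this).resolve_left ha
    simp only [cubic, X.arr]
    linear_combination -h0
  have hsq : halfTrAdj P.arr ^ 2 * blockDet P.arr = halfTr P.arr ^ 2 * P.1 2 2 := by
    rw [← P.blockDet_eq] at f22
    have hne : a ^ 2 * b ≠ 0 := mul_ne_zero (pow_ne_zero 2 ha) hb
    apply mul_left_cancel₀ hne
    calc a ^ 2 * b * (halfTrAdj P.arr ^ 2 * blockDet P.arr) =
        (a * halfTrAdj P.arr) ^ 2 * (b * blockDet P.arr) := by ring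
      _ = (halfTr P.arr * a') ^ 2 * (P.1 2 2 * b') := by rw [← hm, ← f22]
      _ = (a' ^ 2 * b') * (halfTr P.arr ^ 2 * P.1 2 2) := by ring
      _ = _ := by rw [hd]
  refine ⟨?_, by rw [invV, hcub, neg_zero], ?_⟩
  · have hC := P.geomMean_pos
    have hs := P.scaleFactor_pos
    have hs2 : scaleFactor P.arr ^ 2 = P.1 2 2 / geomMean P.arr :=
      Real.sq_sqrt (div_pos hP22 hC).le
    have hC2 : geomMean P.arr ^ 2 = P.1 2 2 * blockDet P.arr :=
      Real.sq_sqrt (mul_pos hP22 P.blockDet_pos).le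
    -- After multiplication by `geomMean + 1` this is the vanishing of `invU`; both sides are
    -- positive, so their squares may be compared.
    have key : halfTrAdj P.arr * geomMean P.arr = halfTr P.arr * P.1 2 2 := by
      refine (pow_left_inj₀ (by positivity) (by positivity) two_ne_zero).1 ?_
      rw [mul_pow, mul_pow, hC2]
      linear_combination P.1 2 2 * hsq
    rw [invU]
    have : halfTrAdj P.arr / scaleFactor P.arr = halfTr P.arr * scaleFactor P.arr := by
      rw [div_eq_iff hs.ne', mul_assoc, ← pow_two, hs2, mul_div_assoc', eq_div_iff hC.ne', key]
    rw [this]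
    ring
  · rintro ⟨p02, p12⟩
    apply hmoved
    rw [act_rot_eq_iff]
    have hpos : 0 < a * a' + a ^ 2 * P.1 2 2 := by positivity
    refine ⟨p02, p12, ?_, ?_⟩
    · rw [p02, p12] at f01
      have : P.1 0 1 * (a * a' + a ^ 2 * P.1 2 2) = 0 := by linear_combination a * f01
      exact (mul_eq_zero.1 this).resolve_right hpos.ne'
    · rw [p12] at f00
      rw [p02] at f11
      have : (P.1 0 0 - P.1 1 1) * (a * a' + a ^ 2 * P.1 2 2) = 0 := by
        linear_combination a * f00 - a * f11
      exact sub_eq_zero.1 ((mul_eq_zero.1 this).resolve_right hpos.ne')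

/-- The form Q is invariant under `rot` and P⁻¹ `rot` P, so both Q and Q' = P⁻¹QP⁻¹ are of type
diag(a, a, b). The entries of PQ' = QP⁻¹ give the equations of `inv_eq_zero_of_entries`. -/
theorem ConicPreserving.inv_eq_zero {ρ : NormRep} (h : ConicPreserving ρ) :
    invU ρ.fix.arr = 0 ∧ invV ρ.fix.arr = 0 ∧ ¬(ρ.fix.1 0 2 = 0 ∧ ρ.fix.1 1 2 = 0) := by
  obtain ⟨Q, hsymm, hdet, -, hT⟩ := h
  have hmoved := ρ.rot_fix_ne
  have hconj := ρ.hom_conj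
  set P := ρ.fix with hP
  obtain ⟨c, -, h1⟩ := hT _ _ ρ.rotation
  have h1 := transpose_mul_mul_eq_of_smul hdet h1
  obtain ⟨c', -, h2⟩ := hT _ _ hconj
  have h2 := transpose_mul_mul_eq_of_smul hdet h2
  obtain ⟨q01, q10, q11, q12, q02, q21, q20⟩ := diag_of_rot_invariant hsymm h1
  set I : Mat3 := (polarity P).1 with hI
  have hIP : I * P.1 = 1 := Matrix.nonsing_inv_mul _ (by rw [P.2.2]; exact isUnit_one)
  have hPI : P.1 * I = 1 := mul_eq_one_comm.1 hIP
  have hIt : I.transpose = I := (polarity P).transpose_eq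
  set Q' : Mat3 := I * Q * I with hQ'
  have hcoe : ((P.toSL⁻¹ : SL3) : Mat3) = I := SL3.coe_inv _
  rw [Matrix.SpecialLinearGroup.coe_mul, Matrix.SpecialLinearGroup.coe_mul, hcoe, X.coe_toSL,
    Matrix.transpose_mul, Matrix.transpose_mul, hIt, P.transpose_eq] at h2
  have h3 : (rot : Mat3).transpose * Q' * (rot : Mat3) = Q' := by
    have := congrArg (fun M => I * M * I) h2
    calc _ = I * P.1 * ((rot : Mat3).transpose * (I * Q * I) * (rot : Mat3)) * (P.1 * I) := by
          rw [hIP, hPI, one_mul, mul_one]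
      _ = I * (P.1 * ((rot : Mat3).transpose * I) * Q * (I * (rot : Mat3) * P.1)) * I := by
          simp only [Matrix.mul_assoc]
      _ = _ := this
  have hsymm' : Q'.IsSymm := by
    rw [Matrix.IsSymm, hQ', Matrix.transpose_mul, Matrix.transpose_mul, hIt, hsymm.eq,
      Matrix.mul_assoc]
  obtain ⟨r01, r10, r11, r12, r02, r21, r20⟩ := diag_of_rot_invariant hsymm' h3
  have hPQ : P.1 * Q' = Q * I := by
    rw [hQ', ← Matrix.mul_assoc, ← Matrix.mul_assoc, hPI, one_mul]
  have f := fun i j => congrFun (congrFun hPQ i) j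
  have f00 := f 0 0
  have f01 := f 0 1
  have f02 := f 0 2
  have f11 := f 1 1
  have f12 := f 1 2
  have f22 := f 2 2
  simp [Matrix.mul_apply, Fin.sum_univ_three, q01, q10, q11, q12, q02, q21, q20, r01, r10, r11,
    r12, r02, r21, r20] at f00 f01 f02 f11 f12 f22
  have hd : Q'.det = Q.det := by
    have e : I.det = 1 := (polarity P).2.2
    rw [hQ', Matrix.det_mul, Matrix.det_mul, e, one_mul, mul_one]
  rw [Matrix.det_fin_three, Matrix.det_fin_three, q01, q10, q11, q12, q02, q21, q20, r01, r10, r11,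
    r12, r02, r21, r20] at hd
  rw [Matrix.det_fin_three, q01, q10, q11, q12, q02, q21, q20] at hdet
  obtain ⟨e00, e11, e22, e01, e02, e12⟩ := polarity_entries P
  change I 0 0 = _ at e00
  change I 1 1 = _ at e11
  change I 2 2 = _ at e22
  change I 0 1 = _ at e01
  change I 0 2 = _ at e02
  change I 1 2 = _ at e12
  have ha : Q 0 0 ≠ 0 := by rintro h; apply hdet; rw [h]; ring
  have hb : Q 2 2 ≠ 0 := by rintro h; apply hdet; rw [h]; ring
  rw [e00] at f00
  rw [e11] at f11
  rw [e22] at f22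
  rw [e01] at f01
  rw [e02] at f02
  rw [e12] at f12
  exact inv_eq_zero_of_entries hmoved ha hb (by linear_combination hd) f00 f11 f22 f01 f02 f12

theorem conicPreserving_of_fix_eq {ρ : NormRep} {n : ℝ} (h : ρ.fix = normalForm n 0 0) :
    ConicPreserving ρ := by
  -- With J = diag(-1, -1, 1), this subgroup, given by contra T = JTJ, is the isometry group of the
  -- form J. For u = v = 0 the inverse of P is JPJ, so P belongs to it.
  set H : Subgroup SL3 := contra.eqLocus (MulAut.conj halfTurn).toMonoidHom with hH
  have hmem : ∀ T, T ∈ H ↔ contra T = halfTurn * T * halfTurn := by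
    intro T
    change contra T = halfTurn * T * halfTurn⁻¹ ↔ _
    rw [halfTurn_inv]
  have key : ∀ (w : G) (T : SL3), (ρ.hom w : Equiv.Perm X) = act T → T ∈ H := by
    refine ρ.mem_of_hom_eq_act _ ?_ ?_ ?_
    · intro T hT
      rw [hmem] at hT ⊢
      conv_lhs => rw [hT, map_mul, map_mul, contra_halfTurn]
    · rw [hmem, contra_rot, mul_assoc]
      rw [show rot * halfTurn = halfTurn * rot from spin_comm_rot _ _ _, ← mul_assoc,
        halfTurn_mul_self, one_mul]
    · rw [hmem]
      rw [contra_toSL, inv_eq_iff_mul_eq_one]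
      apply Subtype.ext
      rw [Matrix.SpecialLinearGroup.coe_mul, Matrix.SpecialLinearGroup.coe_mul,
        Matrix.SpecialLinearGroup.coe_mul, coe_halfTurn, X.coe_toSL, h]
      have hC2 : √(1 + n ^ 2) * √(1 + n ^ 2) = 1 + n ^ 2 := Real.mul_self_sqrt (by positivity)
      have e : (normalForm n 0 0).1 = !![√(1 + n ^ 2), 0, n; 0, 1, 0; n, 0, √(1 + n ^ 2)] := by
        change Matrix.of (normalArr n 0 0) = _
        ext i j
        fin_cases i <;> fin_cases j <;> simp [normalArr, gap]
      rw [e]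
      ext i j
      fin_cases i <;> fin_cases j <;>
        simp [Matrix.mul_apply, Fin.sum_univ_three] <;> linarith
  refine ⟨(halfTurn : Mat3), ?_, ?_, ⟨![1, 0, 1], ?_, ?_⟩, ?_⟩
  · rw [coe_halfTurn]
    ext i j
    fin_cases i <;> fin_cases j <;> rfl
  · rw [halfTurn.2]; exact one_ne_zero
  · intro h
    simpa using congrFun h 0
  · rw [coe_halfTurn]
    simp [Matrix.mulVec, dotProduct, Fin.sum_univ_three]
  · intro w T hT
    refine ⟨1, one_ne_zero, ?_⟩
    have h1 := (hmem _).1 (inv_mem (key w T hT))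
    have h2 : contra T⁻¹ * halfTurn * T = halfTurn := by
      rw [h1, mul_assoc _ halfTurn halfTurn, halfTurn_mul_self, mul_one, inv_mul_cancel_right]
    have h3 := congrArg Subtype.val h2
    rw [Matrix.SpecialLinearGroup.coe_mul, Matrix.SpecialLinearGroup.coe_mul, coe_contra,
      inv_inv] at h3
    rw [h3, one_smul]

/-! ### The curves in terms of the invariants -/

theorem invMap_eq_of_repClass_eq {ρ ρ' : NormRep} (h : repClass ρ = repClass ρ') :
    invMap ρ.fix.arr = invMap ρ'.fix.arr := by
  obtain ⟨g, hg, e⟩ := (repClass_eq_iff ρ ρ').1 h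
  rw [e, invMap_apply_of_mem hg]

theorem repClass_eq_of_invMap_eq {ρ ρ' : NormRep} (h : invMap ρ.fix.arr = invMap ρ'.fix.arr) :
    repClass ρ = repClass ρ' :=
  (repClass_eq_iff ρ ρ').2 (exists_mem_commRot_of_invMap_eq h)

/-- The invariants of a class. -/
def RepSpace.inv : RepSpace → EuclideanSpace ℝ (Fin 3) :=
  Quotient.lift (fun ρ => invMap ρ.fix.arr)
    (fun ρ ρ' h => invMap_eq_of_repClass_eq (Quotient.sound h : repClass ρ = repClass ρ'))

@[simp] theorem inv_repClass (ρ : NormRep) : (repClass ρ).inv = invMap ρ.fix.arr := rfl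

theorem inv_cls (P : Moved) : P.cls.inv = invMap P.1.arr := by
  rw [Moved.cls, inv_repClass, Moved.fix_rep]

theorem RepSpace.inv_injective : Function.Injective RepSpace.inv := by
  intro x y h
  induction x using Quotient.inductionOn with
  | _ ρ =>
    induction y using Quotient.inductionOn with
    | _ ρ' => exact repClass_eq_of_invMap_eq h

theorem RepSpace.inv_ne_zero (x : RepSpace) : x.inv ≠ 0 := by
  induction x using Quotient.inductionOn with
  | _ ρ =>
    intro h
    exact ρ.rot_fix_ne ((invMap_eq_zero_iff _).1 h)

theorem act_rot_normalForm_ne {n u v : ℝ} (h : invMap (normalArr n u v) ≠ 0) :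
    act rot (normalForm n u v) ≠ normalForm n u v := by
  rwa [← arr_normalForm, Ne, invMap_eq_zero_iff] at h

theorem exists_repClass_normalForm (x : RepSpace) :
    ∃ ρ n u v, repClass ρ = x ∧ 0 ≤ n ∧ ρ.fix = normalForm n u v ∧
      x.inv = invMap (normalArr n u v) := by
  obtain ⟨n, u, v, hn, e⟩ := exists_normalArr_invMap_eq x.inv
  have hm := act_rot_normalForm_ne (e ▸ x.inv_ne_zero)
  refine ⟨Moved.rep ⟨_, hm⟩, n, u, v, ?_, hn, Moved.fix_rep _, e.symm⟩
  apply RepSpace.inv_injective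
  rw [inv_repClass, Moved.fix_rep, ← e, arr_normalForm]

theorem mem_lineCurve_iff (x : RepSpace) :
    x ∈ lineCurve ↔ ∃ t : ℝ, 0 < t ∧ x.inv = !₂[0, 0, t] := by
  constructor
  · rintro ⟨ρ, rfl, h⟩
    rw [linePreserving_iff] at h
    obtain ⟨p, r, hpr, n, u, v, hn, e⟩ := exists_normalForm ρ.fix
    rw [← spin_column_eq_zero hpr, e, entry_normalForm] at h
    subst h
    have hinv : (repClass ρ).inv = invMap (normalArr 0 u v) := by
      rw [inv_repClass, ← invMap_spin p r hpr, e, arr_normalForm]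
    have hne := (repClass ρ).inv_ne_zero
    rw [hinv, Ne, invMap_normalArr_eq_zero_iff] at hne
    refine ⟨u ^ 2 + v ^ 2, ?_, ?_⟩
    · by_contra hcon
      exact hne ⟨rfl, by nlinarith [sq_nonneg u, sq_nonneg v],
        by nlinarith [sq_nonneg u, sq_nonneg v]⟩
    · rw [hinv, invMap_normalArr]
      simp
  · rintro ⟨t, ht, e⟩
    obtain ⟨ρ, n, u, v, rfl, hn, hfix, hinv⟩ := exists_repClass_normalForm x
    refine ⟨ρ, rfl, ?_⟩
    rw [linePreserving_iff, hfix, entry_normalForm]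
    obtain ⟨h1, h2⟩ := invMap_normalArr_sq n u v
    rw [← hinv, e] at h1 h2
    simp at h1 h2
    rcases h1 with h | h
    · exact h
    · rw [h] at h2
      nlinarith [sq_nonneg (n ^ 2)]

theorem mem_conicCurve_iff (x : RepSpace) :
    x ∈ conicCurve ↔ ∃ t : ℝ, 0 < t ∧ x.inv = !₂[0, 0, -t] := by
  constructor
  · rintro ⟨ρ, rfl, h⟩
    obtain ⟨hU, hV, hb⟩ := h.inv_eq_zero
    obtain ⟨p, r, hpr, n, u, v, hn, e⟩ := exists_normalForm ρ.fix
    rw [← spin_column_eq_zero hpr, e, entry_normalForm] at hb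
    have hinv : (repClass ρ).inv = invMap (normalArr n u v) := by
      rw [inv_repClass, ← invMap_spin p r hpr, e, arr_normalForm]
    rw [← invU_spin p r hpr, e, arr_normalForm, invU_normalArr] at hU
    rw [← invV_spin p r hpr, e, arr_normalForm, invV_normalArr] at hV
    have hu : u = 0 := (mul_eq_zero.1 hU).resolve_left (pow_ne_zero 2 hb)
    have hv : v = 0 := (mul_eq_zero.1 hV).resolve_left (pow_ne_zero 2 hb)
    refine ⟨n ^ 4, by positivity, ?_⟩
    rw [hinv, invMap_normalArr, hu, hv]
    simp
  · rintro ⟨t, ht, e⟩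
    obtain ⟨ρ, n, u, v, rfl, hn, hfix, hinv⟩ := exists_repClass_normalForm x
    refine ⟨ρ, rfl, ?_⟩
    obtain ⟨h1, h2⟩ := invMap_normalArr_sq n u v
    rw [← hinv, e] at h1 h2
    simp at h1 h2
    have huv : u ^ 2 + v ^ 2 = 0 := by
      rcases h1 with h | h
      · rw [h] at h2
        nlinarith [sq_nonneg u, sq_nonneg v]
      · exact h
    have hu : u = 0 := by nlinarith [sq_nonneg u, sq_nonneg v]
    have hv : v = 0 := by nlinarith [sq_nonneg u, sq_nonneg v]
    rw [hu, hv] at hfix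
    exact conicPreserving_of_fix_eq hfix

/-- The two curves fill the vertical axis, as the origin is not a value. -/
theorem notMem_curves_iff (x : RepSpace) :
    x ∉ lineCurve ∪ conicCurve ↔ ¬(x.inv 0 = 0 ∧ x.inv 1 = 0) := by
  rw [not_iff_not, Set.mem_union, mem_lineCurve_iff, mem_conicCurve_iff]
  constructor
  · rintro (⟨t, -, e⟩ | ⟨t, -, e⟩) <;> rw [e] <;> exact ⟨rfl, rfl⟩
  · rintro ⟨h0, h1⟩
    have h2 : x.inv 2 ≠ 0 := by
      intro h2
      apply x.inv_ne_zero
      ext i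
      fin_cases i
      · exact h0
      · exact h1
      · exact h2
    rcases lt_or_gt_of_ne h2 with h | h
    · right
      refine ⟨-x.inv 2, by linarith, ?_⟩
      ext i
      fin_cases i
      · exact h0
      · exact h1
      · simp
    · left
      refine ⟨x.inv 2, h, ?_⟩
      ext i
      fin_cases i
      · exact h0
      · exact h1
      · rfl


/-! ### The distance of `X` -/

theorem roots_charpoly_conj_diagonal (U : unitary Mat3) (d : Fin 3 → ℝ) :
    ((Unitary.conjStarAlgAut ℝ Mat3 U) (Matrix.diagonal d)).charpoly.roots =
      Finset.univ.val.map d := by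
  have h : ((Unitary.conjStarAlgAut ℝ Mat3 U) (Matrix.diagonal d)).charpoly =
      (Matrix.diagonal d).charpoly := by
    rw [Unitary.conjStarAlgAut_apply, Matrix.charpoly_mul_comm, ← mul_assoc]
    simp
  rw [h, Matrix.charpoly_diagonal]
  exact Polynomial.roots_multiset_prod_X_sub_C (Finset.univ.val.map d) |> fun h => by
    simpa [Finset.prod, Multiset.map_map, Function.comp_def] using h

theorem exists_eigenvalues (Q : X) : ∃ (U : unitary Mat3) (d : Fin 3 → ℝ), (∀ i, 0 < d i) ∧
    Q.1 = (Unitary.conjStarAlgAut ℝ Mat3 U) (Matrix.diagonal d) := by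
  have h := Q.2.1.isHermitian
  exact ⟨h.eigenvectorUnitary, h.eigenvalues, Q.2.1.eigenvalues_pos, h.spectral_theorem⟩

theorem symDist_base {Q : X} {U : unitary Mat3} {d : Fin 3 → ℝ}
    (h : Q.1 = (Unitary.conjStarAlgAut ℝ Mat3 U) (Matrix.diagonal d)) :
    symDist X.base Q = √(∑ i, (Real.log (d i) / 2) ^ 2) := by
  have : X.base.1⁻¹ * Q.1 = Q.1 := by simp [X.base]
  rw [symDist, this, h, roots_charpoly_conj_diagonal, Multiset.map_map]
  rfl

theorem polarity_base : polarity X.base = X.base := Subtype.ext (inv_one (G := Mat3))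

/-- Inversion negates the logarithms of the eigenvalues. -/
theorem symDist_base_polarity (Q : X) : symDist X.base (polarity Q) = symDist X.base Q := by
  obtain ⟨U, d, hd, h⟩ := exists_eigenvalues Q
  have h' : (polarity Q).1 = (Unitary.conjStarAlgAut ℝ Mat3 U) (Matrix.diagonal fun i => (d i)⁻¹) := by
    rw [polarity_apply_coe]
    apply Matrix.inv_eq_left_inv
    rw [h, ← map_mul, Matrix.diagonal_mul_diagonal]
    have : (fun i => (d i)⁻¹ * d i) = fun _ => 1 := by
      funext i; exact inv_mul_cancel₀ (hd i).ne'
    rw [this, Matrix.diagonal_one, map_one]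
  rw [symDist_base h, symDist_base h']
  congr 1
  refine Finset.sum_congr rfl fun i _ => ?_
  rw [Real.log_inv]
  ring

theorem symDist_polarity (P Q : X) : symDist (polarity P) (polarity Q) = symDist P Q := by
  obtain ⟨T, rfl⟩ := X.exists_act_base P
  obtain ⟨R, rfl⟩ : ∃ R, Q = act T R := ⟨(act T)⁻¹ Q, by
    rw [← Equiv.Perm.mul_apply, mul_inv_cancel, Equiv.Perm.one_apply]⟩
  rw [← Equiv.Perm.mul_apply, ← Equiv.Perm.mul_apply, polarity_mul_act, Equiv.Perm.mul_apply,
    Equiv.Perm.mul_apply, symDist_act, symDist_act, polarity_base, symDist_base_polarity]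

theorem symDist_apply {g : Equiv.Perm X} (hg : g ∈ IsomX) (P Q : X) :
    symDist (g P) (g Q) = symDist P Q := by
  obtain ⟨T, rfl | rfl⟩ := (mem_IsomX_iff g).1 hg
  · exact symDist_act T P Q
  · rw [Equiv.Perm.mul_apply, Equiv.Perm.mul_apply, symDist_act, symDist_polarity]

/-- The Frobenius norm of Q - 1 is invariant under orthogonal conjugation. It translates between
closeness of entries and closeness of eigenvalues to 1. -/
theorem sum_sq_eq {Q : X} {U : unitary Mat3} {d : Fin 3 → ℝ}
    (h : Q.1 = (Unitary.conjStarAlgAut ℝ Mat3 U) (Matrix.diagonal d)) :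
    ∑ i, ∑ j, (Q.arr i j - X.base.arr i j) ^ 2 = ∑ i, (d i - 1) ^ 2 := by
  have h1 : Q.1 - 1 = (Unitary.conjStarAlgAut ℝ Mat3 U) (Matrix.diagonal fun i => d i - 1) := by
    have : (Matrix.diagonal fun i => d i - 1) = Matrix.diagonal d - (1 : Mat3) := by
      rw [← Matrix.diagonal_one, Matrix.diagonal_sub]
    rw [this, map_sub, map_one, h]
  have h2 : Matrix.trace ((Q.1 - 1) * (Q.1 - 1)) = ∑ i, (d i - 1) ^ 2 := by
    rw [h1, ← map_mul, Matrix.diagonal_mul_diagonal, Unitary.conjStarAlgAut_apply,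
      Matrix.trace_mul_comm, ← mul_assoc]
    simp [Matrix.trace_diagonal, pow_two]
  rw [← h2, Matrix.trace]
  refine Finset.sum_congr rfl fun i _ => ?_
  rw [Matrix.diag_apply, Matrix.mul_apply]
  refine Finset.sum_congr rfl fun j _ => ?_
  have h3 : (Q.1 - 1) j i = (Q.1 - 1) i j := by
    rw [Matrix.sub_apply, Matrix.sub_apply, Q.apply_comm j i]
    congr 1
    exact X.base.apply_comm j i
  rw [h3, pow_two]
  rfl

theorem isInducing_arr : Topology.IsInducing X.arr := Topology.IsInducing.subtypeVal

theorem continuous_arr : Continuous X.arr := isInducing_arr.continuous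

theorem eventually_symDist_base_lt {ε : ℝ} (hε : 0 < ε) :
    ∀ᶠ Q in 𝓝 X.base, symDist X.base Q < ε := by
  have hlog := (Real.continuousAt_log one_ne_zero).tendsto
  rw [Real.log_one, Metric.tendsto_nhds_nhds] at hlog
  obtain ⟨δ, hδ, h⟩ := hlog ε hε
  rw [isInducing_arr.nhds_eq_comap, Filter.eventually_comap]
  -- Nine entries, each off by less than δ/3, keep the sum of squares below δ².
  filter_upwards [Metric.ball_mem_nhds X.base.arr (show 0 < δ / 3 by positivity)]
  rintro _ hQ Q rfl
  obtain ⟨U, d, hd, e⟩ := exists_eigenvalues Q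
  have hent : ∀ i j, (Q.arr i j - X.base.arr i j) ^ 2 < δ ^ 2 / 9 := by
    intro i j
    have h1 : dist Q.arr X.base.arr < δ / 3 := Metric.mem_ball.1 hQ
    have h2 := (dist_le_pi_dist Q.arr X.base.arr i).trans_lt h1
    have h3 := (dist_le_pi_dist (Q.arr i) (X.base.arr i) j).trans_lt h2
    rw [Real.dist_eq] at h3
    have := sq_lt_sq' (by linarith [abs_nonneg (Q.arr i j - X.base.arr i j)]) h3
    rw [sq_abs] at this
    linarith [this, show (δ / 3) ^ 2 = δ ^ 2 / 9 by ring]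
  have hsum := sum_sq_eq e
  have hlt : ∑ i, (d i - 1) ^ 2 < δ ^ 2 := by
    rw [← hsum]
    simp only [Fin.sum_univ_three]
    linarith [hent 0 0, hent 0 1, hent 0 2, hent 1 0, hent 1 1, hent 1 2, hent 2 0, hent 2 1,
      hent 2 2]
  have hlogs : ∀ i, (Real.log (d i) / 2) ^ 2 < ε ^ 2 / 4 := by
    intro i
    have h1 : (d i - 1) ^ 2 < δ ^ 2 :=
      (Finset.single_le_sum (f := fun i => (d i - 1) ^ 2) (fun _ _ => sq_nonneg _)
        (Finset.mem_univ i)).trans_lt hlt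
    have h2 : |d i - 1| < δ := abs_lt_of_sq_lt_sq h1 hδ.le
    have h3 := h (x := d i) (by rwa [Real.dist_eq])
    rw [Real.dist_eq, sub_zero] at h3
    have := sq_lt_sq' (by linarith [abs_nonneg (Real.log (d i))]) h3
    rw [sq_abs] at this
    linarith [this, show (Real.log (d i) / 2) ^ 2 = Real.log (d i) ^ 2 / 4 by ring]
  rw [symDist_base e, Real.sqrt_lt' hε]
  simp only [Fin.sum_univ_three]
  nlinarith [hlogs 0, hlogs 1, hlogs 2]

theorem exists_symDist_base_subset {V : Set X} (hV : V ∈ 𝓝 X.base) :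
    ∃ δ > 0, ∀ Q, symDist X.base Q < δ → Q ∈ V := by
  rw [isInducing_arr.nhds_eq_comap, Filter.mem_comap] at hV
  obtain ⟨W, hW, hWV⟩ := hV
  obtain ⟨ε, hε, hb⟩ := Metric.mem_nhds_iff.1 hW
  have hexp := Real.continuous_exp.continuousAt.tendsto (x := 0)
  rw [Real.exp_zero, Metric.tendsto_nhds_nhds] at hexp
  obtain ⟨δ, hδ, h⟩ := hexp (ε / 2) (by positivity)
  refine ⟨δ / 2, by positivity, fun Q hQ => hWV (hb ?_)⟩
  obtain ⟨U, d, hd, e⟩ := exists_eigenvalues Q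
  rw [symDist_base e, Real.sqrt_lt' (by positivity)] at hQ
  have hdd : ∀ i, (d i - 1) ^ 2 < ε ^ 2 / 4 := by
    intro i
    have h1 : (Real.log (d i) / 2) ^ 2 < (δ / 2) ^ 2 :=
      (Finset.single_le_sum (f := fun i => (Real.log (d i) / 2) ^ 2) (fun _ _ => sq_nonneg _)
        (Finset.mem_univ i)).trans_lt hQ
    have h2 : |Real.log (d i)| < δ := by
      refine abs_lt_of_sq_lt_sq ?_ hδ.le
      linarith [h1, show (Real.log (d i) / 2) ^ 2 = Real.log (d i) ^ 2 / 4 by ring,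
        show (δ / 2) ^ 2 = δ ^ 2 / 4 by ring]
    have h3 := h (x := Real.log (d i)) (by rwa [Real.dist_eq, sub_zero])
    rw [Real.dist_eq, Real.exp_log (hd i)] at h3
    have := sq_lt_sq' (by linarith [abs_nonneg (d i - 1)]) h3
    rw [sq_abs] at this
    linarith [this, show (ε / 2) ^ 2 = ε ^ 2 / 4 by ring]
  have hsum := sum_sq_eq e
  have hlt : ∑ i, ∑ j, (Q.arr i j - X.base.arr i j) ^ 2 < ε ^ 2 := by
    rw [hsum]
    simp only [Fin.sum_univ_three]
    nlinarith [hdd 0, hdd 1, hdd 2]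
  rw [Metric.mem_ball, dist_pi_lt_iff hε]
  intro i
  rw [dist_pi_lt_iff hε]
  intro j
  rw [Real.dist_eq]
  refine abs_lt_of_sq_lt_sq ?_ hε.le
  refine lt_of_le_of_lt ?_ hlt
  exact (Finset.single_le_sum (f := fun j => (Q.arr i j - X.base.arr i j) ^ 2)
    (fun _ _ => sq_nonneg _) (Finset.mem_univ j)).trans
    (Finset.single_le_sum (f := fun i => ∑ j, (Q.arr i j - X.base.arr i j) ^ 2)
    (fun _ _ => Finset.sum_nonneg fun _ _ => sq_nonneg _) (Finset.mem_univ i))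

theorem continuous_act (T : SL3) : Continuous (act T) := by
  refine Continuous.subtype_mk ?_ _
  exact ((continuous_const.matrix_mul continuous_subtype_val).matrix_mul continuous_const)

theorem act_inv_act (T : SL3) (Q : X) : act T⁻¹ (act T Q) = Q := by
  rw [← Equiv.Perm.mul_apply, ← map_mul, inv_mul_cancel, map_one, Equiv.Perm.one_apply]

theorem act_act_inv (T : SL3) (Q : X) : act T (act T⁻¹ Q) = Q := by
  rw [← Equiv.Perm.mul_apply, ← map_mul, mul_inv_cancel, map_one, Equiv.Perm.one_apply]

theorem eventually_symDist_lt (P : X) {ε : ℝ} (hε : 0 < ε) : ∀ᶠ Q in 𝓝 P, symDist P Q < ε := by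
  obtain ⟨T, rfl⟩ := X.exists_act_base P
  have ht : Filter.Tendsto (act T⁻¹) (𝓝 (act T X.base)) (𝓝 X.base) := by
    have := (continuous_act T⁻¹).tendsto (act T X.base)
    rwa [act_inv_act] at this
  filter_upwards [ht.eventually (eventually_symDist_base_lt hε)] with Q hQ
  have k := symDist_act T X.base (act T⁻¹ Q)
  rw [act_act_inv] at k
  rwa [k]

theorem exists_symDist_subset {P : X} {V : Set X} (hV : V ∈ 𝓝 P) :
    ∃ δ > 0, ∀ Q, symDist P Q < δ → Q ∈ V := by
  obtain ⟨T, rfl⟩ := X.exists_act_base P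
  have ht := (continuous_act T).tendsto X.base
  obtain ⟨δ, hδ, h⟩ := exists_symDist_base_subset (ht hV)
  refine ⟨δ, hδ, fun Q hQ => ?_⟩
  have k := symDist_act T X.base (act T⁻¹ Q)
  rw [act_act_inv] at k
  rw [k] at hQ
  have := Set.mem_preimage.1 (h _ hQ)
  rwa [act_act_inv] at this

/-! ### The topology of the space of classes -/

theorem symDist_nonneg (P Q : X) : 0 ≤ symDist P Q := Real.sqrt_nonneg _

/-- Elements of the centralizer act by isometries, so the first representative can be fixed and
`repDist` is the distance from a point to an orbit. -/
theorem repDist_lt_iff (P : Moved) (y : RepSpace) (ε : ℝ) :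
    repDist P.cls y < ε ↔ ∃ Q : Moved, Q.cls = y ∧ symDist P.1 Q.1 < ε := by
  rw [repDist]
  have hmem : ∀ Q : Moved, Q.cls = y → symDist P.1 Q.1 ∈ {D : ℝ | ∃ ρ₁ ρ₂ : NormRep,
      repClass ρ₁ = P.cls ∧ repClass ρ₂ = y ∧ ∃ p q : X, (ρ₁.hom σ₂ : Equiv.Perm X) p = p ∧
        (ρ₂.hom σ₂ : Equiv.Perm X) q = q ∧ D = symDist p q} := by
    intro Q hQ
    exact ⟨P.rep, Q.rep, rfl, hQ, P.1, Q.1,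
      ((P.rep.hom_two_apply_eq_iff _).2 P.fix_rep.symm),
      ((Q.rep.hom_two_apply_eq_iff _).2 Q.fix_rep.symm), rfl⟩
  rw [csInf_lt_iff]
  · constructor
    · rintro ⟨_, ⟨ρ₁, ρ₂, h1, rfl, p, q, hp, hq, rfl⟩, hlt⟩
      rw [NormRep.hom_two_apply_eq_iff] at hp hq
      subst hp hq
      rw [Moved.cls, repClass_eq_iff, Moved.fix_rep] at h1
      obtain ⟨g, hg, e⟩ := h1
      refine ⟨ρ₂.moved.translate g hg, ?_, ?_⟩
      · rw [Moved.cls_translate, NormRep.cls_moved]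
      · rw [e]
        change symDist (g ρ₁.fix) (g ρ₂.fix) < ε
        rwa [symDist_apply hg.1]
    · rintro ⟨Q, hQ, hlt⟩
      exact ⟨_, hmem Q hQ, hlt⟩
  · refine ⟨0, ?_⟩
    rintro _ ⟨_, _, _, _, _, _, _, _, rfl⟩
    exact symDist_nonneg _ _
  · obtain ⟨Q, hQ⟩ := Moved.cls_surjective y
    exact ⟨_, hmem Q hQ⟩

theorem isOpen_repSpace_iff (U : Set RepSpace) :
    IsOpen U ↔ ∀ x ∈ U, ∃ ε > 0, ∀ y, repDist x y < ε → y ∈ U := Iff.rfl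

/-- The balls of `symDist` form neighbourhood bases for the topology of X, so the topology of
`repDist` is the quotient topology. -/
theorem isQuotientMap_cls : Topology.IsQuotientMap Moved.cls := by
  refine ⟨.of_isOpen_preimage_iff_isOpen fun U => ?_, Moved.cls_surjective⟩
  rw [isOpen_repSpace_iff, iff_comm]
  constructor
  · intro h
    rw [isOpen_iff_mem_nhds]
    intro P hP
    obtain ⟨ε, hε, hU⟩ := h _ hP
    rw [nhds_subtype_eq_comap]
    filter_upwards [Filter.preimage_mem_comap (eventually_symDist_lt P.1 hε)] with Q hQ
    exact hU _ ((repDist_lt_iff P _ ε).2 ⟨Q, rfl, hQ⟩)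
  · intro h x hx
    obtain ⟨P, rfl⟩ := Moved.cls_surjective x
    have := h.mem_nhds hx
    rw [nhds_subtype_eq_comap] at this
    obtain ⟨V, hV, hVU⟩ := this
    obtain ⟨δ, hδ, hb⟩ := exists_symDist_subset hV
    refine ⟨δ, hδ, fun y hy => ?_⟩
    obtain ⟨Q, rfl, hQ⟩ := (repDist_lt_iff P y δ).1 hy
    exact hVU (hb _ hQ)

/-! ### Continuity and properness of the invariants. -/

/-- The map is 2z²/|z|; its components are bounded by 2|z|, which gives continuity at the origin. -/
theorem continuous_double : Continuous fun z : ℝ × ℝ =>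
    (2 * (z.1 ^ 2 - z.2 ^ 2) / √(z.1 ^ 2 + z.2 ^ 2), 2 * (2 * z.1 * z.2) / √(z.1 ^ 2 + z.2 ^ 2)) := by
  have hbound : ∀ (c : ℝ × ℝ → ℝ), Continuous c → (∀ z, |c z| ≤ 2 * (z.1 ^ 2 + z.2 ^ 2)) →
      Continuous fun z : ℝ × ℝ => c z / √(z.1 ^ 2 + z.2 ^ 2) := by
    intro c hc hb
    rw [continuous_iff_continuousAt]
    intro z
    rcases eq_or_ne (z.1 ^ 2 + z.2 ^ 2) 0 with h0 | h0
    · have e : c z / √(z.1 ^ 2 + z.2 ^ 2) = 0 := by rw [h0]; simp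
      rw [ContinuousAt, e]
      have hlim : Filter.Tendsto (fun z : ℝ × ℝ => 2 * √(z.1 ^ 2 + z.2 ^ 2)) (𝓝 z) (𝓝 0) := by
        have : Continuous fun z : ℝ × ℝ => 2 * √(z.1 ^ 2 + z.2 ^ 2) := by fun_prop
        have := this.tendsto z
        rwa [h0, Real.sqrt_zero, mul_zero] at this
      refine squeeze_zero_norm (fun y => ?_) hlim
      rw [Real.norm_eq_abs, abs_div, abs_of_nonneg (Real.sqrt_nonneg _)]
      have hy : 0 ≤ y.1 ^ 2 + y.2 ^ 2 := by positivity
      refine div_le_of_le_mul₀ (Real.sqrt_nonneg _) (by positivity) ?_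
      rw [mul_assoc, Real.mul_self_sqrt hy]
      exact hb y
    · have h1 : √(z.1 ^ 2 + z.2 ^ 2) ≠ 0 := (Real.sqrt_pos.2 (by positivity)).ne'
      exact hc.continuousAt.div (by fun_prop) h1
  refine Continuous.prodMk (hbound _ (by fun_prop) fun z => ?_) (hbound _ (by fun_prop) fun z => ?_)
  · rw [abs_le]
    constructor <;> nlinarith [sq_nonneg z.1, sq_nonneg z.2]
  · rw [abs_le]
    constructor <;> nlinarith [sq_nonneg (z.1 - z.2), sq_nonneg (z.1 + z.2)]

theorem continuous_invMap_arr : Continuous fun P : X => invMap P.arr := by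
  have h := continuous_arr
  have he : ∀ i j, Continuous fun P : X => P.arr i j := fun i j => by fun_prop
  have hb : Continuous fun P : X => blockDet P.arr := by unfold blockDet; fun_prop
  have ht : Continuous fun P : X => halfTr P.arr := by unfold halfTr; fun_prop
  have hta : Continuous fun P : X => halfTrAdj P.arr := by unfold halfTrAdj; fun_prop
  have hc : Continuous fun P : X => cubic P.arr := by unfold cubic; fun_prop
  have hg : Continuous fun P : X => geomMean P.arr := by unfold geomMean; fun_prop
  have hs : Continuous fun P : X => scaleFactor P.arr :=
    Real.continuous_sqrt.comp ((he 2 2).div hg fun P => P.geomMean_pos.ne')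
  have hds : Continuous fun P : X => halfTrAdj P.arr / scaleFactor P.arr :=
    hta.div hs fun P => P.scaleFactor_pos.ne'
  have hN : Continuous fun P : X => invN P.arr := by unfold invN; fun_prop
  have hM : Continuous fun P : X => invM P.arr :=
    Continuous.div (by fun_prop) (by fun_prop) fun P => by have := P.geomMean_pos; positivity
  have hU : Continuous fun P : X => invU P.arr := by unfold invU; fun_prop
  have hV : Continuous fun P : X => invV P.arr := by unfold invV; fun_prop
  have hd := continuous_double.comp (hU.prodMk hV)
  refine (PiLp.continuous_toLp 2 _).comp (continuous_pi fun i => ?_)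
  fin_cases i
  · exact hd.fst
  · exact hd.snd
  · change Continuous fun P : X => invM P.arr ^ 2 - 1 - invN P.arr ^ 2
    fun_prop

theorem continuous_inv : Continuous RepSpace.inv := by
  rw [isQuotientMap_cls.continuous_iff]
  have : RepSpace.inv ∘ Moved.cls = fun P => invMap P.1.arr := funext inv_cls
  rw [this]
  exact continuous_invMap_arr.comp continuous_subtype_val

theorem continuous_normalForm :
    Continuous fun z : ℝ × ℝ × ℝ => normalForm z.1 z.2.1 z.2.2 := by
  rw [isInducing_arr.continuous_iff]
  change Continuous fun z : ℝ × ℝ × ℝ => normalArr z.1 z.2.1 z.2.2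
  have hg : Continuous fun z : ℝ × ℝ × ℝ => gap z.2.1 z.2.2 := by unfold gap; fun_prop
  have h0 : ∀ z : ℝ × ℝ × ℝ, gap z.2.1 z.2.2 ≠ 0 := fun z => (gap_pos _ _).ne'
  have h1 : Continuous fun z : ℝ × ℝ × ℝ => -z.2.2 / gap z.2.1 z.2.2 :=
    Continuous.div (by fun_prop) hg h0
  have h2 : Continuous fun z : ℝ × ℝ × ℝ =>
      √(1 + z.1 ^ 2) * gap z.2.1 z.2.2 + z.2.2 ^ 2 / gap z.2.1 z.2.2 :=
    Continuous.add (by fun_prop) (Continuous.div (by fun_prop) hg h0)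
  have h3 : Continuous fun z : ℝ × ℝ × ℝ => 1 / gap z.2.1 z.2.2 :=
    Continuous.div (by fun_prop) hg h0
  have h4 : Continuous fun z : ℝ × ℝ × ℝ => z.1 * √(gap z.2.1 z.2.2) := by fun_prop
  have h5 : Continuous fun z : ℝ × ℝ × ℝ => √(1 + z.1 ^ 2) := by fun_prop
  refine continuous_pi fun i => continuous_pi fun j => ?_
  fin_cases i <;> fin_cases j
  exacts [h2, h1, h4, h1, h3, continuous_const, h4, continuous_const, h5]

/-- The norm of `invMap` at the normal form is u² + v² + n⁴, so bounded values have bounded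
parameters. -/
theorem isCompact_normalForm_params {K : Set (EuclideanSpace ℝ (Fin 3))} (hK : IsCompact K) :
    IsCompact {z : ℝ × ℝ × ℝ | invMap (normalArr z.1 z.2.1 z.2.2) ∈ K} := by
  have hcont : Continuous fun z : ℝ × ℝ × ℝ => invMap (normalArr z.1 z.2.1 z.2.2) := by
    have := continuous_invMap_arr.comp continuous_normalForm
    simpa only [Function.comp_def, arr_normalForm] using this
  obtain ⟨R, hR⟩ := hK.isBounded.exists_norm_le
  refine Metric.isCompact_of_isClosed_isBounded (hK.isClosed.preimage hcont) ?_
  rw [isBounded_iff_forall_norm_le]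
  refine ⟨1 + R, fun z hz => ?_⟩
  have hle := hR _ hz
  have h0 : 0 ≤ R := (norm_nonneg _).trans hle
  obtain ⟨h1, h2⟩ := invMap_normalArr_sq z.1 z.2.1 z.2.2
  have hn : ‖invMap (normalArr z.1 z.2.1 z.2.2)‖ = z.2.1 ^ 2 + z.2.2 ^ 2 + z.1 ^ 4 := by
    rw [EuclideanSpace.norm_eq, Fin.sum_univ_three]
    simp only [Real.norm_eq_abs, sq_abs]
    rw [h1, h2, show 4 * z.1 ^ 4 * (z.2.1 ^ 2 + z.2.2 ^ 2) + (z.2.1 ^ 2 + z.2.2 ^ 2 - z.1 ^ 4) ^ 2 =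
      (z.2.1 ^ 2 + z.2.2 ^ 2 + z.1 ^ 4) ^ 2 by ring]
    exact Real.sqrt_sq (by positivity)
  rw [hn] at hle
  have hb : ∀ a : ℝ, a ^ 2 ≤ 1 + R → |a| ≤ 1 + R := fun a ha =>
    abs_le_of_sq_le_sq (by nlinarith) (by linarith)
  refine max_le (hb _ ?_) (max_le (hb _ ?_) (hb _ ?_))
  · nlinarith [sq_nonneg z.2.1, sq_nonneg z.2.2, sq_nonneg (z.1 ^ 2 - 1)]
  · nlinarith [sq_nonneg z.2.2, sq_nonneg (z.1 ^ 2)]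
  · nlinarith [sq_nonneg z.2.1, sq_nonneg (z.1 ^ 2)]

/-- The invariants as a map to the complement of the origin. -/
def RepSpace.invNe (x : RepSpace) : {v : EuclideanSpace ℝ (Fin 3) // v ≠ 0} :=
  ⟨x.inv, x.inv_ne_zero⟩

theorem isCompact_preimage_invNe {K : Set {v : EuclideanSpace ℝ (Fin 3) // v ≠ 0}}
    (hK : IsCompact K) : IsCompact (RepSpace.invNe ⁻¹' K) := by
  have hK' : IsCompact (Subtype.val '' K) := hK.image continuous_subtype_val
  have hC := isCompact_normalForm_params hK'
  rw [isCompact_iff_compactSpace] at hC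
  have hne : ∀ z : {z : ℝ × ℝ × ℝ | invMap (normalArr z.1 z.2.1 z.2.2) ∈ Subtype.val '' K},
      invMap (normalArr z.1.1 z.1.2.1 z.1.2.2) ≠ 0 := by
    rintro ⟨z, ⟨w, -, hw⟩⟩
    change invMap (normalArr z.1 z.2.1 z.2.2) ≠ 0
    rw [← hw]
    exact w.2
  let f : {z : ℝ × ℝ × ℝ | invMap (normalArr z.1 z.2.1 z.2.2) ∈ Subtype.val '' K} → RepSpace :=
    fun z => Moved.cls ⟨_, act_rot_normalForm_ne (hne z)⟩
  have hf : Continuous f :=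
    isQuotientMap_cls.continuous.comp
      ((continuous_normalForm.comp continuous_subtype_val).subtype_mk _)
  have hr : RepSpace.invNe ⁻¹' K = Set.range f := by
    ext x
    constructor
    · intro hx
      obtain ⟨ρ, n, u, v, rfl, hn, hfix, hinv⟩ := exists_repClass_normalForm x
      refine ⟨⟨(n, u, v), ⟨_, hx, hinv⟩⟩, ?_⟩
      apply RepSpace.inv_injective
      rw [hinv, inv_cls]
      rfl
    · rintro ⟨⟨z, w, hw, e⟩, rfl⟩
      have : RepSpace.invNe (f ⟨z, w, hw, e⟩) = w := by
        apply Subtype.ext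
        refine Eq.trans ?_ e.symm
        change RepSpace.inv (Moved.cls _) = _
        rw [inv_cls, arr_normalForm]
      rwa [Set.mem_preimage, this]
  rw [hr]
  exact isCompact_range hf

/-- The homeomorphism of the space of classes and `ℝ³` without the origin. -/
def invHomeo : RepSpace ≃ₜ {v : EuclideanSpace ℝ (Fin 3) // v ≠ 0} := by
  have hcont : Continuous RepSpace.invNe := continuous_inv.subtype_mk _
  have hbij : Function.Bijective RepSpace.invNe := by
    constructor
    · intro x y h
      exact RepSpace.inv_injective (congrArg Subtype.val h)
    · rintro ⟨w, hw⟩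
      obtain ⟨n, u, v, -, e⟩ := exists_normalArr_invMap_eq w
      refine ⟨Moved.cls ⟨_, act_rot_normalForm_ne (e ▸ hw)⟩, Subtype.ext ?_⟩
      change RepSpace.inv (Moved.cls _) = w
      rw [inv_cls, arr_normalForm, e]
  have hloc : LocallyCompactSpace {v : EuclideanSpace ℝ (Fin 3) // v ≠ 0} :=
    (isOpen_ne (x := (0 : EuclideanSpace ℝ (Fin 3)))).locallyCompactSpace
  -- Preimages of compact sets are images of compact sets of parameters. A proper map is closed, so
  -- the continuous bijection is a homeomorphism.
  have hproper : IsProperMap RepSpace.invNe :=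
    isProperMap_iff_isCompact_preimage.2 ⟨hcont, fun K hK => isCompact_preimage_invNe hK⟩
  exact (Equiv.ofBijective _ hbij).toHomeomorphOfContinuousClosed hcont hproper.isClosedMap


/-! ### Smoothness of the invariants and smooth sections -/

theorem invU_sq_add_invV_sq_pos {P : X} (h : ¬(invMap P.arr 0 = 0 ∧ invMap P.arr 1 = 0)) :
    0 < invU P.arr ^ 2 + invV P.arr ^ 2 := by
  refine lt_of_le_of_ne (by positivity) fun h0 => h ⟨?_, ?_⟩
  · change 2 * (invU P.arr ^ 2 - invV P.arr ^ 2) / √(invU P.arr ^ 2 + invV P.arr ^ 2) = 0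
    rw [← h0]; simp
  · change 2 * (2 * invU P.arr * invV P.arr) / √(invU P.arr ^ 2 + invV P.arr ^ 2) = 0
    rw [← h0]; simp

/-- Off the axis (U, V) ≠ 0, so every square root and denominator in the formula is positive. The
smoothness is in the ambient space of arrays. -/
theorem contDiffAt_invMap {P : X} (h : ¬(invMap P.arr 0 = 0 ∧ invMap P.arr 1 = 0)) :
    ContDiffAt ℝ ∞ invMap P.arr := by
  have hpos := invU_sq_add_invV_sq_pos h
  have he : ∀ i j : Fin 3, ContDiffAt ℝ ∞ (fun A : Arr => A i j) P.arr := fun i j => by fun_prop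
  have hb : ContDiffAt ℝ ∞ blockDet P.arr := by unfold blockDet; fun_prop
  have ht : ContDiffAt ℝ ∞ halfTr P.arr := by unfold halfTr; fun_prop
  have ha : ContDiffAt ℝ ∞ halfTrAdj P.arr := by unfold halfTrAdj; fun_prop
  have hV : ContDiffAt ℝ ∞ invV P.arr := by unfold invV cubic; fun_prop
  have hN : ContDiffAt ℝ ∞ invN P.arr := by unfold invN; fun_prop
  have hp : 0 < P.arr 2 2 := P.diag_pos 2
  have hg : ContDiffAt ℝ ∞ geomMean P.arr :=
    ((he 2 2).mul hb).sqrt (mul_pos hp P.blockDet_pos).ne'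
  have hs : ContDiffAt ℝ ∞ scaleFactor P.arr :=
    ((he 2 2).div hg P.geomMean_pos.ne').sqrt (div_pos hp P.geomMean_pos).ne'
  have hs0 := P.scaleFactor_pos.ne'
  have hg1 : ContDiffAt ℝ ∞ (fun A => geomMean A + 1) P.arr := hg.add contDiffAt_const
  have hM : ContDiffAt ℝ ∞ invM P.arr :=
    ((ht.mul hs).add (ha.div hs hs0)).div hg1 (by have := P.geomMean_pos; positivity)
  have hU : ContDiffAt ℝ ∞ invU P.arr := hg1.mul ((ha.div hs hs0).sub (ht.mul hs))
  have hr : ContDiffAt ℝ ∞ (fun A => √(invU A ^ 2 + invV A ^ 2)) P.arr :=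
    ((hU.pow 2).add (hV.pow 2)).sqrt hpos.ne'
  have hr0 : √(invU P.arr ^ 2 + invV P.arr ^ 2) ≠ 0 := (Real.sqrt_pos.2 hpos).ne'
  rw [contDiffAt_euclidean]
  intro i
  fin_cases i
  · exact (contDiffAt_const.mul ((hU.pow 2).sub (hV.pow 2))).div hr hr0
  · exact (contDiffAt_const.mul ((contDiffAt_const.mul hU).mul hV)).div hr hr0
  · exact ((hM.pow 2).sub contDiffAt_const).sub (hN.pow 2)

theorem contDiff_normalArr :
    ContDiff ℝ ∞ fun z : ℝ × ℝ × ℝ => normalArr z.1 z.2.1 z.2.2 := by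
  have hq : ContDiff ℝ ∞ fun z : ℝ × ℝ × ℝ => √(1 + z.1 ^ 2) :=
    ContDiff.sqrt (by fun_prop) fun z => by positivity
  have hg : ContDiff ℝ ∞ fun z : ℝ × ℝ × ℝ => gap z.2.1 z.2.2 :=
    (ContDiff.sqrt (by fun_prop) fun z => by positivity).sub (by fun_prop)
  have h0 : ∀ z : ℝ × ℝ × ℝ, gap z.2.1 z.2.2 ≠ 0 := fun z => (gap_pos _ _).ne'
  have h1 : ContDiff ℝ ∞ fun z : ℝ × ℝ × ℝ => -z.2.2 / gap z.2.1 z.2.2 :=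
    ContDiff.div (by fun_prop) hg h0
  have h2 : ContDiff ℝ ∞ fun z : ℝ × ℝ × ℝ =>
      √(1 + z.1 ^ 2) * gap z.2.1 z.2.2 + z.2.2 ^ 2 / gap z.2.1 z.2.2 :=
    (hq.mul hg).add (ContDiff.div (by fun_prop) hg h0)
  have h3 : ContDiff ℝ ∞ fun z : ℝ × ℝ × ℝ => 1 / gap z.2.1 z.2.2 :=
    ContDiff.div (by fun_prop) hg h0
  have h4 : ContDiff ℝ ∞ fun z : ℝ × ℝ × ℝ => z.1 * √(gap z.2.1 z.2.2) :=
    contDiff_fst.mul (hg.sqrt h0)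
  refine contDiff_pi.2 fun i => contDiff_pi.2 fun j => ?_
  fin_cases i <;> fin_cases j
  exacts [h2, h1, h4, h1, h3, contDiff_const, h4, contDiff_const, hq]

/-! ### A smooth choice of the square root. -/

/-- A square root of the argument of `w 0 + i * w 1`, up to a positive factor, on the side of
`u + i * v`. -/
def rootRe (u v : ℝ) (w : EuclideanSpace ℝ (Fin 3)) : ℝ := w 0 * u + w 1 * v + axisDist w * u

def rootIm (u v : ℝ) (w : EuclideanSpace ℝ (Fin 3)) : ℝ := w 1 * u - w 0 * v + axisDist w * v

theorem axisDist_sq (w : EuclideanSpace ℝ (Fin 3)) : axisDist w ^ 2 = w 0 ^ 2 + w 1 ^ 2 :=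
  Real.sq_sqrt (by positivity)

theorem axisDist_pos_iff (w : EuclideanSpace ℝ (Fin 3)) :
    0 < axisDist w ↔ ¬(w 0 = 0 ∧ w 1 = 0) := by
  rw [axisDist, Real.sqrt_pos]
  constructor
  · rintro h ⟨h0, h1⟩
    simp [h0, h1] at h
  · intro h
    refine lt_of_le_of_ne (by positivity) fun e => h ⟨?_, ?_⟩ <;>
      nlinarith [sq_nonneg (w 0), sq_nonneg (w 1)]

/-- Let w also denote w₀ + iw₁, and let z = u + iv and η = w z̄ + |w|z. Then w η̄ = |w|η, so |w|η² =
w|η|². This and the next lemma are the real and imaginary parts. -/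
theorem axisDist_mul_rootRe_sq_sub (u v : ℝ) (w : EuclideanSpace ℝ (Fin 3)) :
    axisDist w * (rootRe u v w ^ 2 - rootIm u v w ^ 2) =
      w 0 * (rootRe u v w ^ 2 + rootIm u v w ^ 2) := by
  have key : ∀ x y L : ℝ, L ^ 2 = x ^ 2 + y ^ 2 →
      L * ((x * u + y * v + L * u) ^ 2 - (y * u - x * v + L * v) ^ 2) =
        x * ((x * u + y * v + L * u) ^ 2 + (y * u - x * v + L * v) ^ 2) := by
    intro x y L h
    grind
  exact key _ _ _ (axisDist_sq w)

theorem axisDist_mul_two_rootRe_mul_rootIm (u v : ℝ) (w : EuclideanSpace ℝ (Fin 3)) :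
    axisDist w * (2 * rootRe u v w * rootIm u v w) =
      w 1 * (rootRe u v w ^ 2 + rootIm u v w ^ 2) := by
  have key : ∀ x y L : ℝ, L ^ 2 = x ^ 2 + y ^ 2 →
      L * (2 * (x * u + y * v + L * u) * (y * u - x * v + L * v)) =
        y * ((x * u + y * v + L * u) ^ 2 + (y * u - x * v + L * v) ^ 2) := by
    intro x y L h
    grind
  exact key _ _ _ (axisDist_sq w)

theorem solveN_pos {w : EuclideanSpace ℝ (Fin 3)} (h : 0 < axisDist w) : 0 < solveN w := by
  refine lt_of_le_of_ne (Real.sqrt_nonneg _) fun e => h.ne ?_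
  rw [← two_mul_solveN_mul_solveR, ← e]; ring

theorem solveR_pos {w : EuclideanSpace ℝ (Fin 3)} (h : 0 < axisDist w) : 0 < solveR w := by
  refine lt_of_le_of_ne (Real.sqrt_nonneg _) fun e => h.ne ?_
  rw [← two_mul_solveN_mul_solveR, ← e]; ring

/-- The parameters of the normal form with invariants `w`. -/
def solveParams (u v : ℝ) (w : EuclideanSpace ℝ (Fin 3)) : ℝ × ℝ × ℝ :=
  (√(solveN w), solveR w * (rootRe u v w / √(rootRe u v w ^ 2 + rootIm u v w ^ 2)),
    solveR w * (rootIm u v w / √(rootRe u v w ^ 2 + rootIm u v w ^ 2)))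

/-- The set on which the section of the invariants is smooth. -/
def solveDomain (u v : ℝ) : Set (EuclideanSpace ℝ (Fin 3)) :=
  {w | 0 < axisDist w ∧ 0 < rootRe u v w ^ 2 + rootIm u v w ^ 2}

theorem isOpen_solveDomain (u v : ℝ) : IsOpen (solveDomain u v) := by
  have h : Continuous axisDist := by unfold axisDist; fun_prop
  have h1 : Continuous (rootRe u v) := by unfold rootRe; fun_prop
  have h2 : Continuous (rootIm u v) := by unfold rootIm; fun_prop
  exact (isOpen_lt continuous_const h).inter
    (isOpen_lt continuous_const ((h1.pow 2).add (h2.pow 2)))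

theorem invMap_solveParams {u v : ℝ} {w : EuclideanSpace ℝ (Fin 3)} (hw : w ∈ solveDomain u v) :
    invMap (normalArr (solveParams u v w).1 (solveParams u v w).2.1 (solveParams u v w).2.2)
      = w := by
  obtain ⟨hL, hη⟩ := hw
  have hs : √(rootRe u v w ^ 2 + rootIm u v w ^ 2) ^ 2 = rootRe u v w ^ 2 + rootIm u v w ^ 2 :=
    Real.sq_sqrt hη.le
  have h0 := axisDist_mul_rootRe_sq_sub u v w
  have h1 := axisDist_mul_two_rootRe_mul_rootIm u v w
  refine invMap_solve w _ _ ?_ ?_ ?_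
  · rw [div_pow, div_pow, hs, ← add_div, div_self hη.ne']
  · rw [div_pow, div_pow, hs, ← sub_div, mul_div_assoc', h0, mul_div_cancel_right₀ _ hη.ne']
  · rw [mul_assoc 2, div_mul_div_comm, ← pow_two √_, hs, mul_div_assoc', mul_div_assoc',
      ← mul_assoc 2, h1, mul_div_cancel_right₀ _ hη.ne']

theorem contDiffOn_solveParams (u v : ℝ) : ContDiffOn ℝ ∞ (solveParams u v) (solveDomain u v) := by
  rintro w ⟨hL, hη⟩
  apply ContDiffAt.contDiffWithinAt
  have he : ∀ i : Fin 3, ContDiffAt ℝ ∞ (fun w : EuclideanSpace ℝ (Fin 3) => w i) w :=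
    fun i => by fun_prop
  have hA : ContDiffAt ℝ ∞ axisDist w :=
    (((he 0).pow 2).add ((he 1).pow 2)).sqrt (Real.sqrt_pos.1 hL).ne'
  have hlen : ContDiffAt ℝ ∞ len w := by
    refine ((((he 0).pow 2).add ((he 1).pow 2)).add ((he 2).pow 2)).sqrt ?_
    have := Real.sqrt_pos.1 hL
    positivity
  have hN : ContDiffAt ℝ ∞ solveN w :=
    ((hlen.sub (he 2)).div_const 2).sqrt (Real.sqrt_pos.1 (solveN_pos hL)).ne'
  have hR : ContDiffAt ℝ ∞ solveR w :=
    ((hlen.add (he 2)).div_const 2).sqrt (Real.sqrt_pos.1 (solveR_pos hL)).ne'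
  have h1 : ContDiffAt ℝ ∞ (rootRe u v) w :=
    (((he 0).mul contDiffAt_const).add ((he 1).mul contDiffAt_const)).add (hA.mul contDiffAt_const)
  have h2 : ContDiffAt ℝ ∞ (rootIm u v) w :=
    (((he 1).mul contDiffAt_const).sub ((he 0).mul contDiffAt_const)).add (hA.mul contDiffAt_const)
  have h3 := ((h1.pow 2).add (h2.pow 2)).sqrt hη.ne'
  have h0 := (Real.sqrt_pos.2 hη).ne'
  exact (hN.sqrt (solveN_pos hL).ne').prodMk
    ((hR.mul (h1.div h3 h0)).prodMk (hR.mul (h2.div h3 h0)))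

/-- At the invariants of (n, u, v) the number w is a positive multiple of z², so w z̄ = |w|z and η =
2|w|z. The chosen root is therefore z and not -z, and the section passes through the given point. -/
theorem solveParams_invMap {n u v : ℝ} (hn : 0 < n) (h : 0 < u ^ 2 + v ^ 2) :
    invMap (normalArr n u v) ∈ solveDomain u v ∧
      solveParams u v (invMap (normalArr n u v)) = (n, u, v) := by
  obtain ⟨e1, e2⟩ := invMap_normalArr_sq n u v
  have hr : 0 < √(u ^ 2 + v ^ 2) := Real.sqrt_pos.2 h
  have hrr : √(u ^ 2 + v ^ 2) ^ 2 = u ^ 2 + v ^ 2 := Real.sq_sqrt h.le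
  have w0 : invMap (normalArr n u v) 0 = 2 * n ^ 2 * (u ^ 2 - v ^ 2) / √(u ^ 2 + v ^ 2) := by
    rw [invMap_normalArr]; rfl
  have w1 : invMap (normalArr n u v) 1 = 4 * n ^ 2 * u * v / √(u ^ 2 + v ^ 2) := by
    rw [invMap_normalArr]; rfl
  have w2 : invMap (normalArr n u v) 2 = u ^ 2 + v ^ 2 - n ^ 4 := by
    rw [invMap_normalArr]; rfl
  generalize invMap (normalArr n u v) = w at *
  set r := √(u ^ 2 + v ^ 2)
  have hA : axisDist w = 2 * n ^ 2 * r := by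
    rw [axisDist, e1, show 4 * n ^ 4 * (u ^ 2 + v ^ 2) = (2 * n ^ 2 * r) ^ 2 by
      rw [mul_pow, hrr]; ring]
    exact Real.sqrt_sq (by positivity)
  have hlen : len w = u ^ 2 + v ^ 2 + n ^ 4 := by
    rw [len, e1, w2, show 4 * n ^ 4 * (u ^ 2 + v ^ 2) + (u ^ 2 + v ^ 2 - n ^ 4) ^ 2 =
      (u ^ 2 + v ^ 2 + n ^ 4) ^ 2 by ring]
    exact Real.sqrt_sq (by positivity)
  have hN : solveN w = n ^ 2 := by
    rw [solveN, hlen, w2, show (u ^ 2 + v ^ 2 + n ^ 4 - (u ^ 2 + v ^ 2 - n ^ 4)) / 2 =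
      (n ^ 2) ^ 2 by ring]
    exact Real.sqrt_sq (by positivity)
  have hR : solveR w = r := by
    rw [solveR, hlen, w2, show (u ^ 2 + v ^ 2 + n ^ 4 + (u ^ 2 + v ^ 2 - n ^ 4)) / 2 =
      u ^ 2 + v ^ 2 by ring]
  have h1 : rootRe u v w = 4 * n ^ 2 * r * u := by
    rw [rootRe, w0, w1, hA]
    field_simp
    rw [hrr]; ring
  have h2 : rootIm u v w = 4 * n ^ 2 * r * v := by
    rw [rootIm, w0, w1, hA]
    field_simp
    rw [hrr]; ring
  have h3 : rootRe u v w ^ 2 + rootIm u v w ^ 2 = (4 * n ^ 2 * r * r) ^ 2 := by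
    rw [h1, h2, mul_pow _ r, hrr]; ring
  have h4 : √(rootRe u v w ^ 2 + rootIm u v w ^ 2) = 4 * n ^ 2 * r * r := by
    rw [h3]; exact Real.sqrt_sq (by positivity)
  refine ⟨⟨by rw [hA]; positivity, by rw [h3]; positivity⟩, ?_⟩
  rw [solveParams, h4, hN, hR, h1, h2, Real.sqrt_sq hn.le]
  refine Prod.ext rfl (Prod.ext ?_ ?_)
  · change r * (4 * n ^ 2 * r * u / (4 * n ^ 2 * r * r)) = u
    field_simp
  · change r * (4 * n ^ 2 * r * v / (4 * n ^ 2 * r * r)) = v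
    field_simp

theorem contDiff_act (T : SL3) : ContDiff ℝ ∞ fun A : Arr => fun i j =>
    ((((T⁻¹ : SL3) : Mat3).transpose * Matrix.of A * ((T⁻¹ : SL3) : Mat3)) i j : ℝ) :=
  contDiff_matrix_mul (contDiff_matrix_mul (contDiff_const
    (c := fun i j => ((T⁻¹ : SL3) : Mat3).transpose i j)) contDiff_id)
    (contDiff_const (c := fun i j => ((T⁻¹ : SL3) : Mat3) i j))

/-- Off the third axis, the invariants have smooth local sections through every point. -/
theorem exists_section_invMap (P : X) (h : ¬(invMap P.arr 0 = 0 ∧ invMap P.arr 1 = 0)) :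
    ∃ (O : Set (EuclideanSpace ℝ (Fin 3))) (S : EuclideanSpace ℝ (Fin 3) → X),
      IsOpen O ∧ invMap P.arr ∈ O ∧ ContDiffOn ℝ ∞ (fun w => (S w).arr) O ∧
        (∀ w ∈ O, invMap (S w).arr = w) ∧ S (invMap P.arr) = P := by
  obtain ⟨p, r, hpr, n, u, v, hn0, e⟩ := exists_normalForm P
  have hmem := act_spin_inv_mem p r hpr
  have hinv : invMap P.arr = invMap (normalArr n u v) := by
    rw [← invMap_apply_of_mem hmem, e, arr_normalForm]
  have hpos : 0 < n ∧ 0 < u ^ 2 + v ^ 2 := by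
    rw [hinv, ← axisDist_pos_iff, axisDist, Real.sqrt_pos, (invMap_normalArr_sq n u v).1] at h
    refine ⟨lt_of_le_of_ne hn0 ?_, lt_of_le_of_ne (by positivity) ?_⟩
    · rintro rfl
      simp at h
    · intro e
      simp [← e] at h
  obtain ⟨hd, hs⟩ := solveParams_invMap hpos.1 hpos.2
  rw [hinv]
  refine ⟨solveDomain u v, fun w => act (spin p r hpr) (normalForm (solveParams u v w).1
    (solveParams u v w).2.1 (solveParams u v w).2.2), isOpen_solveDomain u v, hd, ?_, ?_, ?_⟩
  · exact (contDiff_act (spin p r hpr)).comp_contDiffOn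
      (contDiff_normalArr.comp_contDiffOn (contDiffOn_solveParams u v))
  · intro w hw
    have hm : act (spin p r hpr) ∈ commRot := by
      rw [map_inv] at hmem
      exact inv_mem_iff.1 hmem
    rw [invMap_apply_of_mem hm, arr_normalForm, invMap_solveParams hw]
  · simp only [hs, ← e]
    rw [← Equiv.Perm.mul_apply, ← map_mul, mul_inv_cancel, map_one, Equiv.Perm.one_apply]


/-! ### The smooth structure -/

/-- The coordinates on the complement of the two curves. -/
def SmoothPart.coord (x : SmoothPart) : EuclideanSpace ℝ (Fin 3) := x.1.inv

theorem SmoothPart.coord_off_axis (x : SmoothPart) : ¬(x.coord 0 = 0 ∧ x.coord 1 = 0) :=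
  (notMem_curves_iff x.1).1 x.2

theorem SmoothPart.isOpenEmbedding_coord : Topology.IsOpenEmbedding SmoothPart.coord := by
  have hopen : IsOpen {x : RepSpace | x ∉ lineCurve ∪ conicCurve} := by
    have : {x : RepSpace | x ∉ lineCurve ∪ conicCurve} =
        RepSpace.inv ⁻¹' ({w | w 0 = 0} ∩ {w | w 1 = 0})ᶜ := by
      ext x
      exact notMem_curves_iff x
    rw [this]
    refine IsOpen.preimage continuous_inv (IsClosed.isOpen_compl (self := ?_))
    exact (isClosed_eq (by fun_prop) continuous_const).inter
      (isClosed_eq (by fun_prop) continuous_const)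
  exact (isOpen_ne.isOpenEmbedding_subtypeVal.comp invHomeo.isOpenEmbedding).comp
    hopen.isOpenEmbedding_subtypeVal

theorem smoothClass_surjective : Function.Surjective smoothClass := by
  rintro ⟨x, hx⟩
  induction x using Quotient.inductionOn with
  | _ ρ => exact ⟨⟨ρ, hx⟩, rfl⟩

instance : Nonempty SmoothPart := by
  obtain ⟨n, u, v, -, e⟩ := exists_normalArr_invMap_eq !₂[1, 0, 0]
  have hne : invMap (normalArr n u v) ≠ 0 := by
    intro h
    have := congrArg (fun w : EuclideanSpace ℝ (Fin 3) => w 0) (e.symm.trans h)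
    simp at this
  refine ⟨⟨Moved.cls ⟨_, act_rot_normalForm_ne hne⟩, ?_⟩⟩
  rw [notMem_curves_iff, inv_cls, arr_normalForm, e]
  simp

/-- The smooth structure on the complement of the curves. -/
@[reducible] def SmoothPart.chartedSpace : ChartedSpace (EuclideanSpace ℝ (Fin 3)) SmoothPart :=
  SmoothPart.isOpenEmbedding_coord.singletonChartedSpace

attribute [local instance] SmoothPart.chartedSpace

theorem SmoothPart.isManifold : IsManifold (𝓡 3) ∞ SmoothPart :=
  SmoothPart.isOpenEmbedding_coord.isManifold_singleton

theorem SmoothPart.contMDiff_coord : ContMDiff (𝓡 3) (𝓡 3) ∞ SmoothPart.coord :=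
  contMDiff_isOpenEmbedding SmoothPart.isOpenEmbedding_coord

/-- A smooth function on an open set is a smooth function of the coordinates. -/
theorem SmoothPart.exists_contDiffOn {U : Set SmoothPart} {f : SmoothPart → ℝ}
    (hf : ContMDiffOn (𝓡 3) 𝓘(ℝ, ℝ) ∞ f U) :
    ∃ g : EuclideanSpace ℝ (Fin 3) → ℝ, ContDiffOn ℝ ∞ g (SmoothPart.coord '' U) ∧
      ∀ x, g x.coord = f x := by
  set e := SmoothPart.isOpenEmbedding_coord.toOpenPartialHomeomorph SmoothPart.coord with he
  have hl : ∀ x, e.symm x.coord = x := fun x => e.left_inv (x := x) (by simp [he])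
  refine ⟨f ∘ e.symm, ?_, fun x => congrArg f (hl x)⟩
  rw [← contMDiffOn_iff_contDiffOn]
  have hs : ContMDiffOn (𝓡 3) (𝓡 3) ∞ e.symm (Set.range SmoothPart.coord) :=
    contMDiffOn_isOpenEmbedding_symm SmoothPart.isOpenEmbedding_coord
  refine hf.comp (hs.mono (Set.image_subset_range _ _)) ?_
  rintro _ ⟨x, hx, rfl⟩
  rw [Set.mem_preimage, hl]
  exact hx

/-- A section of `invMap` has values moved by `rot`, because the invariants of a class are nonzero;
these points define the representations. -/
theorem exists_smoothSection (ρ : SmoothRep) :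
    ∃ (U : Set SmoothPart) (s : SmoothPart → SmoothRep),
      IsOpen U ∧ smoothClass ρ ∈ U ∧ IsSmoothSection U s ∧ s (smoothClass ρ) = ρ := by
  obtain ⟨O, S, hO, hmem, hS, hinv, hρ⟩ :=
    exists_section_invMap ρ.1.fix (smoothClass ρ).coord_off_axis
  have hex : ∀ x : SmoothPart, x.coord ∈ O →
      ∃ ρ' : SmoothRep, smoothClass ρ' = x ∧ ρ'.1.fix = S x.coord := by
    intro x hx
    have hm : act rot (S x.coord) ≠ S x.coord := by
      rw [Ne, ← invMap_eq_zero_iff, hinv _ hx]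
      exact x.1.inv_ne_zero
    have hc : repClass (Moved.rep ⟨_, hm⟩) = x.1 := by
      apply RepSpace.inv_injective
      rw [inv_repClass, Moved.fix_rep, hinv _ hx]
      rfl
    exact ⟨⟨Moved.rep ⟨_, hm⟩, hc ▸ x.2⟩, Subtype.ext hc, Moved.fix_rep _⟩
  have : Nonempty SmoothRep := ⟨ρ⟩
  choose! s hs using hex
  refine ⟨SmoothPart.coord ⁻¹' O, s, hO.preimage SmoothPart.isOpenEmbedding_coord.continuous, hmem,
    ⟨fun x hx => (hs x hx).1, ?_⟩, ?_⟩
  · refine (hS.contMDiffOn.comp SmoothPart.contMDiff_coord.contMDiffOn fun x hx => hx).congr ?_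
    intro x hx
    rw [fixedPoint_eq_arr, (hs x hx).2]
    rfl
  · apply Subtype.ext
    apply NormRep.ext_fix
    rw [(hs (smoothClass ρ) hmem).2]
    exact hρ

theorem isQuotientSmoothStructure : IsQuotientSmoothStructure := by
  refine ⟨fun U f hU => ⟨fun hf => ?_, ?_⟩, exists_smoothSection⟩
  · obtain ⟨g, hg, hgf⟩ := SmoothPart.exists_contDiffOn hf
    refine ⟨g ∘ invMap, ?_, fun ρ _ => ?_⟩
    · rintro _ ⟨ρ, hρ, rfl⟩
      apply ContDiffAt.contDiffWithinAt
      have h1 : ContDiffAt ℝ ∞ g (invMap (fixedPoint ρ.1)) :=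
        -- The image of U under the coordinates is open, so `g` is smooth in a full neighbourhood.
        hg.contDiffAt ((SmoothPart.isOpenEmbedding_coord.isOpenMap U hU).mem_nhds ⟨_, hρ, rfl⟩)
      exact h1.comp _ (contDiffAt_invMap (P := ρ.1.fix) (smoothClass ρ).coord_off_axis)
    · exact hgf (smoothClass ρ)
  · rintro ⟨F, hF, hFf⟩ x hx
    obtain ⟨ρ, rfl⟩ := smoothClass_surjective x
    -- Near each class, the function is its pullback composed with a smooth local section.
    obtain ⟨V, s, hV, hρV, ⟨hs, hsm⟩, -⟩ := exists_smoothSection ρ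
    have hUV : IsOpen (U ∩ V) := hU.inter hV
    have h : ContMDiffOn (𝓡 3) 𝓘(ℝ, ℝ) ∞ f (U ∩ V) := by
      refine (hF.contMDiffOn.comp (hsm.mono Set.inter_subset_right) ?_).congr ?_
      · intro y hy
        refine ⟨s y, ?_, rfl⟩
        rw [Set.mem_preimage, hs y hy.2]
        exact hy.1
      · intro y hy
        have hy' : s y ∈ smoothClass ⁻¹' U := by
          rw [Set.mem_preimage, hs y hy.2]
          exact hy.1
        have h1 : F (fixedPoint (s y).1) = f (smoothClass (s y)) := hFf (s y) hy'
        rw [hs y hy.2] at h1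
        exact h1.symm
    exact (h.contMDiffAt (hUV.mem_nhds ⟨hx, hρV⟩)).contMDiffWithinAt

/-- An invariant smooth function of the fixed point descends to the quotient. -/
theorem exists_contMDiff_of_invariant {t : Arr → ℝ} (ht : ContDiff ℝ ∞ t)
    (hinv : ∀ ρ ρ' : SmoothRep, smoothClass ρ = smoothClass ρ' →
      t (fixedPoint ρ.1) = t (fixedPoint ρ'.1)) :
    ∃ f : SmoothPart → ℝ, ContMDiff (𝓡 3) 𝓘(ℝ, ℝ) ∞ f ∧
      ∀ ρ : SmoothRep, f (smoothClass ρ) = t (fixedPoint ρ.1) := by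
  obtain ⟨r, hr⟩ := smoothClass_surjective.hasRightInverse
  have hf : ∀ ρ : SmoothRep, t (fixedPoint (r (smoothClass ρ)).1) = t (fixedPoint ρ.1) :=
    fun ρ => hinv _ _ (hr _)
  refine ⟨fun x => t (fixedPoint (r x).1), ?_, hf⟩
  rw [← contMDiffOn_univ]
  exact (isQuotientSmoothStructure.1 _ _ isOpen_univ).2
    ⟨t, ht.contDiffOn, fun ρ _ => (hf ρ).symm⟩

theorem exists_contMDiff_wordTrace {w : G} (hw : IsEvenWord w)
    (h : ∀ ρ ρ' : SmoothRep, smoothClass ρ = smoothClass ρ' →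
      wordTrace ρ.1 w = wordTrace ρ'.1 w) :
    ∃ f : SmoothPart → ℝ, ContMDiff (𝓡 3) 𝓘(ℝ, ℝ) ∞ f ∧
      ∀ ρ : SmoothRep, f (smoothClass ρ) = wordTrace ρ.1 w := by
  obtain ⟨t, ht, htw⟩ := exists_smooth_wordTrace hw
  simp only [htw] at h ⊢
  exact exists_contMDiff_of_invariant ht h

/-- Conjugation fixes or swaps the traces of w and w⁻¹, so their sum and product are well defined on
classes. -/
theorem wordTrace_pair_conj {ρ ρ' : NormRep} (h : repClass ρ = repClass ρ') {w : G}
    (hw : IsEvenWord w) :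
    (wordTrace ρ w = wordTrace ρ' w ∧ wordTrace ρ w⁻¹ = wordTrace ρ' w⁻¹) ∨
      (wordTrace ρ w = wordTrace ρ' w⁻¹ ∧ wordTrace ρ w⁻¹ = wordTrace ρ' w) := by
  rcases wordTrace_conj h.symm with h | h
  · exact Or.inl ⟨h w hw, h _ hw.inv⟩
  · exact Or.inr ⟨h w hw, by rw [h _ hw.inv, inv_inv]⟩

theorem exists_contMDiff_symmetric_wordTrace {w : G} (hw : IsEvenWord w) :
    ∃ f g : SmoothPart → ℝ, ContMDiff (𝓡 3) 𝓘(ℝ, ℝ) ∞ f ∧ ContMDiff (𝓡 3) 𝓘(ℝ, ℝ) ∞ g ∧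
      ∀ ρ : SmoothRep, f (smoothClass ρ) = wordTrace ρ.1 w + wordTrace ρ.1 w⁻¹ ∧
        g (smoothClass ρ) = wordTrace ρ.1 w * wordTrace ρ.1 w⁻¹ := by
  obtain ⟨t, ht, htw⟩ := exists_smooth_wordTrace hw
  obtain ⟨t', ht', htw'⟩ := exists_smooth_wordTrace hw.inv
  have key := fun (ρ ρ' : SmoothRep) (h : smoothClass ρ = smoothClass ρ') =>
    wordTrace_pair_conj (congrArg Subtype.val h : repClass ρ.1 = repClass ρ'.1) hw
  simp only [htw, htw'] at key ⊢
  obtain ⟨f, hf, hf'⟩ := exists_contMDiff_of_invariant (ht.add ht') fun ρ ρ' h => by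
    rcases key ρ ρ' h with ⟨h1, h2⟩ | ⟨h1, h2⟩ <;> simp only [h1, h2, add_comm]
  obtain ⟨g, hg, hg'⟩ := exists_contMDiff_of_invariant (ht.mul ht') fun ρ ρ' h => by
    rcases key ρ ρ' h with ⟨h1, h2⟩ | ⟨h1, h2⟩ <;> simp only [h1, h2, mul_comm]
  exact ⟨f, g, hf, hg, fun ρ => ⟨hf' ρ, hg' ρ⟩⟩

theorem contMDiffOn_wordTrace_section {w : G} (hw : IsEvenWord w) {U : Set SmoothPart}
    {s : SmoothPart → SmoothRep} (hs : IsSmoothSection U s) :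
    ContMDiffOn (𝓡 3) 𝓘(ℝ, ℝ) ∞ (fun x => wordTrace (s x).1 w) U := by
  obtain ⟨t, ht, htw⟩ := exists_smooth_wordTrace hw
  simp only [htw]
  exact ht.contMDiff.comp_contMDiffOn hs.2

end ModularSL3

end

open ModularSL3 in
theorem theorem3p1 :
    (∃ Φ : RepSpace ≃ₜ {v : EuclideanSpace ℝ (Fin 3) // v ≠ 0},
      (∀ x : RepSpace, x ∈ lineCurve ↔ ∃ t : ℝ, 0 < t ∧ (Φ x).1 = !₂[0, 0, t]) ∧
      (∀ x : RepSpace, x ∈ conicCurve ↔ ∃ t : ℝ, 0 < t ∧ (Φ x).1 = !₂[0, 0, -t])) ∧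
    ∃ _ : ChartedSpace (EuclideanSpace ℝ (Fin 3)) SmoothPart,
      IsManifold (𝓡 3) ∞ SmoothPart ∧
      IsQuotientSmoothStructure ∧
      ∀ w : G, IsEvenWord w →
        (∀ ρ : NormRep, ∃! T : SL3, (ρ.hom w : Equiv.Perm X) = act T) ∧
        (∀ ρ ρ' : NormRep, repClass ρ = repClass ρ' →
          wordTrace ρ' w = wordTrace ρ w ∨ wordTrace ρ' w = wordTrace ρ w⁻¹) ∧
        (∀ (U : Set SmoothPart) (s : SmoothPart → SmoothRep), IsOpen U → IsSmoothSection U s →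
          ContMDiffOn (𝓡 3) 𝓘(ℝ, ℝ) ∞ (fun x => wordTrace (s x).1 w) U) ∧
        (∃ f g : SmoothPart → ℝ,
          ContMDiff (𝓡 3) 𝓘(ℝ, ℝ) ∞ f ∧ ContMDiff (𝓡 3) 𝓘(ℝ, ℝ) ∞ g ∧
          ∀ ρ : SmoothRep, f (smoothClass ρ) = wordTrace ρ.1 w + wordTrace ρ.1 w⁻¹ ∧
            g (smoothClass ρ) = wordTrace ρ.1 w * wordTrace ρ.1 w⁻¹) ∧
        ((∀ ρ ρ' : SmoothRep, smoothClass ρ = smoothClass ρ' →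
            wordTrace ρ.1 w = wordTrace ρ'.1 w) →
          ∃ f : SmoothPart → ℝ, ContMDiff (𝓡 3) 𝓘(ℝ, ℝ) ∞ f ∧
            ∀ ρ : SmoothRep, f (smoothClass ρ) = wordTrace ρ.1 w) := by
  refine ⟨⟨invHomeo, mem_lineCurve_iff, mem_conicCurve_iff⟩, SmoothPart.chartedSpace,
    SmoothPart.isManifold, isQuotientSmoothStructure, fun w hw =>
    ⟨fun ρ => ρ.existsUnique_act hw, fun ρ ρ' h => ?_,
      fun U s _ hs => contMDiffOn_wordTrace_section hw hs,
      exists_contMDiff_symmetric_wordTrace hw, exists_contMDiff_wordTrace hw⟩⟩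
  exact (wordTrace_conj h).imp (fun h => h w hw) fun h => h w hw
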